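/- **Setting.** Consider an episodic MDP with horizon $H\ge 1$, a measurable state space $\mathcal S$, a finite action set $\mathcal A$, transition laws $\mathbb P_h(\cdot\mid s,a)$ and reward laws $\mathbb R_h(\cdot\mid s,a)$ on $[0,1]$; given $(s_h,a_h)$, the reward $r_h$ and the next state $s_{h+1}$ are independent. There are $K\ge1$ episodes; the (deterministic) initial state of episode $k$ is $s_{k,1}$ (for instance always the same $s_1$). For a policy $\pi$ let $Z^\pi=\sum_{h=1}^H r_h$, and for $\tau\in(0,1]$ let $$\operatorname{CVaR}_\tau(Z)=\max_{b}\{b-\tau^{-1}\mathbb E[(b-Z)^+]\}.$$ The augmented MDP has states $(s_h,y_h)$, where $y_{h+1}=y_h+r_h$. The MDP is a *discretized linear MDP* with a known feature map $\phi:\mathcal S\times\mathcal A\to\mathbb R^d$ and a uniform grid of $M$ points $-H\le z_1<\dots<z_M\le H$ if: all rewards lie on the grid; whatever policy is played, $y_h$ stays on the grid for $1\le h\le H+1$ when started at $y_1=-b$ for a grid point $b\ge 0$; and for every $h$ there are an (unknown) $\mathbb R^d$-valued measure $\mu_h$ on $\mathcal S$ and an (unknown) $\theta_h:\{z_i\}\to\mathbb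 R^d$ with $$\mathbb P_h(B\mid s,a)=\phi(s,a)^\top\mu_h(B),\qquad \mathbb R_h(z_i\mid s,a)=\phi(s,a)^\top\theta_h(z_i),$$ with the usual normalization $\|\phi(s,a)\|\le1$, $\|\mu_h(B)\|\le\sqrt d$ for all measurable $B$, and $\|\sum_{z\in Z}\theta_h(z)\|\le\sqrt d$ for all $Z\subseteq\{z_i\}$. **Algorithm (RSRL-Linear-CVaR).** Let $\psi(s,a)\in\mathbb R^{d^2}$ be the flattened matrix $\phi(s,a)\phi(s,a)^\top$, let $\delta\in(0,1)$ and $\beta=c_\beta d^2H\sqrt{M\log(2d^2MK/\delta)}$. In episode $k$, with data $(s_h^i,a_h^i,r_h^i)$ from the episodes $i<k$, put $V_{H+1}^k(s,y)=(-y)^+$ and for $h=H,\dots,1$ $$\Lambda_{k,h}=\sum_{i<k}\psi(s_h^i,a_h^i)\psi(s_h^i,a_h^i)^\top+\mathbf I,\qquad w_h^k(y)=\Lambda_{k,h}^{-1}\sum_{i<k}\psi(s_h^i,a_h^i)V_{h+1}^k(s_{h+1}^i,y+r_h^i),$$ $$Q_h^k(s,y,a)=\psi(s,a)^\top w_h^k(y)-\beta\|\psi(s,a)\|_{\Lambda_{k,h}^{-1}},\quad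 \pi_h^k(s,y)\in\arg\min_aQ_h^k(s,y,a),\quad V_h^k(s,y)=\max\{Q_h^k(s,y,\pi_h^k(s,y)),0\}.$$ Then choose $b_k\in\arg\max\{b-\tau^{-1}V_1^k(s_{k,1},-b)\}$ over the grid points $b\in[0,H]$, and execute $\pi^k$ in the augmented MDP from $(s_{k,1},-b_k)$. Ties are broken by an arbitrary fixed rule. **Theorem.** There are absolute constants $c_\beta,C>0$ and $p\in\mathbb N$ such that for every discretized linear MDP and all $K\geq 1$, $\tau\in(0,1]$, $\delta\in(0,1)$, with probability at least $1-\delta$, $$\operatorname{Regret}(K)=\sum_{k=1}^K\Big(\sup_{\pi}\operatorname{CVaR}_\tau(Z^{\pi})-\operatorname{CVaR}_\tau(Z^{\pi^k})\Big)\le C\,\tau^{-1}d^3H^2\sqrt{MK}\,\Big(\log\tfrac{2dHMK}{\delta}\Big)^p,$$ that is, $\operatorname{Regret}(K)\le\widetilde{\mathcal O}(\tau^{-1}d^3H^2\sqrt{MK})$. The supremum is over all (randomized) history-dependent policies started at $s_{k,1}$, and $Z^{\pi^k}$ is the return of the policy $\pi^k$ chosen in episode $k$, started at $(s_{k,1},-b_k)$.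 -/

import Mathlib

open MeasureTheory ProbabilityTheory
open scoped ENNReal Matrix

noncomputable section

namespace RiskRL

/-! ### Episodic MDPs with distributional rewards, policies and returns

Steps are numbered `0, …, H - 1` and episodes `0, …, K - 1`. -/

/-- An episodic Markov decision process: at step `h`, in state `s` and after action `a`, the reward
is drawn from `rew h (s, a)`, a distribution on `[0, 1]`, and the next state is drawn, independently
of the reward, from `trans h (s, a)`. -/
structure MDP (S A : Type*) [MeasurableSpace S] [MeasurableSpace A] where
  trans : ℕ → Kernel (S × A) S
  rew : ℕ → Kernel (S × A) ℝ
  trans_markov : ∀ h, IsMarkovKernel (trans h)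
  rew_markov : ∀ h, IsMarkovKernel (rew h)
  rew_mem : ∀ h p, rew h p (Set.Icc 0 1)ᶜ = 0

/-- A (randomized) history-dependent policy: the distribution of the action at step `h`, given the
states, actions and rewards of the steps before `h` and the state at step `h`. -/
abbrev HistPolicy (S A : Type*) := (h : ℕ) → (Fin h → S × A × ℝ) → S → PMF A

section General

variable {S A : Type*} [MeasurableSpace S] [MeasurableSpace A]

/-- The joint distribution of (next state, reward) at step `h`, as a function of (state, action). -/
def MDP.step (mdp : MDP S A) (h : ℕ) : Kernel (S × A) (S × ℝ) :=
  mdp.trans h ×ₖ mdp.rew h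

/-- Measurability of a history-dependent policy. -/
def HistPolicy.IsMeasurable (π : HistPolicy S A) : Prop :=
  ∀ (h : ℕ) (a : A), Measurable fun p : (Fin h → S × A × ℝ) × S => π h p.1 p.2 a

/-- The law of the sum of the rewards of the `n` steps `h, …, h + n - 1` when `π` is followed,
the steps before `h` have produced `hist`, and the state at step `h` is `s`. -/
def returnLaw [Fintype A] (mdp : MDP S A) (π : HistPolicy S A) :
    (n h : ℕ) → (Fin h → S × A × ℝ) → S → Measure ℝ
  | 0, _, _, _ => Measure.dirac 0
  | n + 1, h, hist, s =>
      ∑ a : A, (π h hist s a) •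
        (mdp.step h (s, a)).bind fun q =>
          (returnLaw mdp π n (h + 1)
            (Fin.snoc (α := fun _ => S × A × ℝ) hist (s, a, q.2)) q.1).map fun x => q.2 + x

/-- The law of the cumulative reward `Z^π` of the first `n` steps of an episode started at `s`. -/
def totalLaw [Fintype A] (mdp : MDP S A) (π : HistPolicy S A) (n : ℕ) (s : S) : Measure ℝ :=
  returnLaw mdp π n 0 Fin.elim0 s

/-- `CVaR_τ` of a distribution `ν` of returns: `max_b {b - τ⁻¹ 𝔼[(b - Z)⁺]}`, where `Z ∼ ν`. -/
def cvar (τ : ℝ) (ν : Measure ℝ) : ℝ :=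
  ⨆ b : ℝ, (b - τ⁻¹ * ∫ x, max (b - x) 0 ∂ν)

/-- The optimal `CVaR_τ` of the return over `H` steps, among all history-dependent policies. -/
def optCVaR [Fintype A] (mdp : MDP S A) (H : ℕ) (τ : ℝ) (s : S) : ℝ :=
  ⨆ π : {π : HistPolicy S A // π.IsMeasurable}, cvar τ (totalLaw mdp π.1 H s)

/-- The history-dependent policy obtained from a deterministic Markov policy `π` of the augmented
MDP, whose states are the pairs `(s_h, y_h)` with `y_h = y₁ + r_1 + ⋯ + r_{h-1}`. -/
def augPolicy (π : ℕ → S → ℝ → A) (y₁ : ℝ) : HistPolicy S A :=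
  fun h hist s => PMF.pure (π h s (y₁ + ∑ i : Fin h, (hist i).2.2))

end General

/-! ### Discretized linear MDPs -/

/-- The uniform grid `{z₀, z₀ + η, …, z₀ + (M - 1) η}`. -/
def uniformGrid (z₀ η : ℝ) (M : ℕ) : Finset ℝ :=
  (Finset.range M).image fun i : ℕ => z₀ + i * η

/-- A discretized linear MDP with horizon `H`, feature map `φ`, grid `G`, and initial states `s₁ k`
(`k` is the episode). -/
structure IsDiscretizedLinear {S A : Type*} [MeasurableSpace S] [MeasurableSpace A] [Fintype A]
    {d : ℕ} (mdp : MDP S A) (H : ℕ) (φ : S → A → EuclideanSpace ℝ (Fin d)) (G : Finset ℝ)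
    (s₁ : ℕ → S) : Prop where
  /-- The grid lies in `[-H, H]`. -/
  grid_bound : ∀ z ∈ G, |z| ≤ (H : ℝ)
  /-- Rewards lie on the grid. -/
  rew_grid : ∀ h < H, ∀ p : S × A, mdp.rew h p (↑G)ᶜ = 0
  /-- The augmented coordinate `y_h`, started at `-b` for a grid point `b ≥ 0`, stays on the grid,
  whatever policy is played. -/
  aug_grid : ∀ π : HistPolicy S A, π.IsMeasurable → ∀ (k : ℕ), ∀ n ≤ H, ∀ b ∈ G, 0 ≤ b →
    totalLaw mdp π n (s₁ k) {x | -b + x ∉ G} = 0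
  feature_measurable : ∀ a, Measurable fun s => φ s a
  feature_norm : ∀ s a, ‖φ s a‖ ≤ 1
  /-- The transition probabilities are linear in the features. -/
  trans_linear : ∀ h < H, ∃ μ : VectorMeasure S (EuclideanSpace ℝ (Fin d)),
    (∀ B, MeasurableSet B → ‖μ B‖ ≤ √(d : ℝ)) ∧
    ∀ s a B, MeasurableSet B → (mdp.trans h (s, a)).real B = inner ℝ (φ s a) (μ B)
  /-- The reward probabilities are linear in the features. -/
  rew_linear : ∀ h < H, ∃ θ : ℝ → EuclideanSpace ℝ (Fin d),
    (∀ Z ⊆ G, ‖∑ z ∈ Z, θ z‖ ≤ √(d : ℝ)) ∧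
    ∀ s a, ∀ z ∈ G, (mdp.rew h (s, a)).real {z} = inner ℝ (φ s a) (θ z)

/-! ### The algorithm `RSRL-Linear-CVaR` -/

/-- The `d²`-dimensional feature `ψ(s, a)`, the flattened matrix `φ(s, a) φ(s, a)ᵀ`. -/
def psi {S A : Type*} {d : ℕ} (φ : S → A → EuclideanSpace ℝ (Fin d)) (s : S) (a : A) :
    Fin d × Fin d → ℝ :=
  fun ij => φ s a ij.1 * φ s a ij.2

/-- The fixed input of the algorithm: horizon, features, grid, risk level, bonus coefficient `β`,
regularization `lam`, and the rules that break ties between minimizing actions and between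
maximizing grid points. -/
structure Input (S A : Type*) (d : ℕ) where
  H : ℕ
  φ : S → A → EuclideanSpace ℝ (Fin d)
  grid : Finset ℝ
  τ : ℝ
  β : ℝ
  lam : ℝ
  tieA : Finset A → A
  tieB : Finset ℝ → ℝ

/-- The observed data: state, action and reward at a given episode and step. -/
structure Data (S A : Type*) where
  st : ℕ → ℕ → S
  ac : ℕ → ℕ → A
  rw : ℕ → ℕ → ℝ

namespace Input

variable {S A : Type*} {d : ℕ} (I : Input S A d) (D : Data S A)

/-- The regularized Gram matrix `Λ_{k,h}` of the episodes before `k`. -/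
def gram (k h : ℕ) : Matrix (Fin d × Fin d) (Fin d × Fin d) ℝ :=
  ∑ i ∈ Finset.range k,
      Matrix.vecMulVec (psi I.φ (D.st i h) (D.ac i h)) (psi I.φ (D.st i h) (D.ac i h)) +
    I.lam • (1 : Matrix (Fin d × Fin d) (Fin d × Fin d) ℝ)

/-- The ridge regression weight `w_h^k(y)` for the next value function `V`. -/
def weight (k h : ℕ) (V : S → ℝ → ℝ) (y : ℝ) : Fin d × Fin d → ℝ :=
  (I.gram D k h)⁻¹ *ᵥ
    ∑ i ∈ Finset.range k,
      V (D.st i (h + 1)) (y + D.rw i h) • psi I.φ (D.st i h) (D.ac i h)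

/-- The bonus `b_h^k(s, a) = β ‖ψ(s, a)‖_{Λ⁻¹}`. -/
def bonus (k h : ℕ) (s : S) (a : A) : ℝ :=
  I.β * √(psi I.φ s a ⬝ᵥ ((I.gram D k h)⁻¹ *ᵥ psi I.φ s a))

/-- The estimate of `Q_h` built from the next value function `V`. -/
def qOf (k h : ℕ) (V : S → ℝ → ℝ) (s : S) (y : ℝ) (a : A) : ℝ :=
  psi I.φ s a ⬝ᵥ I.weight D k h V y - I.bonus D k h s a

variable [Fintype A]

open Classical in
/-- An action that minimizes `q`, chosen by the tie-breaking rule. -/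
def argminAct (q : A → ℝ) : A :=
  I.tieA (Finset.univ.filter fun a => ∀ a', q a ≤ q a')

/-- The value function of episode `k` with `n` steps to go, that is, at step `H - n`. -/
def vToGo (k : ℕ) : ℕ → S → ℝ → ℝ
  | 0 => fun _ y => max (-y) 0
  | n + 1 => fun s y =>
      max (I.qOf D k (I.H - (n + 1)) (vToGo k n) s y
        (I.argminAct (I.qOf D k (I.H - (n + 1)) (vToGo k n) s y))) 0

/-- `Q_h^k(s, y, a)`, for `h < H`. -/
def Q (k h : ℕ) (s : S) (y : ℝ) (a : A) : ℝ :=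
  I.qOf D k h (I.vToGo D k (I.H - (h + 1))) s y a

/-- The policy `π^k` of episode `k`, greedy for `Q^k`. -/
def policy (k h : ℕ) (s : S) (y : ℝ) : A :=
  I.argminAct (I.Q D k h s y)

/-- The value that the choice of `b` maximizes, `b - τ⁻¹ V_1^k(s₁, -b)`. -/
def objective (k : ℕ) (s : S) (b : ℝ) : ℝ :=
  b - I.τ⁻¹ * I.vToGo D k I.H s (-b)

open Classical in
/-- The budget `b_k`: a maximizer of the objective among the grid points in `[0, H]`, chosen by the
tie-breaking rule. -/
def budget (k : ℕ) (s : S) : ℝ :=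
  I.tieB ((I.grid.filter fun b => 0 ≤ b).filter fun b =>
    ∀ b' ∈ I.grid, 0 ≤ b' → I.objective D k s b' ≤ I.objective D k s b)

end Input

/-! ### Runs of the algorithm and the regret -/

/-- The information available at step `h` of episode `k`, right after the action is chosen. -/
abbrev past {Ω S A : Type*} [MeasurableSpace S] [MeasurableSpace A] (H : ℕ) (D : Ω → Data S A)
    (k h : ℕ) : MeasurableSpace Ω :=
  (⨆ i < k, ⨆ j ≤ H, MeasurableSpace.comap (fun ω => (D ω).st i j) inferInstance) ⊔
  (⨆ i < k, ⨆ j < H, MeasurableSpace.comap (fun ω => ((D ω).ac i j, (D ω).rw i j)) inferInstance) ⊔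
  (⨆ j ≤ h, MeasurableSpace.comap (fun ω => ((D ω).st k j, (D ω).ac k j)) inferInstance) ⊔
  (⨆ j < h, MeasurableSpace.comap (fun ω => (D ω).rw k j) inferInstance)

/-- `D` is the random data produced by running the algorithm with input `I` for `K` episodes in
`mdp`, episode `k` being started at `s₁ k` (at `(s₁ k, -b_k)` in the augmented MDP). -/
structure IsRun {Ω S A : Type*} [MeasurableSpace Ω] [MeasurableSpace S] [MeasurableSpace A]
    [Fintype A] {d : ℕ} (Pr : Measure Ω) (mdp : MDP S A) (I : Input S A d) (s₁ : ℕ → S) (K : ℕ)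
    (D : Ω → Data S A) : Prop where
  measurable_st : ∀ k < K, ∀ h ≤ I.H, Measurable fun ω => (D ω).st k h
  measurable_ac : ∀ k < K, ∀ h < I.H, Measurable fun ω => (D ω).ac k h
  measurable_rw : ∀ k < K, ∀ h < I.H, Measurable fun ω => (D ω).rw k h
  init : ∀ k < K, ∀ ω, (D ω).st k 0 = s₁ k
  action : ∀ k < K, ∀ h < I.H, ∀ ω, (D ω).ac k h =
    I.policy (D ω) k h ((D ω).st k h)
      (-I.budget (D ω) k (s₁ k) + ∑ j ∈ Finset.range h, (D ω).rw k j)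
  /-- Given the past, next state and reward are distributed as the MDP prescribes. -/
  dynamics : ∀ k < K, ∀ h < I.H, ∀ C : Set Ω, MeasurableSet[past I.H D k h] C →
    ∀ B : Set (S × ℝ), MeasurableSet B →
      Pr (C ∩ {ω | ((D ω).st k (h + 1), (D ω).rw k h) ∈ B}) =
        ∫⁻ ω in C, mdp.step h ((D ω).st k h, (D ω).ac k h) B ∂Pr

/-- The regret of the algorithm over `K` episodes when the observed data are `D`: the sum over
episodes of the optimal `CVaR_τ` minus the `CVaR_τ` of the return of the policy played. -/
def regret {S A : Type*} [MeasurableSpace S] [MeasurableSpace A] [Fintype A] {d : ℕ}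
    (mdp : MDP S A) (I : Input S A d) (s₁ : ℕ → S) (K : ℕ) (D : Data S A) : ℝ :=
  ∑ k ∈ Finset.range K,
    (optCVaR mdp I.H I.τ (s₁ k) -
      cvar I.τ (totalLaw mdp (augPolicy (I.policy D k) (-I.budget D k (s₁ k))) I.H (s₁ k)))

/-- The bonus coefficient `β = c d² H √(M log(2 d² M K / δ))`. -/
def betaCoeff (c : ℝ) (d H M K : ℕ) (δ : ℝ) : ℝ :=
  c * (d : ℝ) ^ 2 * H * √(M * Real.log (2 * (d : ℝ) ^ 2 * M * K / δ))

end RiskRL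

end

/-! For fixed b, maximizing b - τ⁻¹ E(b - Z)⁺ over policies means minimizing the expected shortfall
(b - Z)⁺, a dynamic program on augmented states (s, y) with y = -b + collected reward. A run of the
algorithm is optimistic least-squares value iteration for this program, and the proof has four
ingredients.

Linearity and regression: a one-step expectation of V(s', y + r) equals ∑ z ⟨φ, θ z⟩⟨φ, v z⟩, which
is linear in ψ = φφᵀ with weights at most 2d (`IsDiscretizedLinear.exists_weight`). Ridge regression
therefore estimates it with error at most ‖ψ‖ in the inverse Gram norm times a self-normalized noise
sum plus a bias (`ridge_regression_error`).

Uniform concentration: the regressed V depends on the same data, so the noise must be controlled for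
a whole class. For fixed y, the map (s', r) ↦ V(s', y + r) is described by one weight vector per
reward value, one matrix, and one truncation level per reward value. A finite net of this class has
log-cardinality of order M d⁴ log, the same for all y. The bound for one function
(`measure_selfNormalized_le`) comes from an exponential supermartingale, and a union bound over the
net explains the order d² H √M of β. On the resulting event every estimate is within its bonus of
the true expectation (`IsAccurate`).

Optimism: on this event the estimates lie below the shortfall of every history-dependent policy
(`IsAccurate.le_shortfall`), and the shortfall of the greedy policy exceeds its estimate by at most
2β times its expected feature widths (`IsAccurate.shortfall_le`). Returns live on the grid, where
the `CVaR` maximum is attained at a nonnegative grid point, so the choice of b_k loses nothing and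
an episode costs at most τ⁻¹ · 2β · (expected width) (`IsAccurate.optCVaR_sub_cvar_le`).

Summation: expected widths are at most twice the observed ones plus O(H log(1/δ))
(`IsRun.measure_meanWidth_le`), and the observed ones add up to H √(K d² log) by the elliptical
potential bound (`sum_sqrt_invNormSq_le`). This argument is run for K > H²; for K ≤ H² the trivial
bound K H ≤ H² √K suffices. -/

noncomputable section

set_option linter.unusedSectionVars false

namespace RiskRL

/-! ### Ridge regression Gram matrices and elliptical potentials -/

section Ridge

variable {ι : Type*} [Fintype ι] [DecidableEq ι]

/-- The Gram matrix of the first `k` vectors of `x`, regularized by the identity. -/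
def ridge (x : ℕ → ι → ℝ) (k : ℕ) : Matrix ι ι ℝ :=
  ∑ i ∈ Finset.range k, Matrix.vecMulVec (x i) (x i) + 1

/-- The squared norm `v ⬝ A⁻¹ v`. -/
def invNormSq (A : Matrix ι ι ℝ) (v : ι → ℝ) : ℝ := v ⬝ᵥ (A⁻¹ *ᵥ v)

lemma ridge_succ (x : ℕ → ι → ℝ) (k : ℕ) :
    ridge x (k + 1) = ridge x k + Matrix.vecMulVec (x k) (x k) := by
  simp only [ridge, Finset.sum_range_succ]
  abel

lemma posSemidef_vecMulVec_self (v : ι → ℝ) : (Matrix.vecMulVec v v).PosSemidef := by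
  simpa using Matrix.posSemidef_vecMulVec_self_star v

lemma ridge_posDef (x : ℕ → ι → ℝ) (k : ℕ) : (ridge x k).PosDef :=
  Matrix.PosDef.posSemidef_add
    (Matrix.posSemidef_sum _ fun i _ => posSemidef_vecMulVec_self (x i)) Matrix.PosDef.one

lemma dotProduct_mulVec_comm_of_isHermitian {A : Matrix ι ι ℝ} (hA : A.IsHermitian)
    (u v : ι → ℝ) : u ⬝ᵥ (A *ᵥ v) = v ⬝ᵥ (A *ᵥ u) := by
  have hT : Aᵀ = A := by rw [← Matrix.conjTranspose_eq_transpose_of_trivial]; exact hA.eq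
  rw [Matrix.dotProduct_mulVec, dotProduct_comm, ← Matrix.mulVec_transpose, hT]

lemma mulVec_inv_mulVec {A : Matrix ι ι ℝ} (hA : A.PosDef) (v : ι → ℝ) :
    A *ᵥ (A⁻¹ *ᵥ v) = v := by
  rw [Matrix.mulVec_mulVec, Matrix.mul_nonsing_inv _ (isUnit_iff_ne_zero.2 hA.det_pos.ne'),
    Matrix.one_mulVec]

lemma inv_mulVec_mulVec {A : Matrix ι ι ℝ} (hA : A.PosDef) (v : ι → ℝ) :
    A⁻¹ *ᵥ (A *ᵥ v) = v := by
  rw [Matrix.mulVec_mulVec, Matrix.nonsing_inv_mul _ (isUnit_iff_ne_zero.2 hA.det_pos.ne'),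
    Matrix.one_mulVec]

lemma invNormSq_nonneg {A : Matrix ι ι ℝ} (hA : A.PosDef) (v : ι → ℝ) : 0 ≤ invNormSq A v := by
  simpa [invNormSq] using hA.inv.posSemidef.dotProduct_mulVec_nonneg v

lemma invNormSq_zero (A : Matrix ι ι ℝ) : invNormSq A 0 = 0 := by
  simp [invNormSq]

lemma invNormSq_add {A : Matrix ι ι ℝ} (hA : A.PosDef) (u v : ι → ℝ) :
    invNormSq A (u + v) = invNormSq A u + 2 * (u ⬝ᵥ (A⁻¹ *ᵥ v)) + invNormSq A v := by
  simp only [invNormSq, Matrix.mulVec_add, add_dotProduct, dotProduct_add]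
  rw [dotProduct_mulVec_comm_of_isHermitian hA.inv.isHermitian v u]
  ring

lemma invNormSq_smul (A : Matrix ι ι ℝ) (t : ℝ) (v : ι → ℝ) :
    invNormSq A (t • v) = t ^ 2 * invNormSq A v := by
  simp only [invNormSq, Matrix.mulVec_smul, smul_dotProduct, dotProduct_smul, smul_eq_mul]
  ring

/-- The Cauchy–Schwarz inequality for the inner product given by `A⁻¹`. -/
lemma abs_dotProduct_inv_mulVec_le {A : Matrix ι ι ℝ} (hA : A.PosDef) (u v : ι → ℝ) :
    |u ⬝ᵥ (A⁻¹ *ᵥ v)| ≤ √(invNormSq A u) * √(invNormSq A v) := by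
  have h := discrim_le_zero (a := invNormSq A v) (b := 2 * (u ⬝ᵥ (A⁻¹ *ᵥ v)))
    (c := invNormSq A u) fun t => by
      have h0 := invNormSq_nonneg hA (u + t • v)
      rw [invNormSq_add hA, invNormSq_smul, Matrix.mulVec_smul, dotProduct_smul, smul_eq_mul] at h0
      linarith
  rw [discrim] at h
  rw [← Real.sqrt_mul (invNormSq_nonneg hA u)]
  apply Real.abs_le_sqrt
  linarith

lemma sqrt_invNormSq_add_le {A : Matrix ι ι ℝ} (hA : A.PosDef) (u v : ι → ℝ) :
    √(invNormSq A (u + v)) ≤ √(invNormSq A u) + √(invNormSq A v) := by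
  rw [Real.sqrt_le_left (by positivity), invNormSq_add hA, add_sq,
    Real.sq_sqrt (invNormSq_nonneg hA u), Real.sq_sqrt (invNormSq_nonneg hA v)]
  have := (le_abs_self _).trans (abs_dotProduct_inv_mulVec_le hA u v)
  linarith

lemma sqrt_invNormSq_smul (A : Matrix ι ι ℝ) (t : ℝ) (v : ι → ℝ) :
    √(invNormSq A (t • v)) = |t| * √(invNormSq A v) := by
  rw [invNormSq_smul, Real.sqrt_mul (sq_nonneg t), Real.sqrt_sq_eq_abs]

lemma sqrt_invNormSq_sum_le {A : Matrix ι ι ℝ} (hA : A.PosDef) {κ : Type*} (s : Finset κ)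
    (v : κ → ι → ℝ) : √(invNormSq A (∑ i ∈ s, v i)) ≤ ∑ i ∈ s, √(invNormSq A (v i)) := by
  classical
  induction s using Finset.induction_on with
  | empty => simp [invNormSq_zero]
  | insert a s ha ih =>
    rw [Finset.sum_insert ha, Finset.sum_insert ha]
    exact (sqrt_invNormSq_add_le hA _ _).trans (by linarith)

lemma dotProduct_self_le_ridge (x : ℕ → ι → ℝ) (k : ℕ) (u : ι → ℝ) :
    u ⬝ᵥ u ≤ u ⬝ᵥ (ridge x k *ᵥ u) := by
  have h : (∑ i ∈ Finset.range k, Matrix.vecMulVec (x i) (x i)).PosSemidef :=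
    Matrix.posSemidef_sum _ fun i _ => posSemidef_vecMulVec_self (x i)
  have h0 := h.dotProduct_mulVec_nonneg u
  rw [star_trivial] at h0
  rw [ridge, Matrix.add_mulVec, dotProduct_add, Matrix.one_mulVec]
  linarith

lemma dotProduct_self_nonneg' (u : ι → ℝ) : 0 ≤ u ⬝ᵥ u :=
  Finset.sum_nonneg fun i _ => mul_self_nonneg (u i)

lemma dotProduct_sq_le (u v : ι → ℝ) : (u ⬝ᵥ v) ^ 2 ≤ (u ⬝ᵥ u) * (v ⬝ᵥ v) := by
  simpa [dotProduct, sq] using Finset.sum_mul_sq_le_sq_mul_sq Finset.univ u v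

/-- The ridge matrix A dominates the identity, so u = A⁻¹v satisfies u·u ≤ u·Au = v·u;
Cauchy–Schwarz then gives v·u ≤ v·v. -/
lemma dotProduct_ridge_inv_le (x : ℕ → ι → ℝ) (k : ℕ) (v : ι → ℝ) :
    (((ridge x k)⁻¹ *ᵥ v) ⬝ᵥ ((ridge x k)⁻¹ *ᵥ v) ≤ invNormSq (ridge x k) v) ∧
      invNormSq (ridge x k) v ≤ v ⬝ᵥ v := by
  set u := (ridge x k)⁻¹ *ᵥ v with hu
  have h1 : u ⬝ᵥ u ≤ v ⬝ᵥ u := by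
    have := dotProduct_self_le_ridge x k u
    rwa [hu, mulVec_inv_mulVec (ridge_posDef x k), ← hu, dotProduct_comm u v] at this
  refine ⟨h1, ?_⟩
  change v ⬝ᵥ u ≤ v ⬝ᵥ v
  have h2 := dotProduct_sq_le v u
  have h3 := dotProduct_self_nonneg' v
  have h4 := dotProduct_self_nonneg' u
  by_contra! hlt
  nlinarith [mul_le_mul_of_nonneg_left h1 h3]

lemma inv_apply_sq_le (x : ℕ → ι → ℝ) (k : ℕ) (v : ι → ℝ) (i : ι) :
    (((ridge x k)⁻¹ *ᵥ v) i) ^ 2 ≤ v ⬝ᵥ v := by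
  obtain ⟨h1, h2⟩ := dotProduct_ridge_inv_le x k v
  refine le_trans ?_ (h1.trans h2)
  rw [sq]
  exact Finset.single_le_sum (f := fun j => ((ridge x k)⁻¹ *ᵥ v) j * ((ridge x k)⁻¹ *ᵥ v) j)
    (fun j _ => mul_self_nonneg _) (Finset.mem_univ i)

/-- This confines the matrices in the bonus to entries in [-1, 1], the range covered by the net. -/
lemma abs_ridge_inv_apply_le (x : ℕ → ι → ℝ) (k : ℕ) (i j : ι) :
    |(ridge x k)⁻¹ i j| ≤ 1 := by
  have h := inv_apply_sq_le x k (Pi.single j 1) i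
  rw [Matrix.mulVec_single_one] at h
  simp only [Matrix.col_apply, dotProduct_single, Pi.single_eq_same, mul_one] at h
  exact abs_le_one_iff_mul_self_le_one.2 (by rwa [← sq])

/-- The rank-one update of the squared norm of `S + e • v`. -/
lemma invNormSq_rankOne_update {A : Matrix ι ι ℝ} (hA : A.PosDef) (S v : ι → ℝ) (e : ℝ) :
    invNormSq (A + Matrix.vecMulVec v v) (S + e • v) = invNormSq A S +
      (2 * e * (v ⬝ᵥ (A⁻¹ *ᵥ S)) + e ^ 2 * invNormSq A v - (v ⬝ᵥ (A⁻¹ *ᵥ S)) ^ 2) /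
        (1 + invNormSq A v) := by
  have hq := invNormSq_nonneg hA v
  have hA' : (A + Matrix.vecMulVec v v).PosDef := hA.add_posSemidef (posSemidef_vecMulVec_self v)
  set m := v ⬝ᵥ (A⁻¹ *ᵥ S) with hm
  set q := invNormSq A v with hqd
  set t := (e - m) / (1 + q) with ht
  have ht' : t * (1 + q) = e - m := by rw [ht]; field_simp
  -- Sherman–Morrison in vector form: the updated linear system is solved explicitly, and `t` is the
  -- value that matches the coefficients of `v`.
  have key : (A + Matrix.vecMulVec v v) *ᵥ (A⁻¹ *ᵥ S + t • (A⁻¹ *ᵥ v)) = S + e • v := by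
    rw [Matrix.add_mulVec, Matrix.mulVec_add, Matrix.mulVec_smul, mulVec_inv_mulVec hA,
      mulVec_inv_mulVec hA, Matrix.vecMulVec_mulVec, dotProduct_add, dotProduct_smul, ← hm]
    change S + t • v + MulOpposite.op (m + t • q) • v = _
    rw [op_smul_eq_smul, add_assoc, ← add_smul]
    congr 2
    simp only [smul_eq_mul]
    linarith
  have hinv : (A + Matrix.vecMulVec v v)⁻¹ *ᵥ (S + e • v) = A⁻¹ *ᵥ S + t • (A⁻¹ *ᵥ v) := by
    rw [← key, inv_mulVec_mulVec hA']
  rw [invNormSq, hinv]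
  simp only [dotProduct_add, add_dotProduct, dotProduct_smul, smul_dotProduct, smul_eq_mul, ← hm]
  rw [dotProduct_mulVec_comm_of_isHermitian hA.inv.isHermitian S v, ← hm]
  change invNormSq A S + e * m + t * (m + e * q) = _
  rw [ht]
  field_simp
  ring

lemma det_add_vecMulVec_self {A : Matrix ι ι ℝ} (hA : A.PosDef) (v : ι → ℝ) :
    (A + Matrix.vecMulVec v v).det = A.det * (1 + invNormSq A v) := by
  rw [Matrix.vecMulVec_eq Unit,
    Matrix.det_add_replicateCol_mul_replicateRow (isUnit_iff_ne_zero.2 hA.det_pos.ne'),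
    Matrix.mul_assoc, ← Matrix.replicateCol_mulVec,
    Matrix.det_unique (1 + Matrix.replicateRow Unit v * _), Matrix.add_apply, Matrix.one_apply_eq,
    Matrix.replicateRow_mul_replicateCol_apply, invNormSq]

/-- Each eigenvalue is at most the trace. This is cruder than the arithmetic–geometric mean
inequality, but only the logarithm of the determinant matters. -/
lemma ridge_det_le (x : ℕ → ι → ℝ) (hx : ∀ i, x i ⬝ᵥ x i ≤ 1) (k : ℕ) :
    (ridge x k).det ≤ (Fintype.card ι + k : ℝ) ^ Fintype.card ι := by
  have hP := ridge_posDef x k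
  have htr : (ridge x k).trace ≤ Fintype.card ι + k := by
    rw [ridge, Matrix.trace_add, Matrix.trace_one, Matrix.trace_sum, add_comm]
    gcongr
    calc ∑ i ∈ Finset.range k, (Matrix.vecMulVec (x i) (x i)).trace
        ≤ ∑ i ∈ Finset.range k, (1 : ℝ) := Finset.sum_le_sum fun i _ => by
          rw [Matrix.trace_vecMulVec]; exact hx i
      _ = k := by simp
  have htr' := hP.isHermitian.trace_eq_sum_eigenvalues
  simp only [RCLike.ofReal_real_eq_id, id_eq] at htr'
  rw [hP.isHermitian.det_eq_prod_eigenvalues]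
  simp only [RCLike.ofReal_real_eq_id, id_eq]
  rw [← Finset.card_univ, ← Finset.prod_const]
  refine Finset.prod_le_prod (fun i _ => hP.posSemidef.eigenvalues_nonneg i) fun i _ => ?_
  rw [Finset.card_univ]
  refine le_trans ?_ htr
  rw [htr']
  exact Finset.single_le_sum (f := fun j => hP.isHermitian.eigenvalues j)
    (fun j _ => hP.posSemidef.eigenvalues_nonneg j) (Finset.mem_univ i)

/-- The elliptical potential bound. -/
lemma sum_potential_le (x : ℕ → ι → ℝ) (hx : ∀ i, x i ⬝ᵥ x i ≤ 1) (k : ℕ) :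
    ∑ i ∈ Finset.range k, invNormSq (ridge x i) (x i) / (1 + invNormSq (ridge x i) (x i)) ≤
      Fintype.card ι * Real.log (Fintype.card ι + k) := by
  have h : ∑ i ∈ Finset.range k, invNormSq (ridge x i) (x i) / (1 + invNormSq (ridge x i) (x i)) ≤
      Real.log (ridge x k).det := by
    induction k with
    | zero => simp [ridge]
    | succ k ih =>
      have hq := invNormSq_nonneg (ridge_posDef x k) (x k)
      rw [Finset.sum_range_succ, ridge_succ, det_add_vecMulVec_self (ridge_posDef x k),
        Real.log_mul (ridge_posDef x k).det_pos.ne' (by positivity)]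
      -- The determinant is multiplied by 1 + q, and log(1 + q) ≥ 1 - 1/(1 + q) = q/(1 + q), so the
      -- sum telescopes.
      have := Real.one_sub_inv_le_log_of_pos (x := 1 + invNormSq (ridge x k) (x k)) (by positivity)
      have e : 1 - (1 + invNormSq (ridge x k) (x k))⁻¹ =
          invNormSq (ridge x k) (x k) / (1 + invNormSq (ridge x k) (x k)) := by
        field_simp
        ring
      linarith
  refine h.trans ?_
  rw [← Real.log_pow]
  exact Real.log_le_log (ridge_posDef x k).det_pos (ridge_det_le x hx k)

/-- The sum of the norms of the features is at most `√(2 k n log (n + k))`. -/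
lemma sum_sqrt_invNormSq_le (x : ℕ → ι → ℝ) (hx : ∀ i, x i ⬝ᵥ x i ≤ 1) (k : ℕ) :
    ∑ i ∈ Finset.range k, √(invNormSq (ridge x i) (x i)) ≤
      √(k * (2 * (Fintype.card ι * Real.log (Fintype.card ι + k)))) := by
  have hq := fun i => invNormSq_nonneg (ridge_posDef x i) (x i)
  have hq1 := fun i => ((dotProduct_ridge_inv_le x i (x i)).2).trans (hx i)
  -- Since 0 ≤ q ≤ 1, q ≤ 2q/(1 + q).
  have h1 : ∑ i ∈ Finset.range k, invNormSq (ridge x i) (x i) ≤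
      2 * (Fintype.card ι * Real.log (Fintype.card ι + k)) := by
    refine le_trans ?_ (mul_le_mul_of_nonneg_left (sum_potential_le x hx k) zero_le_two)
    rw [Finset.mul_sum]
    refine Finset.sum_le_sum fun i _ => ?_
    have := hq i
    have := hq1 i
    rw [← mul_div_assoc, le_div_iff₀ (by positivity)]
    nlinarith
  apply Real.le_sqrt_of_sq_le
  have h2 := Finset.sum_mul_sq_le_sq_mul_sq (Finset.range k) (fun _ => (1 : ℝ))
    (fun i => √(invNormSq (ridge x i) (x i)))
  simp only [one_mul, one_pow, Finset.sum_const, Finset.card_range, nsmul_eq_mul, mul_one] at h2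
  refine h2.trans (mul_le_mul_of_nonneg_left ?_ (by positivity))
  refine le_trans (le_of_eq ?_) h1
  exact Finset.sum_congr rfl fun i _ => Real.sq_sqrt (hq i)

end Ridge

/-! ### Measurability of matrix expressions -/

section MatrixMeasurability

variable {E : Type*} {mE : MeasurableSpace E} {ι : Type*} [Fintype ι] [DecidableEq ι]

lemma measurable_dotProduct {u v : E → ι → ℝ} (hu : ∀ j, Measurable fun e => u e j)
    (hv : ∀ j, Measurable fun e => v e j) : Measurable fun e => u e ⬝ᵥ v e := by
  simp only [dotProduct]
  exact Finset.measurable_sum _ fun j _ => (hu j).mul (hv j)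

lemma measurable_mulVec {A : E → Matrix ι ι ℝ} {v : E → ι → ℝ}
    (hA : ∀ i j, Measurable fun e => A e i j) (hv : ∀ j, Measurable fun e => v e j) (i : ι) :
    Measurable fun e => (A e *ᵥ v e) i := by
  simp only [Matrix.mulVec]
  exact measurable_dotProduct (hA i) hv

lemma measurable_det {A : E → Matrix ι ι ℝ} (hA : ∀ i j, Measurable fun e => A e i j) :
    Measurable fun e => (A e).det := by
  simp only [Matrix.det_apply]
  refine Finset.measurable_sum _ fun σ _ => Measurable.const_smul ?_ _
  exact Finset.measurable_prod _ fun i _ => hA _ _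

/-- By Cramer's rule the entries of the inverse are quotients of polynomials in the entries. -/
lemma measurable_inv_apply {A : E → Matrix ι ι ℝ} (hA : ∀ i j, Measurable fun e => A e i j)
    (i j : ι) : Measurable fun e => (A e)⁻¹ i j := by
  simp only [Matrix.inv_def, Ring.inverse_eq_inv', Matrix.smul_apply, smul_eq_mul,
    Matrix.adjugate_apply]
  refine (measurable_det hA).inv.mul (measurable_det fun a b => ?_)
  simp only [Matrix.updateRow_apply]
  split_ifs
  · exact measurable_const
  · exact hA a b

lemma measurable_invNormSq {A : E → Matrix ι ι ℝ} {v : E → ι → ℝ}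
    (hA : ∀ i j, Measurable fun e => A e i j) (hv : ∀ j, Measurable fun e => v e j) :
    Measurable fun e => invNormSq (A e) (v e) :=
  measurable_dotProduct hv (measurable_mulVec (measurable_inv_apply hA) hv)

lemma measurable_ridge_apply {x : E → ℕ → ι → ℝ} {k : ℕ}
    (hx : ∀ i < k, ∀ j, Measurable fun e => x e i j) (a b : ι) :
    Measurable fun e => ridge (x e) k a b := by
  simp only [ridge, Matrix.add_apply, Matrix.sum_apply, Matrix.vecMulVec_apply]
  refine Measurable.add_const (Finset.measurable_sum _ fun i hi => ?_) _
  exact (hx i (Finset.mem_range.1 hi) a).mul (hx i (Finset.mem_range.1 hi) b)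

end MatrixMeasurability

/-! ### Disintegration along a kernel -/

section Disintegration

variable {Ω E Q : Type*} {mΩ : MeasurableSpace Ω} {mE : MeasurableSpace E} {mQ : MeasurableSpace Q}

/-- Rectangles determine a finite measure on a product. In the application `T` is the identity of Ω
into Ω with the σ-algebra of the past, so that the identity encodes the conditional law given the
past. -/
lemma map_prodMk_eq_compProd (P : Measure Ω) [IsFiniteMeasure P] {T : Ω → E} (hT : Measurable T)
    {X : Ω → Q} (hX : Measurable X) (κ : Kernel E Q) [IsMarkovKernel κ]
    (h : ∀ C, MeasurableSet C → ∀ B, MeasurableSet B →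
      P (T ⁻¹' C ∩ X ⁻¹' B) = ∫⁻ ω in T ⁻¹' C, κ (T ω) B ∂P) :
    P.map (fun ω => (T ω, X ω)) = (P.map T) ⊗ₘ κ := by
  have : IsFiniteMeasure (P.map fun ω => (T ω, X ω)) := inferInstance
  refine Measure.ext_prod fun {s t} hs ht => ?_
  rw [Measure.map_apply (hT.prodMk hX) (hs.prod ht), Measure.compProd_apply_prod hs ht,
    setLIntegral_map hs (κ.measurable_coe ht) hT]
  exact h s hs t ht

lemma lintegral_eq_of_map_prodMk (P : Measure Ω) [IsFiniteMeasure P] {T : Ω → E}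
    (hT : Measurable T) {X : Ω → Q} (hX : Measurable X) (κ : Kernel E Q) [IsMarkovKernel κ]
    (h : P.map (fun ω => (T ω, X ω)) = (P.map T) ⊗ₘ κ) {F : E × Q → ℝ≥0∞} (hF : Measurable F) :
    ∫⁻ ω, F (T ω, X ω) ∂P = ∫⁻ ω, ∫⁻ q, F (T ω, q) ∂κ (T ω) ∂P := by
  rw [← lintegral_map hF (hT.prodMk hX), h, Measure.lintegral_compProd hF,
    lintegral_map (Measurable.lintegral_kernel_prod_right' hF) hT]

/-- Hoeffding's lemma for a function with values in `[0, 1]`. -/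
lemma lintegral_exp_centered_le (μ : Measure Q) [IsProbabilityMeasure μ] {f : Q → ℝ}
    (hf : Measurable f) (hf01 : ∀ q, f q ∈ Set.Icc (0 : ℝ) 1) (s : ℝ) :
    ∫⁻ q, ENNReal.ofReal (Real.exp (s * (f q - ∫ q, f q ∂μ))) ∂μ ≤
      ENNReal.ofReal (Real.exp (s ^ 2 / 2)) := by
  have h := hasSubgaussianMGF_of_mem_Icc (μ := μ) hf.aemeasurable (ae_of_all _ hf01)
  rw [← ofReal_integral_eq_lintegral_ofReal (h.integrable_exp_mul s)
    (ae_of_all _ fun q => (Real.exp_pos _).le)]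
  -- Hoeffding's lemma on an interval of length 1 gives s²/8; the weaker s²/2 is all that is needed.
  refine ENNReal.ofReal_le_ofReal ((h.mgf_le s).trans (Real.exp_le_exp.2 ?_))
  norm_num
  nlinarith [sq_nonneg s]

/-- Conditional Hoeffding bound in integrated form: testing against arbitrary weights `U (T ω)`
takes the place of a conditional expectation given `T`. -/
lemma lintegral_mul_exp_centered_le (P : Measure Ω) [IsFiniteMeasure P] {T : Ω → E}
    (hT : Measurable T) {X : Ω → Q} (hX : Measurable X) (κ : Kernel E Q) [IsMarkovKernel κ]
    (h : P.map (fun ω => (T ω, X ω)) = (P.map T) ⊗ₘ κ) {f : Q → ℝ} (hf : Measurable f)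
    (hf01 : ∀ q, f q ∈ Set.Icc (0 : ℝ) 1) {U s : E → ℝ} (hU : Measurable U) (hs : Measurable s) :
    ∫⁻ ω, ENNReal.ofReal (U (T ω)) *
        ENNReal.ofReal (Real.exp (s (T ω) * (f (X ω) - ∫ q, f q ∂κ (T ω)))) ∂P ≤
      ∫⁻ ω, ENNReal.ofReal (U (T ω)) * ENNReal.ofReal (Real.exp (s (T ω) ^ 2 / 2)) ∂P := by
  have hbar : Measurable fun e => ∫ q, f q ∂κ e :=
    (StronglyMeasurable.integral_kernel hf.stronglyMeasurable).measurable
  have hF : Measurable fun p : E × Q => ENNReal.ofReal (U p.1) *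
      ENNReal.ofReal (Real.exp (s p.1 * (f p.2 - ∫ q, f q ∂κ p.1))) := by
    refine (hU.comp measurable_fst).ennreal_ofReal.mul (Measurable.ennreal_ofReal ?_)
    refine Real.measurable_exp.comp ((hs.comp measurable_fst).mul ?_)
    exact (hf.comp measurable_snd).sub (hbar.comp measurable_fst)
  rw [lintegral_eq_of_map_prodMk P hT hX κ h hF]
  refine lintegral_mono fun ω => ?_
  dsimp only
  rw [lintegral_const_mul]
  · gcongr
    exact lintegral_exp_centered_le _ hf hf01 _
  · exact (Real.measurable_exp.comp ((hf.sub_const _).const_mul _)).ennreal_ofReal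

end Disintegration

/-! ### A self-normalized concentration inequality -/

section SelfNormalized

variable {Ω : Type*} {mΩ : MeasurableSpace Ω} {ι : Type*} [Fintype ι] [DecidableEq ι]

/-- The sum of the vectors `x i`, weighted by the noise `e i`. -/
def noiseSum (x : ℕ → ι → ℝ) (e : ℕ → ℝ) (k : ℕ) : ι → ℝ :=
  ∑ i ∈ Finset.range k, e i • x i

/-- The log-determinant-like compensator of the squared self-normalized sum. -/
def compensator (x : ℕ → ι → ℝ) (k : ℕ) : ℝ :=
  ∑ i ∈ Finset.range k, invNormSq (ridge x i) (x i) / (1 + invNormSq (ridge x i) (x i))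

lemma measurable_noiseSum_apply {x : Ω → ℕ → ι → ℝ} {e : Ω → ℕ → ℝ} {k : ℕ}
    (hx : ∀ i < k, ∀ j, Measurable fun ω => x ω i j) (he : ∀ i < k, Measurable fun ω => e ω i)
    (j : ι) : Measurable fun ω => noiseSum (x ω) (e ω) k j := by
  simp only [noiseSum, Finset.sum_apply, Pi.smul_apply, smul_eq_mul]
  exact Finset.measurable_sum _ fun i hi =>
    (he i (Finset.mem_range.1 hi)).mul (hx i (Finset.mem_range.1 hi) j)

lemma measurable_compensator {x : Ω → ℕ → ι → ℝ} {k : ℕ}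
    (hx : ∀ i < k, ∀ j, Measurable fun ω => x ω i j) :
    Measurable fun ω => compensator (x ω) k := by
  refine Finset.measurable_sum _ fun i hi => ?_
  have hik := Finset.mem_range.1 hi
  have := measurable_invNormSq (A := fun ω => ridge (x ω) i) (v := fun ω => x ω i)
    (measurable_ridge_apply fun i' hi' => hx i' (hi'.trans hik)) (hx i hik)
  exact this.div (this.const_add 1)

lemma measurable_selfNormalized {x : Ω → ℕ → ι → ℝ} {e : Ω → ℕ → ℝ} {k : ℕ}
    (hx : ∀ i < k, ∀ j, Measurable fun ω => x ω i j) (he : ∀ i < k, Measurable fun ω => e ω i) :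
    Measurable fun ω => Real.exp
      ((invNormSq (ridge (x ω) k) (noiseSum (x ω) (e ω) k) - compensator (x ω) k) / 2) := by
  refine Real.measurable_exp.comp (Measurable.div_const (Measurable.sub ?_ ?_) 2)
  · exact measurable_invNormSq (measurable_ridge_apply hx) (measurable_noiseSum_apply hx he)
  · exact measurable_compensator hx

variable (P : Measure Ω) [IsProbabilityMeasure P] {K : ℕ} {m : ℕ → MeasurableSpace Ω}
  {x : Ω → ℕ → ι → ℝ} {e : Ω → ℕ → ℝ}

/-- The process is a supermartingale. With q the squared norm of the new feature and u its inner
product with the past sum, the rank-one update adds (2eu + e²q - u²)/(1 + q) to the squared norm.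
The compensator pays for e²q, and the conditional Gaussian bound on the term linear in e is paid for
by -u²/(1 + q). No mixture over directions is needed. -/
lemma lintegral_exp_selfNormalized_le_one
    (hx : ∀ i < K, ∀ i' ≤ i, ∀ j, Measurable[m i] fun ω => x ω i' j)
    (he : ∀ i < K, ∀ i' < i, Measurable[m i] fun ω => e ω i')
    (he1 : ∀ i < K, ∀ ω, |e ω i| ≤ 1)
    (hstep : ∀ i < K, ∀ U s : Ω → ℝ, Measurable[m i] U → Measurable[m i] s →
      ∫⁻ ω, ENNReal.ofReal (U ω) * ENNReal.ofReal (Real.exp (s ω * e ω i)) ∂P ≤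
        ∫⁻ ω, ENNReal.ofReal (U ω) * ENNReal.ofReal (Real.exp (s ω ^ 2 / 2)) ∂P)
    {k : ℕ} (hk : k ≤ K) :
    ∫⁻ ω, ENNReal.ofReal (Real.exp
      ((invNormSq (ridge (x ω) k) (noiseSum (x ω) (e ω) k) - compensator (x ω) k) / 2)) ∂P ≤ 1 := by
  induction k with
  | zero => simp [noiseSum, compensator, invNormSq_zero]
  | succ k ih =>
    have hkK : k < K := hk
    refine le_trans ?_ (ih hkK.le)
    set W : Ω → ℝ := fun ω =>
      (invNormSq (ridge (x ω) k) (noiseSum (x ω) (e ω) k) - compensator (x ω) k) / 2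
    set q : Ω → ℝ := fun ω => invNormSq (ridge (x ω) k) (x ω k)
    set u : Ω → ℝ := fun ω => x ω k ⬝ᵥ ((ridge (x ω) k)⁻¹ *ᵥ noiseSum (x ω) (e ω) k)
    have hq0 : ∀ ω, 0 ≤ q ω := fun ω => invNormSq_nonneg (ridge_posDef _ _) _
    have hx' : ∀ i < k, ∀ j, Measurable[m k] fun ω => x ω i j := fun i hi => hx k hkK i hi.le
    have hR := measurable_ridge_apply hx'
    have hN := measurable_noiseSum_apply hx' (he k hkK)
    have hqm : Measurable[m k] q := measurable_invNormSq hR (hx k hkK k le_rfl)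
    have hum : Measurable[m k] u :=
      measurable_dotProduct (hx k hkK k le_rfl) (measurable_mulVec (measurable_inv_apply hR) hN)
    have hWm : Measurable[m k] W :=
      ((measurable_invNormSq hR hN).sub (measurable_compensator hx')).div_const 2
    -- After halving, the exponent is linear in the noise with predictable slope u/(1 + q); all
    -- remaining terms form the predictable weight.
    have h1 := hstep k hkK (fun ω => Real.exp (W ω - u ω ^ 2 / (1 + q ω) / 2))
      (fun ω => u ω / (1 + q ω))
      (Real.measurable_exp.comp (hWm.sub (((hum.pow_const 2).div (hqm.const_add 1)).div_const 2)))
      (hum.div (hqm.const_add 1))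
    refine le_trans (lintegral_mono fun ω => ?_) (h1.trans (lintegral_mono fun ω => ?_))
    · rw [← ENNReal.ofReal_mul (Real.exp_pos _).le, ← Real.exp_add]
      refine ENNReal.ofReal_le_ofReal (Real.exp_le_exp.2 ?_)
      have hsum : noiseSum (x ω) (e ω) (k + 1) = noiseSum (x ω) (e ω) k + e ω k • x ω k := by
        rw [noiseSum, Finset.sum_range_succ, noiseSum]
      have hcomp : compensator (x ω) (k + 1) = compensator (x ω) k + q ω / (1 + q ω) := by
        rw [compensator, Finset.sum_range_succ, compensator]
      rw [hsum, ridge_succ, invNormSq_rankOne_update (ridge_posDef _ _), hcomp]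
      change (invNormSq (ridge (x ω) k) (noiseSum (x ω) (e ω) k) +
        (2 * e ω k * u ω + e ω k ^ 2 * q ω - u ω ^ 2) / (1 + q ω) -
          (compensator (x ω) k + q ω / (1 + q ω))) / 2 ≤ _
      have he2 : e ω k ^ 2 ≤ 1 := by
        rw [← sq_abs]; exact pow_le_one₀ (abs_nonneg _) (he1 k hkK ω)
      -- The term e²q is absorbed by the compensator increment q/(1 + q) because |e| ≤ 1.
      have h2 : (2 * e ω k * u ω + e ω k ^ 2 * q ω - u ω ^ 2) / (1 + q ω) - q ω / (1 + q ω) ≤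
          2 * (u ω / (1 + q ω) * e ω k) - u ω ^ 2 / (1 + q ω) := by
        have : 0 < 1 + q ω := by linarith [hq0 ω]
        have e1 : 2 * (u ω / (1 + q ω) * e ω k) - u ω ^ 2 / (1 + q ω) =
            (2 * e ω k * u ω - u ω ^ 2) / (1 + q ω) := by ring
        rw [← sub_div, e1]
        refine div_le_div_of_nonneg_right ?_ this.le
        linarith [mul_le_mul_of_nonneg_right he2 (hq0 ω)]
      change _ ≤ (invNormSq (ridge (x ω) k) (noiseSum (x ω) (e ω) k) - compensator (x ω) k) / 2 -
        u ω ^ 2 / (1 + q ω) / 2 + u ω / (1 + q ω) * e ω k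
      linarith
    · rw [← ENNReal.ofReal_mul (Real.exp_pos _).le, ← Real.exp_add]
      refine ENNReal.ofReal_le_ofReal (Real.exp_le_exp.2 ?_)
      change W ω - u ω ^ 2 / (1 + q ω) / 2 + (u ω / (1 + q ω)) ^ 2 / 2 ≤ W ω
      have h1q : 1 ≤ 1 + q ω := by linarith [hq0 ω]
      -- The Gaussian cost of the slope is at most the negative quadratic term, because 1 + q ≥ 1.
      have : (u ω / (1 + q ω)) ^ 2 ≤ u ω ^ 2 / (1 + q ω) := by
        rw [div_pow]
        gcongr
        nlinarith
      linarith

/-- A sum of conditionally centered noise, weighted by predictable vectors and normalized by their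
Gram matrix, is small with high probability. -/
lemma measure_selfNormalized_le
    (hx : ∀ i < K, ∀ i' ≤ i, ∀ j, Measurable[m i] fun ω => x ω i' j)
    (he : ∀ i < K, ∀ i' < i, Measurable[m i] fun ω => e ω i')
    (hxΩ : ∀ i < K, ∀ j, Measurable fun ω => x ω i j) (heΩ : ∀ i < K, Measurable fun ω => e ω i)
    (he1 : ∀ i < K, ∀ ω, |e ω i| ≤ 1)
    (hstep : ∀ i < K, ∀ U s : Ω → ℝ, Measurable[m i] U → Measurable[m i] s →
      ∫⁻ ω, ENNReal.ofReal (U ω) * ENNReal.ofReal (Real.exp (s ω * e ω i)) ∂P ≤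
        ∫⁻ ω, ENNReal.ofReal (U ω) * ENNReal.ofReal (Real.exp (s ω ^ 2 / 2)) ∂P)
    (hx1 : ∀ ω i, x ω i ⬝ᵥ x ω i ≤ 1) {k : ℕ} (hk : k ≤ K) {ε : ℝ} (hε : 0 < ε) :
    P {ω | Fintype.card ι * Real.log (Fintype.card ι + k) + 2 * Real.log (1 / ε) ≤
      invNormSq (ridge (x ω) k) (noiseSum (x ω) (e ω) k)} ≤ ENNReal.ofReal ε := by
  have h1 := lintegral_exp_selfNormalized_le_one P hx he he1 hstep hk
  -- Markov's inequality at level 1/ε; the random compensator is replaced below by its deterministic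
  -- elliptical potential bound.
  have h2 := mul_meas_ge_le_lintegral₀ (μ := P)
    (measurable_selfNormalized (fun i hi => hxΩ i (hi.trans_le hk))
      (fun i hi => heΩ i (hi.trans_le hk))).ennreal_ofReal.aemeasurable (ENNReal.ofReal (1 / ε))
  have h3 := h2.trans h1
  have h4 : P {ω | ENNReal.ofReal (1 / ε) ≤ ENNReal.ofReal (Real.exp
      ((invNormSq (ridge (x ω) k) (noiseSum (x ω) (e ω) k) - compensator (x ω) k) / 2))} ≤
      ENNReal.ofReal ε := by
    rw [one_div, ENNReal.ofReal_inv_of_pos hε] at h3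
    rw [one_div, ENNReal.ofReal_inv_of_pos hε]
    rwa [mul_comm, ← div_eq_mul_inv, ENNReal.div_le_iff (by simpa using hε) (by simp),
      one_mul] at h3
  refine (measure_mono fun ω hω => ?_).trans h4
  refine ENNReal.ofReal_le_ofReal ?_
  have h5 : compensator (x ω) k ≤ _ := sum_potential_le (x ω) (hx1 ω) k
  rw [← Real.log_le_iff_le_exp (by positivity)]
  rw [Set.mem_ofPred_eq] at hω
  linarith

end SelfNormalized

/-! ### Finite nets for value functions -/

/-- The `j`-th of the `N + 1` equidistant levels in `[-R, R]`. -/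
def level (R : ℝ) (N : ℕ) (j : Fin (N + 1)) : ℝ := -R + 2 * R * j / N

lemma exists_level {R : ℝ} {N : ℕ} (hR : 0 < R) (hN : 0 < N) {t : ℝ} (ht : |t| ≤ R) :
    ∃ j, |t - level R N j| ≤ 2 * R / N := by
  have hN' : (0 : ℝ) < N := by exact_mod_cast hN
  obtain ⟨h1, h2⟩ := abs_le.1 ht
  have h0 : 0 ≤ (t + R) * N / (2 * R) := by
    have : 0 ≤ t + R := by linarith
    positivity
  have hle : (t + R) * N / (2 * R) ≤ N := by
    rw [div_le_iff₀ (by positivity)]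
    nlinarith
  refine ⟨⟨⌊(t + R) * N / (2 * R)⌋₊, Nat.lt_succ_of_le (Nat.floor_le_of_le hle)⟩, ?_⟩
  simp only [level]
  set n := ⌊(t + R) * N / (2 * R)⌋₊
  have f1 : (n : ℝ) ≤ (t + R) * N / (2 * R) := Nat.floor_le h0
  have f2 : (t + R) * N / (2 * R) < n + 1 := Nat.lt_floor_add_one _
  rw [le_div_iff₀ (by positivity)] at f1
  rw [div_lt_iff₀ (by positivity)] at f2
  have e : t - (-R + 2 * R * n / N) = ((t + R) * N - n * (2 * R)) / N := by
    field_simp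
    ring
  rw [e, abs_div, abs_of_pos hN']
  gcongr
  rw [abs_le]
  constructor <;> linarith

section Net

variable {S A : Type*} {d : ℕ}

lemma abs_psi_le {φ : S → A → EuclideanSpace ℝ (Fin d)} (hφ : ∀ s a, ‖φ s a‖ ≤ 1) (s : S) (a : A)
    (j : Fin d × Fin d) : |psi φ s a j| ≤ 1 := by
  have h : ∀ i, |φ s a i| ≤ 1 := fun i =>
    (by simpa using PiLp.norm_apply_le (φ s a) i : |φ s a i| ≤ ‖φ s a‖).trans (hφ s a)
  rw [psi, abs_mul]
  exact mul_le_one₀ (h _) (abs_nonneg _) (h _)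

lemma psi_dotProduct_self_le {φ : S → A → EuclideanSpace ℝ (Fin d)} (hφ : ∀ s a, ‖φ s a‖ ≤ 1)
    (s : S) (a : A) : psi φ s a ⬝ᵥ psi φ s a ≤ 1 := by
  have h : psi φ s a ⬝ᵥ psi φ s a = (‖φ s a‖ ^ 2) ^ 2 := by
    rw [EuclideanSpace.real_norm_sq_eq, sq, Finset.sum_mul_sum, ← Finset.sum_product',
      Finset.univ_product_univ]
    exact Finset.sum_congr rfl fun ij _ => by simp only [psi]; ring
  rw [h]
  exact pow_le_one₀ (by positivity) (pow_le_one₀ (norm_nonneg _) (hφ s a))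

lemma abs_dotProduct_le_card {ι : Type*} [Fintype ι] {u v : ι → ℝ} {ε : ℝ} (hu : ∀ j, |u j| ≤ 1)
    (hv : ∀ j, |v j| ≤ ε) : |u ⬝ᵥ v| ≤ Fintype.card ι * ε := by
  calc |u ⬝ᵥ v| ≤ ∑ j, |u j * v j| := Finset.abs_sum_le_sum_abs _ _
    _ ≤ ∑ _j : ι, ε := Finset.sum_le_sum fun j _ => by
        rw [abs_mul]
        exact (mul_le_of_le_one_left (abs_nonneg _) (hu j)).trans (hv j)
    _ = Fintype.card ι * ε := by simp

/-- The square root is only 1/2-Hölder at 0, so the bonus depends on the matrix with exponent 1/2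
and the net must be correspondingly finer. -/
lemma abs_sqrt_sub_sqrt_le (a b : ℝ) : |√a - √b| ≤ √|a - b| := by
  have key : ∀ a b : ℝ, √a - √b ≤ √|a - b| := fun a b => by
    rw [sub_le_iff_le_add, Real.sqrt_le_left (by positivity)]
    rcases le_total b 0 with hb | hb
    · rw [Real.sqrt_eq_zero_of_nonpos hb, add_zero, Real.sq_sqrt (abs_nonneg _)]
      exact le_trans (by linarith) (le_abs_self (a - b))
    · nlinarith [Real.sq_sqrt hb, Real.sq_sqrt (abs_nonneg (a - b)), le_abs_self (a - b),
        Real.sqrt_nonneg b, Real.sqrt_nonneg |a - b|,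
        mul_nonneg (Real.sqrt_nonneg b) (Real.sqrt_nonneg |a - b|)]
  rw [abs_sub_le_iff]
  exact ⟨key a b, by simpa only [abs_sub_comm] using key b a⟩

/-- The action value given by a weight vector and an elliptical bonus. -/
def linQ (φ : S → A → EuclideanSpace ℝ (Fin d)) (b : ℝ) (w : Fin d × Fin d → ℝ)
    (B : Matrix (Fin d × Fin d) (Fin d × Fin d) ℝ) (s : S) (a : A) : ℝ :=
  psi φ s a ⬝ᵥ w - b * √(psi φ s a ⬝ᵥ (B *ᵥ psi φ s a))

lemma abs_linQ_sub_le {φ : S → A → EuclideanSpace ℝ (Fin d)} (hφ : ∀ s a, ‖φ s a‖ ≤ 1) {b : ℝ}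
    (hb : 0 ≤ b) {w w' : Fin d × Fin d → ℝ} {B B' : Matrix (Fin d × Fin d) (Fin d × Fin d) ℝ}
    {ε₁ ε₂ : ℝ} (hw : ∀ j, |w j - w' j| ≤ ε₁) (hB : ∀ i j, |B i j - B' i j| ≤ ε₂) (s : S) (a : A) :
    |linQ φ b w B s a - linQ φ b w' B' s a| ≤ (d : ℝ) ^ 2 * ε₁ + b * √((d : ℝ) ^ 4 * ε₂) := by
  have hcard : (Fintype.card (Fin d × Fin d) : ℝ) = (d : ℝ) ^ 2 := by simp [sq]
  have h1 : |psi φ s a ⬝ᵥ w - psi φ s a ⬝ᵥ w'| ≤ (d : ℝ) ^ 2 * ε₁ := by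
    rw [← dotProduct_sub, ← hcard]
    exact abs_dotProduct_le_card (abs_psi_le hφ s a) hw
  have h2 : |psi φ s a ⬝ᵥ (B *ᵥ psi φ s a) - psi φ s a ⬝ᵥ (B' *ᵥ psi φ s a)| ≤
      (d : ℝ) ^ 4 * ε₂ := by
    rw [← dotProduct_sub, ← Matrix.sub_mulVec]
    have e : (d : ℝ) ^ 4 * ε₂ = (d : ℝ) ^ 2 * ((d : ℝ) ^ 2 * ε₂) := by ring
    rw [e, ← hcard]
    refine abs_dotProduct_le_card (abs_psi_le hφ s a) fun i => ?_
    rw [Matrix.mulVec, dotProduct_comm]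
    exact abs_dotProduct_le_card (abs_psi_le hφ s a) (hB i)
  have h3 := (abs_sqrt_sub_sqrt_le _ _).trans (Real.sqrt_le_sqrt h2)
  have e : linQ φ b w B s a - linQ φ b w' B' s a = (psi φ s a ⬝ᵥ w - psi φ s a ⬝ᵥ w') -
      b * (√(psi φ s a ⬝ᵥ (B *ᵥ psi φ s a)) - √(psi φ s a ⬝ᵥ (B' *ᵥ psi φ s a))) := by
    simp only [linQ]; ring
  rw [e]
  refine (abs_sub _ _).trans (add_le_add h1 ?_)
  rw [abs_mul, abs_of_nonneg hb]
  gcongr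

variable [Fintype A] [Nonempty A]

/-- The minimum of `linQ` over the actions, truncated below at `c` and clipped to `[0, 1]`. -/
def clippedV (φ : S → A → EuclideanSpace ℝ (Fin d)) (b : ℝ) (w : Fin d × Fin d → ℝ)
    (B : Matrix (Fin d × Fin d) (Fin d × Fin d) ℝ) (c : ℝ) (s : S) : ℝ :=
  min (max (max (Finset.univ.inf' Finset.univ_nonempty (linQ φ b w B s)) c) 0) 1

lemma clippedV_mem (φ : S → A → EuclideanSpace ℝ (Fin d)) (b : ℝ) (w : Fin d × Fin d → ℝ)
    (B : Matrix (Fin d × Fin d) (Fin d × Fin d) ℝ) (c : ℝ) (s : S) :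
    clippedV φ b w B c s ∈ Set.Icc (0 : ℝ) 1 :=
  ⟨le_min (le_max_right _ _) zero_le_one, min_le_right _ _⟩

lemma abs_inf'_sub_inf'_le {f g : A → ℝ} {ε : ℝ} (h : ∀ a, |f a - g a| ≤ ε) :
    |Finset.univ.inf' Finset.univ_nonempty f - Finset.univ.inf' Finset.univ_nonempty g| ≤ ε := by
  have key : ∀ f g : A → ℝ, (∀ a, |f a - g a| ≤ ε) →
      Finset.univ.inf' Finset.univ_nonempty f - Finset.univ.inf' Finset.univ_nonempty g ≤ ε := by
    intro f g h
    obtain ⟨a, -, ha⟩ := Finset.exists_mem_eq_inf' (Finset.univ_nonempty (α := A)) g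
    have h1 := Finset.inf'_le f (Finset.mem_univ a)
    have := (abs_le.1 (h a)).2
    rw [ha]
    linarith
  exact abs_sub_le_iff.2 ⟨key f g h, key g f fun a => by rw [abs_sub_comm]; exact h a⟩

lemma abs_clippedV_sub_le {φ : S → A → EuclideanSpace ℝ (Fin d)} {b : ℝ}
    {w w' : Fin d × Fin d → ℝ} {B B' : Matrix (Fin d × Fin d) (Fin d × Fin d) ℝ} {c c' ε : ℝ}
    {s : S} (hq : ∀ a, |linQ φ b w B s a - linQ φ b w' B' s a| ≤ ε) (hc : |c - c'| ≤ ε) :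
    |clippedV φ b w B c s - clippedV φ b w' B' c' s| ≤ ε := by
  have h0 : 0 ≤ ε := (abs_nonneg _).trans hc
  refine (abs_min_sub_min_le_max _ _ _ _).trans (max_le ?_ (by simpa using h0))
  refine (abs_max_sub_max_le_max _ _ _ _).trans (max_le ?_ (by simpa using h0))
  exact (abs_max_sub_max_le_max _ _ _ _).trans (max_le (abs_inf'_sub_inf'_le hq) hc)

/-- Indices of the net: discretized weights for each reward, a discretized matrix, and a
discretized truncation level for each reward. -/
abbrev NetIndex (d : ℕ) (G : Finset ℝ) (N : ℕ) : Type :=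
  (G → Fin d × Fin d → Fin (N + 1)) × (Fin d × Fin d → Fin d × Fin d → Fin (N + 1)) ×
    (G → Fin (N + 1))

lemma card_netIndex (d : ℕ) (G : Finset ℝ) (N : ℕ) :
    Fintype.card (NetIndex d G N) = (N + 1) ^ (d ^ 2 * G.card + (d ^ 4 + G.card)) := by
  simp only [Fintype.card_prod, Fintype.card_fun, Fintype.card_fin, Fintype.card_coe]
  ring

/-- The functions of (next state, reward) in the net. -/
def netFun (φ : S → A → EuclideanSpace ℝ (Fin d)) (b R : ℝ) {G : Finset ℝ} {N : ℕ}
    (θ : NetIndex d G N) (q : S × ℝ) : ℝ :=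
  ∑ z : G, if q.2 = z then
    clippedV φ b (fun j => level R N (θ.1 z j)) (fun i j => level 1 N (θ.2.1 i j))
      (level 1 N (θ.2.2 z)) q.1 else 0

variable {φ : S → A → EuclideanSpace ℝ (Fin d)} {b R : ℝ} {G : Finset ℝ} {N : ℕ}

lemma netFun_apply_mem (θ : NetIndex d G N) (s : S) (z : G) :
    netFun φ b R θ (s, (z : ℝ)) = clippedV φ b (fun j => level R N (θ.1 z j))
      (fun i j => level 1 N (θ.2.1 i j)) (level 1 N (θ.2.2 z)) s := by
  rw [netFun, Finset.sum_eq_single z]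
  · simp
  · intro z' _ hz'
    rw [if_neg]
    exact fun h => hz' (Subtype.ext h.symm)
  · simp

lemma netFun_mem (θ : NetIndex d G N) (q : S × ℝ) : netFun φ b R θ q ∈ Set.Icc (0 : ℝ) 1 := by
  by_cases hq : q.2 ∈ G
  · obtain ⟨s, r⟩ := q
    rw [netFun_apply_mem θ s ⟨r, hq⟩]
    exact clippedV_mem _ _ _ _ _ _
  · rw [netFun, Finset.sum_eq_zero]
    · simp
    · intro z _
      rw [if_neg]
      exact fun h => hq (h ▸ z.2)

/-- A single index serves all states and rewards: weights and truncation levels are rounded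
separately for each reward value, while the matrix is shared because the Gram matrix does not depend
on y. -/
lemma exists_netFun_close (hφ : ∀ s a, ‖φ s a‖ ≤ 1) (hb : 0 ≤ b) (hR : 0 < R) (hN : 0 < N) {ε : ℝ}
    (hε : (d : ℝ) ^ 2 * (2 * R / N) + b * √((d : ℝ) ^ 4 * (2 / N)) ≤ ε) (hε' : 2 / N ≤ ε)
    (w : ℝ → Fin d × Fin d → ℝ) (B : Matrix (Fin d × Fin d) (Fin d × Fin d) ℝ) (c : ℝ → ℝ)
    (hw : ∀ z ∈ G, ∀ j, |w z j| ≤ R) (hB : ∀ i j, |B i j| ≤ 1) (hc : ∀ z ∈ G, |c z| ≤ 1) :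
    ∃ θ : NetIndex d G N, ∀ s, ∀ z ∈ G,
      |clippedV φ b (w z) B (c z) s - netFun φ b R θ (s, z)| ≤ ε := by
  choose jw hjw using fun (z : G) (j : Fin d × Fin d) => exists_level hR hN (hw z z.2 j)
  choose jB hjB using fun i j : Fin d × Fin d => exists_level one_pos hN (hB i j)
  choose jc hjc using fun z : G => exists_level one_pos hN (hc z z.2)
  refine ⟨(jw, jB, jc), fun s z hz => ?_⟩
  rw [netFun_apply_mem (jw, jB, jc) s ⟨z, hz⟩]
  simp only [mul_one] at hjB hjc
  exact abs_clippedV_sub_le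
    (fun a => (abs_linQ_sub_le hφ hb (hjw ⟨z, hz⟩) hjB s a).trans hε) ((hjc ⟨z, hz⟩).trans hε')

end Net

/-! ### Measurability of the functions in the net. -/

section NetMeasurability

variable {S A E : Type*} [MeasurableSpace S] {mE : MeasurableSpace E} {d : ℕ}
  {φ : S → A → EuclideanSpace ℝ (Fin d)}

lemma measurable_psi_apply (hφ : ∀ a, Measurable fun s => φ s a) (a : A) (j : Fin d × Fin d) :
    Measurable fun s => psi φ s a j := by
  have h : ∀ i, Measurable fun s => φ s a i := fun i =>
    (PiLp.continuous_apply 2 _ i).measurable.comp (hφ a)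
  exact (h _).mul (h _)

lemma measurable_linQ (hφ : ∀ a, Measurable fun s => φ s a) {b : ℝ} {w : E → Fin d × Fin d → ℝ}
    {B : E → Matrix (Fin d × Fin d) (Fin d × Fin d) ℝ} {s : E → S} (hs : Measurable s)
    (hw : ∀ j, Measurable fun e => w e j) (hB : ∀ i j, Measurable fun e => B e i j) (a : A) :
    Measurable fun e => linQ φ b (w e) (B e) (s e) a := by
  have h : ∀ j, Measurable fun e => psi φ (s e) a j := fun j =>
    (measurable_psi_apply hφ a j).comp hs
  exact (measurable_dotProduct h hw).sub
    ((measurable_dotProduct h (measurable_mulVec hB h)).sqrt.const_mul b)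

variable [Fintype A] [Nonempty A]

lemma measurable_clippedV (hφ : ∀ a, Measurable fun s => φ s a) (b : ℝ) (w : Fin d × Fin d → ℝ)
    (B : Matrix (Fin d × Fin d) (Fin d × Fin d) ℝ) (c : ℝ) :
    Measurable fun s => clippedV φ b w B c s := by
  have h : Measurable fun s => Finset.univ.inf' Finset.univ_nonempty (linQ φ b w B s) := by
    have e : (fun s => Finset.univ.inf' Finset.univ_nonempty (linQ φ b w B s)) =
        Finset.univ.inf' Finset.univ_nonempty (fun a s => linQ φ b w B s a) := by
      ext s
      simp [Finset.inf'_apply]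
    rw [e]
    refine Finset.inf'_induction _ _ (p := fun f : S → ℝ => Measurable f)
      (fun f hf g hg => hf.inf hg) fun a _ => ?_
    exact measurable_linQ (E := S) (w := fun _ => w) (B := fun _ => B) hφ measurable_id
      (fun j => measurable_const) (fun i j => measurable_const) a
  exact ((h.max measurable_const).max measurable_const).min measurable_const

lemma measurable_netFun (hφ : ∀ a, Measurable fun s => φ s a) (b R : ℝ) {G : Finset ℝ} {N : ℕ}
    (θ : NetIndex d G N) : Measurable (netFun φ b R θ) := by
  refine Finset.measurable_sum _ fun z _ => Measurable.ite ?_ ?_ measurable_const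
  · exact measurable_snd (measurableSet_singleton (z : ℝ))
  · exact (measurable_clippedV hφ _ _ _ _).comp measurable_fst

end NetMeasurability

/-! ### Linear structure of one-step expectations -/

section Linear

/-- The average of the indicators of the `n` upper level sets of `t` at the heights `(j + 1) / n`. -/
lemma abs_levelSets_average_sub_le {t : ℝ} (ht : t ∈ Set.Icc (0 : ℝ) 1) {n : ℕ} (hn : 0 < n) :
    |(n : ℝ)⁻¹ * ∑ j ∈ Finset.range n, (if (j : ℝ) + 1 ≤ n * t then (1 : ℝ) else 0) - t| ≤
      (n : ℝ)⁻¹ := by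
  have hn' : (0 : ℝ) < n := by exact_mod_cast hn
  have h0 : 0 ≤ n * t := mul_nonneg hn'.le ht.1
  have hle : ⌊n * t⌋₊ ≤ n := Nat.floor_le_of_le (by nlinarith [ht.2])
  have hsum : ∑ j ∈ Finset.range n, (if (j : ℝ) + 1 ≤ n * t then (1 : ℝ) else 0) =
      ⌊n * t⌋₊ := by
    rw [Finset.sum_boole]
    congr 1
    rw [← Finset.card_range ⌊n * t⌋₊]
    congr 1
    ext j
    have : (j : ℝ) + 1 ≤ n * t ↔ j + 1 ≤ ⌊n * t⌋₊ := by
      rw [Nat.le_floor_iff h0]; push_cast; rfl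
    simp only [Finset.mem_filter, Finset.mem_range, this]
    omega
  rw [hsum]
  have f1 := Nat.floor_le h0
  have f2 := Nat.lt_floor_add_one (n * t)
  have e : (n : ℝ)⁻¹ * ⌊n * t⌋₊ - t = (n : ℝ)⁻¹ * (⌊n * t⌋₊ - n * t) := by
    field_simp
  rw [e, abs_mul, abs_of_pos (inv_pos.2 hn')]
  refine mul_le_of_le_one_right (inv_pos.2 hn').le (abs_le.2 ⟨?_, ?_⟩) <;> linarith

variable {S A : Type*} [MeasurableSpace S] {d : ℕ}

/-- If the probabilities of all events are linear in the features, so are the expectations of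
functions with values in `[0, 1]`. -/
lemma exists_integral_eq_inner {X : Type*} (P : X → Measure S) (hP : ∀ p, IsProbabilityMeasure (P p))
    (φ : X → EuclideanSpace ℝ (Fin d)) (μ : Set S → EuclideanSpace ℝ (Fin d)) {c : ℝ}
    (hμ : ∀ B, MeasurableSet B → ‖μ B‖ ≤ c)
    (hlin : ∀ p B, MeasurableSet B → (P p).real B = inner ℝ (φ p) (μ B))
    {g : S → ℝ} (hg : Measurable g) (hg01 : ∀ s, g s ∈ Set.Icc (0 : ℝ) 1) :
    ∃ v : EuclideanSpace ℝ (Fin d), ‖v‖ ≤ c ∧ ∀ p, ∫ s, g s ∂P p = inner ℝ (φ p) v := by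
  let B : ℕ → ℕ → Set S := fun n j => {s | (j : ℝ) + 1 ≤ (n + 1 : ℕ) * g s}
  have hB : ∀ n j, MeasurableSet (B n j) := fun n j =>
    measurableSet_le measurable_const (hg.const_mul _)
  -- A layer-cake approximation of the integral of `g` against `μ`. Being an average of values of
  -- `μ` on events, it keeps the norm bound `c`.
  let v : ℕ → EuclideanSpace ℝ (Fin d) := fun n =>
    ((n + 1 : ℕ) : ℝ)⁻¹ • ∑ j ∈ Finset.range (n + 1), μ (B n j)
  have hv : ∀ n, ‖v n‖ ≤ c := by
    intro n
    have h1 : ‖∑ j ∈ Finset.range (n + 1), μ (B n j)‖ ≤ ((n + 1 : ℕ) : ℝ) * c := by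
      refine (norm_sum_le_of_le _ fun j _ => hμ _ (hB n j)).trans (le_of_eq ?_)
      simp
    have hpos : (0 : ℝ) < ((n + 1 : ℕ) : ℝ) := by positivity
    rw [norm_smul, Real.norm_of_nonneg (inv_pos.2 hpos).le, inv_mul_le_iff₀ hpos]
    exact h1
  -- Compactness of the ball supplies the limit vector, so no integral against a vector measure is
  -- needed.
  obtain ⟨w, hw, σ, hσ, hlim⟩ := tendsto_subseq_of_bounded (Metric.isBounded_closedBall (x := 0)
    (r := c)) (fun n => mem_closedBall_zero_iff.2 (hv n))
  rw [Metric.isClosed_closedBall.closure_eq, mem_closedBall_zero_iff] at hw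
  refine ⟨w, hw, fun p => ?_⟩
  have hPp := hP p
  have hint : ∀ f : S → ℝ, Measurable f → (∀ s, f s ∈ Set.Icc (0 : ℝ) 1) → Integrable f (P p) :=
    fun f hf hf01 => Integrable.of_mem_Icc 0 1 hf.aemeasurable (ae_of_all _ hf01)
  have happrox : ∀ n : ℕ, |inner ℝ (φ p) (v n) - ∫ s, g s ∂P p| ≤ ((n + 1 : ℕ) : ℝ)⁻¹ := by
    intro n
    have hi : ∀ j : ℕ, Integrable (fun s => if (j : ℝ) + 1 ≤ (n + 1 : ℕ) * g s then (1 : ℝ) else 0)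
        (P p) := fun j => hint _ (Measurable.ite (hB n j) measurable_const measurable_const)
      fun s => by split_ifs <;> simp
    have e : inner ℝ (φ p) (v n) = ∫ s, ((n + 1 : ℕ) : ℝ)⁻¹ * ∑ j ∈ Finset.range (n + 1),
        (if (j : ℝ) + 1 ≤ (n + 1 : ℕ) * g s then (1 : ℝ) else 0) ∂P p := by
      rw [integral_const_mul, integral_finsetSum _ fun j _ => hi j, real_inner_smul_right, inner_sum]
      congr 1
      refine Finset.sum_congr rfl fun j _ => ?_
      rw [← hlin p _ (hB n j), ← integral_indicator_one (hB n j)]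
      refine integral_congr_ae (ae_of_all _ fun s => ?_)
      simp [Set.indicator_apply, B]
    rw [e, ← integral_sub ((integrable_finsetSum _ fun j _ => hi j).const_mul _) (hint g hg hg01)]
    rw [← Real.norm_eq_abs]
    refine (norm_integral_le_of_norm_le_const (μ := P p) (C := ((n + 1 : ℕ) : ℝ)⁻¹) (ae_of_all _ fun s => by
      rw [Real.norm_eq_abs]
      exact abs_levelSets_average_sub_le (hg01 s) n.succ_pos)).trans (le_of_eq ?_)
    simp
  have ht : Filter.Tendsto (fun n => inner ℝ (φ p) (v (σ n))) Filter.atTop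
      (nhds (inner ℝ (φ p) w)) := Filter.Tendsto.inner tendsto_const_nhds hlim
  refine tendsto_nhds_unique ?_ ht
  rw [tendsto_iff_norm_sub_tendsto_zero]
  refine squeeze_zero (fun n => norm_nonneg _) (fun n => happrox (σ n)) ?_
  have h1 : Filter.Tendsto (fun n : ℕ => ((n + 1 : ℕ) : ℝ)⁻¹) Filter.atTop (nhds 0) :=
    (tendsto_inv_atTop_nhds_zero_nat (𝕜 := ℝ)).comp (Filter.tendsto_add_atTop_nat 1)
  exact h1.comp hσ.tendsto_atTop

/-- In each coordinate the positive and the negative terms form two subsets of the grid, each with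
sum bounded by `c`. The absolute sum is thus bounded independently of the number of grid points. -/
lemma sum_abs_le_of_subset_norm_le {G : Finset ℝ} {θ : ℝ → EuclideanSpace ℝ (Fin d)} {c : ℝ}
    (h : ∀ Z ⊆ G, ‖∑ z ∈ Z, θ z‖ ≤ c) (j : Fin d) : ∑ z ∈ G, |θ z j| ≤ 2 * c := by
  have key : ∀ Z ⊆ G, |∑ z ∈ Z, θ z j| ≤ c := fun Z hZ => by
    have := (PiLp.norm_apply_le (∑ z ∈ Z, θ z) j).trans (h Z hZ)
    simpa using this
  have h1 := key (G.filter fun z => 0 ≤ θ z j) (Finset.filter_subset _ _)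
  have h2 := key (G.filter fun z => ¬ 0 ≤ θ z j) (Finset.filter_subset _ _)
  rw [← Finset.sum_filter_add_sum_filter_not G fun z => 0 ≤ θ z j]
  have e1 : ∑ z ∈ G.filter (fun z => 0 ≤ θ z j), |θ z j| =
      ∑ z ∈ G.filter (fun z => 0 ≤ θ z j), θ z j :=
    Finset.sum_congr rfl fun z hz => abs_of_nonneg (Finset.mem_filter.1 hz).2
  have e2 : ∑ z ∈ G.filter (fun z => ¬ 0 ≤ θ z j), |θ z j| =
      - ∑ z ∈ G.filter (fun z => ¬ 0 ≤ θ z j), θ z j := by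
    rw [← Finset.sum_neg_distrib]
    exact Finset.sum_congr rfl fun z hz => abs_of_nonpos (not_le.1 (Finset.mem_filter.1 hz).2).le
  rw [e1, e2]
  linarith [(abs_le.1 h1).2, (abs_le.1 h2).1]

variable [MeasurableSpace A]

instance (mdp : MDP S A) (h : ℕ) : IsMarkovKernel (mdp.trans h) := mdp.trans_markov h
instance (mdp : MDP S A) (h : ℕ) : IsMarkovKernel (mdp.rew h) := mdp.rew_markov h
instance (mdp : MDP S A) (h : ℕ) : IsMarkovKernel (mdp.step h) := by
  unfold MDP.step; infer_instance

lemma MDP.step_apply (mdp : MDP S A) (h : ℕ) (p : S × A) :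
    mdp.step h p = (mdp.trans h p).prod (mdp.rew h p) := Kernel.prod_apply _ _ _

lemma MDP.step_ae_reward (mdp : MDP S A) (h : ℕ) (p : S × A) {T : Set ℝ}
    (hT' : mdp.rew h p Tᶜ = 0) : ∀ᵐ q ∂mdp.step h p, q.2 ∈ T := by
  rw [MDP.step_apply]
  exact Measure.quasiMeasurePreserving_snd.ae (p := fun r => r ∈ T) hT'

/-- The expectation of a function of (next state, reward), when the rewards lie in a finite set. -/
lemma MDP.integral_step (mdp : MDP S A) (h : ℕ) (p : S × A) {G : Finset ℝ}
    (hG : mdp.rew h p (↑G)ᶜ = 0) (f : S × ℝ → ℝ) (hf : ∀ z ∈ G, Measurable fun s => f (s, z))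
    (hb : ∀ z ∈ G, ∀ s, f (s, z) ∈ Set.Icc (0 : ℝ) 1) :
    ∫ q, f q ∂mdp.step h p =
      ∑ z ∈ G, (mdp.rew h p).real {z} * ∫ s, f (s, z) ∂mdp.trans h p := by
  have e : f =ᵐ[mdp.step h p] fun q => ∑ z ∈ G, f (q.1, z) * Set.indicator {z} 1 q.2 := by
    filter_upwards [mdp.step_ae_reward h p hG] with q hq
    rw [Finset.sum_eq_single q.2]
    · simp
    · intro z _ hz
      simp [hz.symm]
    · intro hq'; exact absurd hq hq'
  rw [integral_congr_ae e, mdp.step_apply, integral_finsetSum]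
  · refine Finset.sum_congr rfl fun z _ => ?_
    rw [integral_prod_mul (fun s => f (s, z)) (Set.indicator {z} 1),
      integral_indicator_one (measurableSet_singleton z), mul_comm]
  · intro z hz
    refine Integrable.mul_prod (f := fun s => f (s, z)) (g := Set.indicator {z} 1) ?_ ?_
    · exact Integrable.of_mem_Icc 0 1 (hf z hz).aemeasurable (ae_of_all _ fun s => hb z hz s)
    · exact (integrable_indicator_iff (measurableSet_singleton z)).2 (by simp)

variable [Fintype A] {mdp : MDP S A} {H : ℕ} {φ : S → A → EuclideanSpace ℝ (Fin d)} {G : Finset ℝ}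
  {s₁ : ℕ → S}

/-- The nonnegative grid points, which carry the rewards. -/
def rewardGrid (G : Finset ℝ) : Finset ℝ := G.filter fun z => 0 ≤ z ∧ z ≤ 1

lemma IsDiscretizedLinear.rew_rewardGrid (hlin : IsDiscretizedLinear mdp H φ G s₁) {h : ℕ}
    (hh : h < H) (p : S × A) : mdp.rew h p (↑(rewardGrid G))ᶜ = 0 := by
  refine measure_mono_null (t := (↑G)ᶜ ∪ (Set.Icc 0 1)ᶜ) (fun z hz => ?_)
    (measure_union_null (hlin.rew_grid h hh p) (mdp.rew_mem h p))
  by_contra hcon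
  simp only [Set.mem_union, not_or, Set.mem_compl_iff, not_not] at hcon
  exact hz (by
    rw [rewardGrid, Finset.coe_filter]
    exact ⟨hcon.1, hcon.2.1, hcon.2.2⟩)

/-- One-step expectations are linear in the quadratic features, with bounded weights. -/
lemma IsDiscretizedLinear.exists_weight (hlin : IsDiscretizedLinear mdp H φ G s₁) {h : ℕ}
    (hh : h < H) (f : S × ℝ → ℝ) (hf : ∀ z ∈ rewardGrid G, Measurable fun s => f (s, z))
    (hb : ∀ z ∈ rewardGrid G, ∀ s, f (s, z) ∈ Set.Icc (0 : ℝ) 1) :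
    ∃ w : Fin d × Fin d → ℝ, (∀ j, |w j| ≤ 2 * d) ∧
      ∀ s a, ∫ q, f q ∂mdp.step h (s, a) = psi φ s a ⬝ᵥ w := by
  obtain ⟨μ, hμ, hμlin⟩ := hlin.trans_linear h hh
  obtain ⟨θ, hθ, hθlin⟩ := hlin.rew_linear h hh
  have hsub : rewardGrid G ⊆ G := Finset.filter_subset _ _
  have hex : ∀ z : ℝ, ∃ v : EuclideanSpace ℝ (Fin d), ‖v‖ ≤ √(d : ℝ) ∧ (z ∈ rewardGrid G →
      ∀ p : S × A, ∫ s, f (s, z) ∂mdp.trans h p = inner ℝ (φ p.1 p.2) v) := by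
    intro z
    by_cases hz : z ∈ rewardGrid G
    · obtain ⟨v, hv, hv'⟩ := exists_integral_eq_inner (fun p => mdp.trans h p)
        (fun p => inferInstance) (fun p : S × A => φ p.1 p.2) μ hμ
        (fun p B hB => hμlin p.1 p.2 B hB) (hf z hz) (hb z hz)
      exact ⟨v, hv, fun _ => hv'⟩
    · exact ⟨0, by simp, fun hz' => absurd hz' hz⟩
  choose v hv hv' using hex
  -- By independence of reward and next state the expectation is ∑ z ⟨φ, v z⟩⟨φ, θ z⟩, the pairing
  -- of φφᵀ with the matrix ∑ z (v z)(θ z)ᵀ.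
  refine ⟨fun ij => ∑ z ∈ rewardGrid G, v z ij.1 * θ z ij.2, fun ij => ?_, fun s a => ?_⟩
  · have h1 : ∀ z, |v z ij.1| ≤ √(d : ℝ) := fun z =>
      (by simpa using PiLp.norm_apply_le (v z) ij.1 : |v z ij.1| ≤ ‖v z‖).trans (hv z)
    calc |∑ z ∈ rewardGrid G, v z ij.1 * θ z ij.2|
        ≤ ∑ z ∈ rewardGrid G, |v z ij.1 * θ z ij.2| := Finset.abs_sum_le_sum_abs _ _
      _ ≤ ∑ z ∈ rewardGrid G, √(d : ℝ) * |θ z ij.2| := Finset.sum_le_sum fun z _ => by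
          rw [abs_mul]
          exact mul_le_mul_of_nonneg_right (h1 z) (abs_nonneg _)
      _ ≤ √(d : ℝ) * (2 * √(d : ℝ)) := by
          rw [← Finset.mul_sum]
          exact mul_le_mul_of_nonneg_left (sum_abs_le_of_subset_norm_le
            (fun Z hZ => hθ Z (hZ.trans hsub)) ij.2) (Real.sqrt_nonneg _)
      _ = 2 * d := by
          rw [mul_left_comm, Real.mul_self_sqrt (Nat.cast_nonneg d)]
  · rw [mdp.integral_step h (s, a) (hlin.rew_rewardGrid hh _) f hf hb]
    have e : ∀ z ∈ rewardGrid G, (mdp.rew h (s, a)).real {z} * ∫ s', f (s', z) ∂mdp.trans h (s, a) =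
        ∑ ij : Fin d × Fin d, psi φ s a ij * (v z ij.1 * θ z ij.2) := by
      intro z hz
      rw [hθlin s a z (hsub hz), hv' z hz (s, a), mul_comm]
      simp only [PiLp.inner_apply, RCLike.inner_apply, conj_trivial]
      rw [Finset.sum_mul_sum, ← Finset.sum_product', Finset.univ_product_univ]
      exact Finset.sum_congr rfl fun ij _ => by simp only [psi]; ring
    rw [Finset.sum_congr rfl e, Finset.sum_comm]
    simp only [dotProduct, Finset.mul_sum]

end Linear

/-! ### The error of the value estimates -/

section RegressionError

variable {ι : Type*} [Fintype ι] [DecidableEq ι]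

/-- The weighted sum of responses equals noise - w + A w with A the ridge matrix. Applying A⁻¹
recovers w, and Cauchy–Schwarz bounds the noise and the regularization bias -w. -/
lemma ridge_regression_error (x : ℕ → ι → ℝ) (k : ℕ) (g : ℕ → ℝ) (w u : ι → ℝ) :
    |u ⬝ᵥ ((ridge x k)⁻¹ *ᵥ ∑ i ∈ Finset.range k, g i • x i) - u ⬝ᵥ w| ≤
      √(invNormSq (ridge x k) u) *
        (√(invNormSq (ridge x k) (noiseSum x (fun i => g i - x i ⬝ᵥ w) k)) + √(w ⬝ᵥ w)) := by
  have hP := ridge_posDef x k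
  set A := ridge x k with hA
  have hAw : A *ᵥ w = ∑ i ∈ Finset.range k, (x i ⬝ᵥ w) • x i + w := by
    rw [hA, ridge, Matrix.add_mulVec, Matrix.one_mulVec, Matrix.sum_mulVec]
    congr 1
    refine Finset.sum_congr rfl fun i _ => ?_
    rw [Matrix.vecMulVec_mulVec, op_smul_eq_smul]
  have h1 : ∑ i ∈ Finset.range k, g i • x i =
      noiseSum x (fun i => g i - x i ⬝ᵥ w) k + (-1 : ℝ) • w + A *ᵥ w := by
    rw [hAw, noiseSum]
    simp only [sub_smul, Finset.sum_sub_distrib]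
    module
  rw [h1, Matrix.mulVec_add, inv_mulVec_mulVec hP, dotProduct_add, add_sub_cancel_right]
  refine (abs_dotProduct_inv_mulVec_le hP _ _).trans
    (mul_le_mul_of_nonneg_left ?_ (Real.sqrt_nonneg _))
  refine (sqrt_invNormSq_add_le hP _ _).trans ?_
  rw [sqrt_invNormSq_smul]
  have h2 := Real.sqrt_le_sqrt (dotProduct_ridge_inv_le x k w).2
  norm_num
  exact h2

/-- Every feature has inverse Gram norm at most 1, so replacing the regressed function by a nearby
net function costs at most `ε` per sample. -/
lemma sqrt_noiseSum_le (x : ℕ → ι → ℝ) (hx : ∀ i, x i ⬝ᵥ x i ≤ 1) (k : ℕ) (e e' : ℕ → ℝ) {ε : ℝ}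
    (he : ∀ i < k, |e i - e' i| ≤ ε) :
    √(invNormSq (ridge x k) (noiseSum x e k)) ≤
      √(invNormSq (ridge x k) (noiseSum x e' k)) + k * ε := by
  have hP := ridge_posDef x k
  have h1 : noiseSum x e k =
      noiseSum x e' k + ∑ i ∈ Finset.range k, (e i - e' i) • x i := by
    simp only [noiseSum, sub_smul, Finset.sum_sub_distrib]
    abel
  rw [h1]
  refine (sqrt_invNormSq_add_le hP _ _).trans (add_le_add_right ?_ _)
  refine (sqrt_invNormSq_sum_le hP _ _).trans ?_
  calc ∑ i ∈ Finset.range k, √(invNormSq (ridge x k) ((e i - e' i) • x i))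
      ≤ ∑ _i ∈ Finset.range k, ε := Finset.sum_le_sum fun i hi => by
        rw [sqrt_invNormSq_smul]
        have h2 : √(invNormSq (ridge x k) (x i)) ≤ 1 :=
          Real.sqrt_le_one.2 (((dotProduct_ridge_inv_le x k (x i)).2).trans (hx i))
        have h3 := he i (Finset.mem_range.1 hi)
        exact (mul_le_of_le_one_right (abs_nonneg _) h2).trans h3
    _ = k * ε := by simp

/-- This bounds the regression weights of responses in [-1, 1], hence the range `R` that the net has
to cover. -/
lemma abs_inv_mulVec_sum_le (x : ℕ → ι → ℝ) (hx : ∀ i, x i ⬝ᵥ x i ≤ 1) (k : ℕ) (g : ℕ → ℝ)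
    (hg : ∀ i < k, |g i| ≤ 1) (j : ι) :
    |((ridge x k)⁻¹ *ᵥ ∑ i ∈ Finset.range k, g i • x i) j| ≤ k := by
  rw [Matrix.mulVec_sum, Finset.sum_apply]
  refine (Finset.abs_sum_le_sum_abs _ _).trans ?_
  calc ∑ i ∈ Finset.range k, |((ridge x k)⁻¹ *ᵥ (g i • x i)) j|
      ≤ ∑ _i ∈ Finset.range k, (1 : ℝ) := Finset.sum_le_sum fun i hi => by
        rw [Matrix.mulVec_smul, Pi.smul_apply, smul_eq_mul, abs_mul]
        have h1 : |((ridge x k)⁻¹ *ᵥ x i) j| ≤ 1 := by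
          rw [← sq_le_one_iff_abs_le_one]
          exact (inv_apply_sq_le x k (x i) j).trans (hx i)
        exact mul_le_one₀ (hg i (Finset.mem_range.1 hi)) (abs_nonneg _) h1
    _ = k := by simp

end RegressionError

/-! ### Accuracy of the value estimates on the concentration event. -/

section Algorithm

variable {S A : Type*} [MeasurableSpace S] [MeasurableSpace A] {d : ℕ}

/-- The feature observed at step `h` of episode `i`. -/
def Input.feat (I : Input S A d) (D : Data S A) (h i : ℕ) : Fin d × Fin d → ℝ :=
  psi I.φ (D.st i h) (D.ac i h)

lemma Input.gram_eq_ridge (I : Input S A d) (hlam : I.lam = 1) (D : Data S A) (k h : ℕ) :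
    I.gram D k h = ridge (I.feat D h) k := by
  rw [gram, hlam, one_smul]; rfl

/-- The deviation of `f` at the observed next state and reward from its expectation. -/
def sampleNoise (mdp : MDP S A) (D : Data S A) (h : ℕ) (f : S × ℝ → ℝ) (i : ℕ) : ℝ :=
  f (D.st i (h + 1), D.rw i h) - ∫ q, f q ∂mdp.step h (D.st i h, D.ac i h)

variable [Fintype A] [Nonempty A]

/-- The event that, at the beginning of episode `k`, all rewards lie on the grid and all
self-normalized sums of the noise of the functions in the net are at most `ρ`. -/
def ConcentrationEvent (I : Input S A d) (mdp : MDP S A) (b R : ℝ) (N : ℕ) (ρ : ℝ) (k : ℕ)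
    (D : Data S A) : Prop :=
  ∀ h < I.H, (∀ i < k, D.rw i h ∈ rewardGrid I.grid) ∧
    ∀ θ : NetIndex d (rewardGrid I.grid) N,
      √(invNormSq (ridge (I.feat D h) k)
        (noiseSum (I.feat D h) (sampleNoise mdp D h (netFun I.φ b R θ)) k)) ≤ ρ

lemma Input.argminAct_le (I : Input S A d) (htie : ∀ T : Finset A, T.Nonempty → I.tieA T ∈ T)
    (q : A → ℝ) (a : A) : q (I.argminAct q) ≤ q a := by
  classical
  obtain ⟨a₀, -, ha₀⟩ := Finset.exists_min_image Finset.univ q (Finset.univ_nonempty (α := A))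
  have h := htie (Finset.univ.filter fun a => ∀ a', q a ≤ q a')
    ⟨a₀, by simpa using fun a' => ha₀ a' (Finset.mem_univ a')⟩
  have h2 := (Finset.mem_filter.1 h).2 a
  convert h2 using 2
  simp only [argminAct]

lemma Input.argminAct_eq_inf' (I : Input S A d) (htie : ∀ T : Finset A, T.Nonempty → I.tieA T ∈ T)
    (q : A → ℝ) : q (I.argminAct q) = Finset.univ.inf' Finset.univ_nonempty q :=
  le_antisymm (Finset.le_inf' _ _ fun a _ => I.argminAct_le htie q a)
    (Finset.inf'_le _ (Finset.mem_univ _))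

variable {I : Input S A d} {mdp : MDP S A} {s₁ : ℕ → S} {b R ρ ε : ℝ} {N k : ℕ} {D : Data S A}

/-- The function `f` may depend on the data: the net function chosen near it is covered by the
event. The three terms on the right are the noise of the net function, the approximation error (ε
from the sample and ε from its mean, k times), and the regularization bias. -/
lemma regression_close (hlin : IsDiscretizedLinear mdp I.H I.φ I.grid s₁)
    (hb : 0 ≤ b) (hR : 0 < R) (hN : 0 < N)
    (hε : (d : ℝ) ^ 2 * (2 * R / N) + b * √((d : ℝ) ^ 4 * (2 / N)) ≤ ε) (hε' : 2 / N ≤ ε)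
    (hE : ConcentrationEvent I mdp b R N ρ k D) {h : ℕ} (hh : h < I.H) (f : S × ℝ → ℝ)
    (w : ℝ → Fin d × Fin d → ℝ) (B : Matrix (Fin d × Fin d) (Fin d × Fin d) ℝ) (c : ℝ → ℝ)
    (hw : ∀ z ∈ rewardGrid I.grid, ∀ j, |w z j| ≤ R) (hB : ∀ i j, |B i j| ≤ 1)
    (hc : ∀ z ∈ rewardGrid I.grid, |c z| ≤ 1)
    (hf : ∀ s, ∀ z ∈ rewardGrid I.grid, f (s, z) = clippedV I.φ b (w z) B (c z) s) (s : S) (a : A) :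
    |psi I.φ s a ⬝ᵥ ((ridge (I.feat D h) k)⁻¹ *ᵥ ∑ i ∈ Finset.range k,
        f (D.st i (h + 1), D.rw i h) • I.feat D h i) - ∫ q, f q ∂mdp.step h (s, a)| ≤
      √(invNormSq (ridge (I.feat D h) k) (psi I.φ s a)) * (ρ + k * (2 * ε) + 2 * d ^ 2) := by
  have hφ := hlin.feature_norm
  have hx : ∀ i, I.feat D h i ⬝ᵥ I.feat D h i ≤ 1 := fun i => psi_dotProduct_self_le hφ _ _
  have hfm : ∀ z ∈ rewardGrid I.grid, Measurable fun s => f (s, z) := fun z hz => by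
    simp only [hf _ z hz]
    exact measurable_clippedV hlin.feature_measurable _ _ _ _
  have hf01 : ∀ z ∈ rewardGrid I.grid, ∀ s, f (s, z) ∈ Set.Icc (0 : ℝ) 1 := fun z hz s => by
    rw [hf s z hz]; exact clippedV_mem _ _ _ _ _ _
  obtain ⟨w', hw', hexp⟩ := hlin.exists_weight hh f hfm hf01
  obtain ⟨θ, hθ⟩ := exists_netFun_close (G := rewardGrid I.grid) hφ hb hR hN hε hε' w B c hw hB hc
  obtain ⟨hrw, hρ⟩ := hE h hh
  rw [hexp s a]
  refine (ridge_regression_error _ k _ w' _).trans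
    (mul_le_mul_of_nonneg_left ?_ (Real.sqrt_nonneg _))
  -- There are d² coordinates of size at most 2d.
  have h1 : √(w' ⬝ᵥ w') ≤ 2 * d ^ 2 := by
    rw [Real.sqrt_le_left (by positivity)]
    have : w' ⬝ᵥ w' ≤ ∑ _j : Fin d × Fin d, (2 * d : ℝ) * (2 * d) := Finset.sum_le_sum fun j _ => by
      rw [← abs_mul_abs_self]
      exact mul_le_mul (hw' j) (hw' j) (abs_nonneg _) (by positivity)
    refine this.trans (le_of_eq ?_)
    simp
    ring
  refine add_le_add ?_ h1
  refine (sqrt_noiseSum_le _ hx k _ (sampleNoise mdp D h (netFun I.φ b R θ)) (ε := 2 * ε)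
    fun i hi => ?_).trans (add_le_add_left (hρ θ) _)
  have e : I.feat D h i ⬝ᵥ w' = ∫ q, f q ∂mdp.step h (D.st i h, D.ac i h) :=
    (hexp (D.st i h) (D.ac i h)).symm
  rw [e, sampleNoise]
  have hnet01 : ∀ z ∈ rewardGrid I.grid, ∀ s,
      netFun I.φ b R θ (s, z) ∈ Set.Icc (0 : ℝ) 1 := fun z _ s => netFun_mem θ _
  have hnetm : ∀ z ∈ rewardGrid I.grid, Measurable fun s => netFun I.φ b R θ (s, z) := fun z _ =>
    (measurable_netFun hlin.feature_measurable b R θ).comp measurable_prodMk_right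
  have d1 : |f (D.st i (h + 1), D.rw i h) - netFun I.φ b R θ (D.st i (h + 1), D.rw i h)| ≤ ε := by
    rw [hf _ _ (hrw i hi)]
    exact hθ _ _ (hrw i hi)
  have d2 : |∫ q, f q ∂mdp.step h (D.st i h, D.ac i h) -
      ∫ q, netFun I.φ b R θ q ∂mdp.step h (D.st i h, D.ac i h)| ≤ ε := by
    have hG := hlin.rew_rewardGrid hh (D.st i h, D.ac i h)
    have hae : ∀ᵐ q ∂mdp.step h (D.st i h, D.ac i h), q.2 ∈ rewardGrid I.grid :=
      mdp.step_ae_reward h (D.st i h, D.ac i h) hG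
    -- `f` is controlled only at grid rewards, so it is replaced almost surely by a finite sum of
    -- its measurable slices.
    have e1 : ∫ q, f q ∂mdp.step h (D.st i h, D.ac i h) =
        ∫ q, ∑ z ∈ rewardGrid I.grid, (if q.2 = z then f (q.1, z) else 0)
          ∂mdp.step h (D.st i h, D.ac i h) := by
      refine integral_congr_ae ?_
      filter_upwards [hae] with q hq
      rw [Finset.sum_ite_eq, if_pos hq]
    have hi1 : Integrable (fun q : S × ℝ => ∑ z ∈ rewardGrid I.grid,
        (if q.2 = z then f (q.1, z) else 0)) (mdp.step h (D.st i h, D.ac i h)) := by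
      refine integrable_finsetSum _ fun z hz => Integrable.of_mem_Icc 0 1 ?_ (ae_of_all _ fun q => ?_)
      · exact (Measurable.ite (measurable_snd (measurableSet_singleton z))
          ((hfm z hz).comp measurable_fst) measurable_const).aemeasurable
      · split_ifs
        · exact hf01 z hz _
        · simp
    have hi2 : Integrable (netFun I.φ b R θ) (mdp.step h (D.st i h, D.ac i h)) :=
      Integrable.of_mem_Icc 0 1 (measurable_netFun hlin.feature_measurable b R θ).aemeasurable
        (ae_of_all _ fun q => netFun_mem θ q)
    rw [e1, ← integral_sub hi1 hi2, ← Real.norm_eq_abs]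
    refine (norm_integral_le_of_norm_le_const (μ := mdp.step h (D.st i h, D.ac i h))
      (C := ε) ?_).trans (le_of_eq (by simp))
    filter_upwards [hae] with q hq
    rw [Finset.sum_ite_eq, if_pos hq, Real.norm_eq_abs]
    have : f q = f (q.1, q.2) := rfl
    rw [this, hf _ _ hq]
    exact hθ _ _ hq
  calc _ = |(f (D.st i (h + 1), D.rw i h) - netFun I.φ b R θ (D.st i (h + 1), D.rw i h)) -
        (∫ q, f q ∂mdp.step h (D.st i h, D.ac i h) -
          ∫ q, netFun I.φ b R θ q ∂mdp.step h (D.st i h, D.ac i h))| := by congr 1; ring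
    _ ≤ ε + ε := (abs_sub _ _).trans (add_le_add d1 d2)
    _ = 2 * ε := by ring

/-- The value function with `n` steps to go, divided by the horizon, has the form of the functions
approximated by the net. -/
def IsClippedLinear (I : Input S A d) (D : Data S A) (k n : ℕ) (R : ℝ) : Prop :=
  ∃ (w : ℝ → Fin d × Fin d → ℝ) (B : Matrix (Fin d × Fin d) (Fin d × Fin d) ℝ) (c : ℝ → ℝ),
    (∀ i j, |B i j| ≤ 1) ∧ ∀ y, -(I.H : ℝ) ≤ y → (∀ j, |w y j| ≤ R) ∧ |c y| ≤ 1 ∧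
      ∀ s, I.vToGo D k n s y = I.H * clippedV I.φ (I.β / I.H) (w y) B (c y) s

lemma IsClippedLinear.mem_Icc {n : ℕ} (h : IsClippedLinear I D k n R) {y : ℝ}
    (hy : -(I.H : ℝ) ≤ y) (s : S) : I.vToGo D k n s y ∈ Set.Icc (0 : ℝ) I.H := by
  obtain ⟨w, B, c, -, h⟩ := h
  rw [(h y hy).2.2 s]
  obtain ⟨h0, h1⟩ := clippedV_mem I.φ (I.β / I.H) (w y) B (c y) s
  exact ⟨mul_nonneg (Nat.cast_nonneg _) h0, mul_le_of_le_one_right (Nat.cast_nonneg _) h1⟩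

/-- Dividing by the horizon puts the values in [0, 1], the scale of the concentration event; `hρ`
says that β covers the resulting error after rescaling. Rewards are nonnegative, so y + r stays in
the range y ≥ -H where the representation holds. -/
lemma IsClippedLinear.weight_close (hlin : IsDiscretizedLinear mdp I.H I.φ I.grid s₁)
    (hlam : I.lam = 1) (hH : 1 ≤ I.H) (hβ : 0 ≤ I.β) (hR : 0 < R) (hN : 0 < N)
    (hε : (d : ℝ) ^ 2 * (2 * R / N) + I.β / I.H * √((d : ℝ) ^ 4 * (2 / N)) ≤ ε) (hε' : 2 / N ≤ ε)
    (hE : ConcentrationEvent I mdp (I.β / I.H) R N ρ k D)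
    (hρ : I.H * (ρ + k * (2 * ε) + 2 * d ^ 2) ≤ I.β) {n : ℕ}
    (hV : IsClippedLinear I D k n R) {h : ℕ} (hh : h < I.H) {y : ℝ} (hy : -(I.H : ℝ) ≤ y)
    (s : S) (a : A) :
    |psi I.φ s a ⬝ᵥ I.weight D k h (I.vToGo D k n) y -
      ∫ q, I.vToGo D k n q.1 (y + q.2) ∂mdp.step h (s, a)| ≤ I.bonus D k h s a := by
  have hH' : (0 : ℝ) < I.H := by exact_mod_cast hH
  obtain ⟨w, B, c, hB, hw⟩ := hV
  have hz0 : ∀ z ∈ rewardGrid I.grid, 0 ≤ z := fun z hz => (Finset.mem_filter.1 hz).2.1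
  have hyz : ∀ z ∈ rewardGrid I.grid, -(I.H : ℝ) ≤ y + z := fun z hz => by linarith [hz0 z hz]
  have h1 := regression_close hlin (div_nonneg hβ hH'.le) hR hN hε hε' hE hh
    (fun q => (I.H : ℝ)⁻¹ * I.vToGo D k n q.1 (y + q.2)) (fun z => w (y + z)) B (fun z => c (y + z))
    (fun z hz => (hw _ (hyz z hz)).1) hB (fun z hz => (hw _ (hyz z hz)).2.1)
    (fun s z hz => by
      dsimp only
      rw [(hw _ (hyz z hz)).2.2 s, inv_mul_cancel_left₀ hH'.ne']) s a
  have e1 : ∑ i ∈ Finset.range k, ((I.H : ℝ)⁻¹ * I.vToGo D k n (D.st i (h + 1)) (y + D.rw i h)) •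
      I.feat D h i = (I.H : ℝ)⁻¹ • ∑ i ∈ Finset.range k,
        I.vToGo D k n (D.st i (h + 1)) (y + D.rw i h) • I.feat D h i := by
    rw [Finset.smul_sum]
    exact Finset.sum_congr rfl fun i _ => by rw [smul_smul]
  dsimp only at h1
  rw [e1, Matrix.mulVec_smul, dotProduct_smul, integral_const_mul, smul_eq_mul, ← mul_sub, abs_mul,
    abs_of_pos (inv_pos.2 hH'), inv_mul_le_iff₀ hH'] at h1
  rw [Input.weight, Input.bonus, I.gram_eq_ridge hlam]
  refine h1.trans ?_
  rw [mul_left_comm, mul_comm I.β]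
  exact mul_le_mul_of_nonneg_left hρ (Real.sqrt_nonneg _)

lemma IsClippedLinear.zero (hH : 1 ≤ I.H) (hR : 0 < R) : IsClippedLinear I D k 0 R := by
  have hH' : (0 : ℝ) < I.H := by exact_mod_cast hH
  -- The truncation level exists for the terminal value alone, which is a function of y; at all
  -- other steps it is 0.
  refine ⟨0, 0, fun y => max (-y) 0 / I.H, by simp, fun y hy => ⟨fun j => by simpa using hR.le, ?_, ?_⟩⟩
  · rw [abs_of_nonneg (by positivity), div_le_one hH']
    exact max_le (by linarith) hH'.le
  · intro s
    have h0 : linQ I.φ (I.β / I.H) ((0 : ℝ → Fin d × Fin d → ℝ) y) 0 s = fun _ => 0 := by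
      ext a; simp [linQ]
    have h1 : 0 ≤ max (-y) 0 / (I.H : ℝ) := by positivity
    have h2 : max (-y) 0 / (I.H : ℝ) ≤ 1 := by
      rw [div_le_one hH']
      exact max_le (by linarith) hH'.le
    rw [clippedV, h0, Finset.inf'_const, max_eq_right h1, max_eq_left h1, min_eq_left h2,
      mul_div_cancel₀ _ hH'.ne']
    rfl

/-- On the concentration event, all value functions are bounded by the horizon and belong to the
class approximated by the net. -/
lemma isClippedLinear_of_concentrationEvent (hlin : IsDiscretizedLinear mdp I.H I.φ I.grid s₁)
    (htie : ∀ T : Finset A, T.Nonempty → I.tieA T ∈ T)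
    (hlam : I.lam = 1) (hH : 1 ≤ I.H) (hβ : 0 ≤ I.β) (hR : 0 < R) (hN : 0 < N)
    (hε : (d : ℝ) ^ 2 * (2 * R / N) + I.β / I.H * √((d : ℝ) ^ 4 * (2 / N)) ≤ ε) (hε' : 2 / N ≤ ε)
    (hE : ConcentrationEvent I mdp (I.β / I.H) R N ρ k D)
    (hρ : I.H * (ρ + k * (2 * ε) + 2 * d ^ 2) ≤ I.β) (hkR : k ≤ R) {n : ℕ} (hn : n ≤ I.H) :
    IsClippedLinear I D k n R := by
  have hH' : (0 : ℝ) < I.H := by exact_mod_cast hH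
  induction n with
  | zero => exact IsClippedLinear.zero hH hR
  | succ n ih =>
    have hV := ih (Nat.le_of_succ_le hn)
    set h := I.H - (n + 1) with hhd
    have hh : h < I.H := by omega
    have hx : ∀ i, I.feat D h i ⬝ᵥ I.feat D h i ≤ 1 :=
      fun i => psi_dotProduct_self_le hlin.feature_norm _ _
    have hrw := (hE h hh).1
    refine ⟨fun y => (I.H : ℝ)⁻¹ • I.weight D k h (I.vToGo D k n) y, (ridge (I.feat D h) k)⁻¹, 0,
      abs_ridge_inv_apply_le _ _, fun y hy => ⟨fun j => ?_, by simp, fun s => ?_⟩⟩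
    · have e1 : (I.H : ℝ)⁻¹ • I.weight D k h (I.vToGo D k n) y =
          (ridge (I.feat D h) k)⁻¹ *ᵥ ∑ i ∈ Finset.range k,
            ((I.H : ℝ)⁻¹ * I.vToGo D k n (D.st i (h + 1)) (y + D.rw i h)) • I.feat D h i := by
        rw [Input.weight, I.gram_eq_ridge hlam, ← Matrix.mulVec_smul, Finset.smul_sum]
        congr 1
        exact Finset.sum_congr rfl fun i _ => by rw [smul_smul]; rfl
      beta_reduce
      rw [e1]
      refine (abs_inv_mulVec_sum_le _ hx k _ (fun i hi => ?_) j).trans hkR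
      have hr0 : 0 ≤ D.rw i h := (Finset.mem_filter.1 (hrw i hi)).2.1
      obtain ⟨v0, v1⟩ := hV.mem_Icc (y := y + D.rw i h) (by linarith) (D.st i (h + 1))
      rw [abs_of_nonneg (mul_nonneg (inv_nonneg.2 hH'.le) v0), inv_mul_le_iff₀ hH', mul_one]
      exact v1
    · have hQ : ∀ a, I.qOf D k h (I.vToGo D k n) s y a = I.H *
          linQ I.φ (I.β / I.H) ((I.H : ℝ)⁻¹ • I.weight D k h (I.vToGo D k n) y)
            (ridge (I.feat D h) k)⁻¹ s a := by
        intro a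
        rw [Input.qOf, linQ, Input.bonus, I.gram_eq_ridge hlam, dotProduct_smul, smul_eq_mul]
        field_simp
      have hinf : I.qOf D k h (I.vToGo D k n) s y (I.argminAct (I.qOf D k h (I.vToGo D k n) s y)) =
          I.H * Finset.univ.inf' Finset.univ_nonempty
            (linQ I.φ (I.β / I.H) ((I.H : ℝ)⁻¹ • I.weight D k h (I.vToGo D k n) y)
              (ridge (I.feat D h) k)⁻¹ s) := by
        rw [I.argminAct_eq_inf' htie (I.qOf D k h (I.vToGo D k n) s y)]
        refine le_antisymm ?_ ?_
        · obtain ⟨a, -, ha⟩ := Finset.exists_mem_eq_inf' (Finset.univ_nonempty (α := A))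
            (linQ I.φ (I.β / I.H) ((I.H : ℝ)⁻¹ • I.weight D k h (I.vToGo D k n) y)
              (ridge (I.feat D h) k)⁻¹ s)
          rw [ha, ← hQ a]
          exact Finset.inf'_le _ (Finset.mem_univ a)
        · refine Finset.le_inf' _ _ fun a _ => ?_
          rw [hQ a]
          exact mul_le_mul_of_nonneg_left (Finset.inf'_le _ (Finset.mem_univ a)) hH'.le
      -- The algorithm does not clip from above. The estimate minus its bonus is at most a true
      -- expectation, which is at most H, so the clipping at 1 in `clippedV` is inactive.
      have hle : I.qOf D k h (I.vToGo D k n) s y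
          (I.argminAct (I.qOf D k h (I.vToGo D k n) s y)) ≤ I.H := by
        set a := I.argminAct (I.qOf D k h (I.vToGo D k n) s y)
        have h1 := (abs_le.1 (hV.weight_close hlin hlam hH hβ hR hN hε hε' hE hρ hh hy s a)).2
        have h2 : ∫ q, I.vToGo D k n q.1 (y + q.2) ∂mdp.step h (s, a) ≤ I.H := by
          have := norm_integral_le_of_norm_le_const (μ := mdp.step h (s, a)) (C := I.H)
            (f := fun q : S × ℝ => I.vToGo D k n q.1 (y + q.2)) (by
              filter_upwards [mdp.step_ae_reward h (s, a) (hlin.rew_rewardGrid hh _)] with q hq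
              have hq0 : 0 ≤ q.2 := (Finset.mem_filter.1 hq).2.1
              obtain ⟨v0, v1⟩ := hV.mem_Icc (y := y + q.2) (by linarith) q.1
              rwa [Real.norm_of_nonneg v0])
          rw [probReal_univ, mul_one] at this
          exact (le_abs_self _).trans this
        rw [Input.qOf]
        linarith
      change max (I.qOf D k h (I.vToGo D k n) s y
        (I.argminAct (I.qOf D k h (I.vToGo D k n) s y))) 0 = _
      rw [hinf] at hle ⊢
      rw [clippedV, Pi.zero_apply, max_assoc, max_self, mul_min_of_nonneg _ _ hH'.le,
        mul_max_of_nonneg _ _ hH'.le, mul_one, mul_zero, min_eq_left]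
      exact max_le hle hH'.le

end Algorithm

/-! ### Measurability of the algorithm -/

section AlgorithmMeasurability

/-- Only finitely many subsets can occur, and each occurs on a measurable set. Hence an arbitrary
tie-breaking rule `g` is allowed. -/
lemma measurable_comp_filter {E α β : Type*} {mE : MeasurableSpace E} [MeasurableSpace β]
    (s : Finset α) (g : Finset α → β) (p : E → α → Prop) [∀ e, DecidablePred (p e)]
    (hp : ∀ a ∈ s, MeasurableSet {e | p e a}) : Measurable fun e => g (s.filter (p e)) := by
  classical
  intro B _
  have e1 : (fun e => g (s.filter (p e))) ⁻¹' B = ⋃ T ∈ s.powerset.filter fun T => g T ∈ B,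
      ⋂ a ∈ s, {e | a ∈ T ↔ p e a} := by
    ext e
    simp only [Set.mem_preimage, Set.mem_iUnion, Set.mem_iInter, Set.mem_ofPred_eq,
      Finset.mem_filter, Finset.mem_powerset, exists_prop]
    constructor
    · intro h
      exact ⟨_, ⟨Finset.filter_subset _ _, h⟩, fun a ha => by simp [ha]⟩
    · rintro ⟨T, ⟨hT, hTB⟩, h⟩
      have : s.filter (p e) = T := by
        ext a
        rw [Finset.mem_filter]
        exact ⟨fun h' => (h a h'.1).2 h'.2, fun h' => ⟨hT h', (h a (hT h')).1 h'⟩⟩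
      rwa [this]
  rw [e1]
  refine Finset.measurableSet_biUnion _ fun T _ => Finset.measurableSet_biInter _ fun a ha => ?_
  by_cases haT : a ∈ T
  · simpa [haT] using hp a ha
  · simp only [haT, false_iff]
    exact (hp a ha).compl

variable {S A E F : Type*} [MeasurableSpace S] [MeasurableSpace A] [MeasurableSingletonClass A]
  [Fintype A] {mE : MeasurableSpace E} {mF : MeasurableSpace F} {d : ℕ} {I : Input S A d}

lemma measurable_apply_action {q : F → A → ℝ} (hq : ∀ a, Measurable fun e => q e a) {α : F → A}
    (hα : Measurable α) : Measurable fun e => q e (α e) := by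
  have h : Measurable fun p : F × A => q p.1 p.2 :=
    measurable_from_prod_countable_left fun a => hq a
  exact h.comp (measurable_id.prodMk hα)

lemma measurable_argminAct {q : F → A → ℝ} (hq : ∀ a, Measurable fun e => q e a) :
    Measurable fun e => I.argminAct (q e) := by
  classical
  refine measurable_comp_filter Finset.univ I.tieA (fun e a => ∀ a', q e a ≤ q e a') fun a _ => ?_
  have : {e | ∀ a', q e a ≤ q e a'} = ⋂ a', {e | q e a ≤ q e a'} := by ext; simp
  rw [this]
  exact MeasurableSet.iInter fun a' => measurableSet_le (hq a) (hq a')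

/-- The data of the episodes before `k` and of the steps before `T` depend measurably on a
parameter. -/
def MeasurableData (mE : MeasurableSpace E) (D : E → Data S A) (k T : ℕ) : Prop :=
  ∀ i < k, ∀ h < T, (Measurable fun e => (D e).st i h) ∧ (Measurable fun e => (D e).ac i h) ∧
    (Measurable fun e => (D e).rw i h) ∧ Measurable fun e => (D e).st i (h + 1)

variable {D : E → Data S A} {k T : ℕ}

lemma MeasurableData.feat (hD : MeasurableData mE D k T) (hφ : ∀ a, Measurable fun s => I.φ s a)
    {i h : ℕ} (hi : i < k) (hh : h < T) (j : Fin d × Fin d) :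
    Measurable fun e => I.feat (D e) h i j := by
  obtain ⟨h1, h2, -, -⟩ := hD i hi h hh
  exact measurable_apply_action (q := fun e a => psi I.φ ((D e).st i h) a j)
    (fun a => (measurable_psi_apply hφ a j).comp h1) h2

lemma MeasurableData.gram_apply (hD : MeasurableData mE D k T) (hφ : ∀ a, Measurable fun s => I.φ s a)
    (hlam : I.lam = 1) {h : ℕ} (hh : h < T) (i j : Fin d × Fin d) :
    Measurable fun e => I.gram (D e) k h i j := by
  simp only [I.gram_eq_ridge hlam]
  exact measurable_ridge_apply (x := fun e => I.feat (D e) h) (fun i' hi' => hD.feat hφ hi' hh) i j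

lemma MeasurableData.sqrt_invNormSq (hD : MeasurableData mE D k T)
    (hφ : ∀ a, Measurable fun s => I.φ s a) (hlam : I.lam = 1) {h : ℕ} (hh : h < T) {e : F → E}
    (he : Measurable e) {s : F → S} (hs : Measurable s) {α : F → A} (hα : Measurable α) :
    Measurable fun p => √(invNormSq (I.gram (D (e p)) k h) (psi I.φ (s p) (α p))) := by
  refine measurable_apply_action (q := fun p a => √(invNormSq (I.gram (D (e p)) k h)
    (psi I.φ (s p) a))) (fun a => Measurable.sqrt ?_) hα
  exact measurable_invNormSq (fun i j => (hD.gram_apply hφ hlam hh i j).comp he)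
    fun j => (measurable_psi_apply hφ a j).comp hs

lemma MeasurableData.qOf (hD : MeasurableData mE D k T) (hφ : ∀ a, Measurable fun s => I.φ s a)
    (hlam : I.lam = 1) {h : ℕ} (hh : h < T) {V : E → S → ℝ → ℝ}
    (hV : Measurable fun p : E × S × ℝ => V p.1 p.2.1 p.2.2) (a : A) :
    Measurable fun p : E × S × ℝ => I.qOf (D p.1) k h (V p.1) p.2.1 p.2.2 a := by
  have hψ : ∀ j, Measurable fun p : E × S × ℝ => psi I.φ p.2.1 a j := fun j =>
    (measurable_psi_apply hφ a j).comp (measurable_fst.comp measurable_snd)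
  have hinv : ∀ i j, Measurable fun p : E × S × ℝ => (I.gram (D p.1) k h)⁻¹ i j := fun i j =>
    measurable_inv_apply (fun i j => (hD.gram_apply hφ hlam hh i j).comp measurable_fst) i j
  refine Measurable.sub (measurable_dotProduct hψ fun j => measurable_mulVec hinv (fun j => ?_) j)
    (Measurable.const_mul (Measurable.sqrt (measurable_dotProduct hψ (measurable_mulVec hinv hψ)))
      _)
  simp only [Finset.sum_apply, Pi.smul_apply, smul_eq_mul]
  refine Finset.measurable_sum _ fun i hi => ?_
  have hik := Finset.mem_range.1 hi
  refine Measurable.mul ?_ ((hD.feat hφ hik hh j).comp measurable_fst)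
  obtain ⟨-, -, h3, h4⟩ := hD i hik h hh
  exact hV.comp (measurable_fst.prodMk ((h4.comp measurable_fst).prodMk
    ((measurable_snd.comp measurable_snd).add (h3.comp measurable_fst))))

lemma MeasurableData.vToGo (hD : MeasurableData mE D k T) (hφ : ∀ a, Measurable fun s => I.φ s a)
    (hlam : I.lam = 1) (hH : 1 ≤ I.H) (hT : I.H ≤ T) (n : ℕ) :
    Measurable fun p : E × S × ℝ => I.vToGo (D p.1) k n p.2.1 p.2.2 := by
  induction n with
  | zero => exact ((measurable_snd.comp measurable_snd).neg).max measurable_const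
  | succ n ih =>
    -- For n ≥ H the truncated subtraction gives step 0, which is below `T` because H ≥ 1; no
    -- restriction on `n` is needed.
    have hh : I.H - (n + 1) < T := by omega
    have hq := hD.qOf (V := fun e => I.vToGo (D e) k n) hφ hlam hh ih
    exact (measurable_apply_action hq (measurable_argminAct hq)).max measurable_const

lemma MeasurableData.policy (hD : MeasurableData mE D k T) (hφ : ∀ a, Measurable fun s => I.φ s a)
    (hlam : I.lam = 1) (hH : 1 ≤ I.H) (hT : I.H ≤ T) {h : ℕ} (hh : h < T) :
    Measurable fun p : E × S × ℝ => I.policy (D p.1) k h p.2.1 p.2.2 :=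
  measurable_argminAct
    (hD.qOf (V := fun e => I.vToGo (D e) k (I.H - (h + 1))) hφ hlam hh (hD.vToGo hφ hlam hH hT _))

lemma MeasurableData.budget (hD : MeasurableData mE D k T) (hφ : ∀ a, Measurable fun s => I.φ s a)
    (hlam : I.lam = 1) (hH : 1 ≤ I.H) (hT : I.H ≤ T) (s : S) :
    Measurable fun e => I.budget (D e) k s := by
  classical
  have hobj : ∀ b, Measurable fun e => I.objective (D e) k s b := fun b => by
    have h : Measurable fun e => I.vToGo (D e) k I.H s (-b) :=
      (hD.vToGo hφ hlam hH hT I.H).comp (measurable_id.prodMk (measurable_const (a := (s, -b))))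
    exact (h.const_mul _).const_sub _
  refine measurable_comp_filter (I.grid.filter fun b => 0 ≤ b) I.tieB
    (fun e b => ∀ b' ∈ I.grid, 0 ≤ b' → I.objective (D e) k s b' ≤ I.objective (D e) k s b)
    fun b _ => ?_
  have : {e | ∀ b' ∈ I.grid, 0 ≤ b' → I.objective (D e) k s b' ≤ I.objective (D e) k s b} =
      ⋂ b' ∈ I.grid.filter fun b => 0 ≤ b,
        {e | I.objective (D e) k s b' ≤ I.objective (D e) k s b} := by
    ext e
    simp only [Set.mem_ofPred_eq, Finset.mem_filter, Set.mem_iInter]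
    exact ⟨fun h b' hb' => h b' hb'.1 hb'.2, fun h b' h1 h2 => h b' ⟨h1, h2⟩⟩
  rw [this]
  exact Finset.measurableSet_biInter _ fun b' _ => measurableSet_le (hobj b') (hobj b)

/-- The expected sum of the norms of the features over the last `n` steps, when the policy of
episode `k` is followed from the augmented state `(s, y)`. -/
def expectedWidth (mdp : MDP S A) (I : Input S A d) (D : Data S A) (k : ℕ) : ℕ → S → ℝ → ℝ≥0∞
  | 0 => fun _ _ => 0
  | n + 1 => fun s y =>
      ENNReal.ofReal (√(invNormSq (I.gram D k (I.H - (n + 1)))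
        (psi I.φ s (I.policy D k (I.H - (n + 1)) s y)))) +
      ∫⁻ q, expectedWidth mdp I D k n q.1 (y + q.2)
        ∂mdp.step (I.H - (n + 1)) (s, I.policy D k (I.H - (n + 1)) s y)

lemma MeasurableData.expectedWidth (mdp : MDP S A) (hD : MeasurableData mE D k T)
    (hφ : ∀ a, Measurable fun s => I.φ s a) (hlam : I.lam = 1) (hH : 1 ≤ I.H) (hT : I.H ≤ T)
    (n : ℕ) : Measurable fun p : E × S × ℝ => expectedWidth mdp I (D p.1) k n p.2.1 p.2.2 := by
  induction n with
  | zero => exact measurable_const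
  | succ n ih =>
    have hh : I.H - (n + 1) < T := by omega
    have hπ := hD.policy hφ hlam hH hT hh
    have hs : Measurable fun p : E × S × ℝ => p.2.1 := measurable_fst.comp measurable_snd
    refine Measurable.add (hD.sqrt_invNormSq hφ hlam hh measurable_fst hs hπ).ennreal_ofReal ?_
    let κ : Kernel (E × S × ℝ) (S × ℝ) := (mdp.step (I.H - (n + 1))).comap
      (fun p => (p.2.1, I.policy (D p.1) k (I.H - (n + 1)) p.2.1 p.2.2)) (hs.prodMk hπ)
    refine Measurable.lintegral_kernel_prod_right' (κ := κ) (f := fun r : (E × S × ℝ) × S × ℝ =>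
      RiskRL.expectedWidth mdp I (D r.1.1) k n r.2.1 (r.1.2.2 + r.2.2)) ?_
    exact ih.comp ((measurable_fst.comp measurable_fst).prodMk
      ((measurable_fst.comp measurable_snd).prodMk
        ((measurable_snd.comp (measurable_snd.comp measurable_fst)).add
          (measurable_snd.comp measurable_snd))))

end AlgorithmMeasurability

/-! ### The law of the return -/

section ReturnLaw

variable {S A : Type*} [MeasurableSpace S] [MeasurableSpace A]

lemma measurable_snoc {E : Type*} {mE : MeasurableSpace E} {h : ℕ} {f : E → Fin h → S × A × ℝ}
    (hf : Measurable f) {g : E → S × A × ℝ} (hg : Measurable g) :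
    Measurable fun e => Fin.snoc (α := fun _ => S × A × ℝ) (f e) (g e) := by
  refine measurable_pi_lambda _ fun i => ?_
  induction i using Fin.lastCases with
  | last => simpa only [Fin.snoc_last] using hg
  | cast i => 
    simp only [Fin.snoc_castSucc]
    exact (measurable_pi_apply i).comp hf

variable [Fintype A] (mdp : MDP S A) {π : HistPolicy S A}

/-- The law of the return of the remaining steps after one step. -/
def nextLaw (mdp : MDP S A) (π : HistPolicy S A) (n : ℕ) {h : ℕ} (hist : Fin h → S × A × ℝ) (s : S)
    (a : A) (q : S × ℝ) : Measure ℝ :=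
  returnLaw mdp π n (h + 1) (Fin.snoc (α := fun _ => S × A × ℝ) hist (s, a, q.2)) q.1

lemma measurable_nextLaw {n h : ℕ}
    (hm : Measurable fun p : (Fin (h + 1) → S × A × ℝ) × S => returnLaw mdp π n (h + 1) p.1 p.2)
    (a : A) : Measurable fun r : ((Fin h → S × A × ℝ) × S) × S × ℝ =>
      nextLaw mdp π n r.1.1 r.1.2 a r.2 := by
  refine hm.comp (f := fun r : ((Fin h → S × A × ℝ) × S) × S × ℝ =>
    (Fin.snoc (α := fun _ => S × A × ℝ) r.1.1 (r.1.2, a, r.2.2), r.2.1)) ?_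
  refine Measurable.prodMk (measurable_snoc (measurable_fst.comp measurable_fst) ?_)
    (measurable_fst.comp measurable_snd)
  exact (measurable_snd.comp measurable_fst).prodMk
    (measurable_const.prodMk (measurable_snd.comp measurable_snd))

lemma measurable_lintegral_nextLaw {n h : ℕ}
    (hm : Measurable fun p : (Fin (h + 1) → S × A × ℝ) × S => returnLaw mdp π n (h + 1) p.1 p.2)
    (hp : ∀ hist s, IsProbabilityMeasure (returnLaw mdp π n (h + 1) hist s)) (a : A)
    {g : ℝ → ℝ≥0∞} (hg : Measurable g) :
    Measurable fun r : ((Fin h → S × A × ℝ) × S) × S × ℝ =>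
      ∫⁻ x, g (r.2.2 + x) ∂nextLaw mdp π n r.1.1 r.1.2 a r.2 := by
  let κ : Kernel (((Fin h → S × A × ℝ) × S) × S × ℝ) ℝ :=
    ⟨fun r => nextLaw mdp π n r.1.1 r.1.2 a r.2, measurable_nextLaw mdp hm a⟩
  have : IsMarkovKernel κ := ⟨fun r => hp _ _⟩
  refine Measurable.lintegral_kernel_prod_right' (κ := κ)
    (f := fun r : (((Fin h → S × A × ℝ) × S) × S × ℝ) × ℝ => g (r.1.2.2 + r.2)) ?_
  exact hg.comp (((measurable_snd.comp measurable_snd).comp measurable_fst).add measurable_snd)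

lemma measurable_nextLaw_map {n h : ℕ}
    (hm : Measurable fun p : (Fin (h + 1) → S × A × ℝ) × S => returnLaw mdp π n (h + 1) p.1 p.2)
    (hp : ∀ hist s, IsProbabilityMeasure (returnLaw mdp π n (h + 1) hist s))
    (hist : Fin h → S × A × ℝ) (s : S) (a : A) :
    Measurable fun q : S × ℝ => (nextLaw mdp π n hist s a q).map fun x => q.2 + x := by
  refine Measure.measurable_of_measurable_coe _ fun B hB => ?_
  have h1 := (measurable_lintegral_nextLaw mdp hm hp a (g := B.indicator 1)
    (measurable_one.indicator hB)).comp (measurable_prodMk_left (x := (hist, s)))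
  convert h1 using 1
  ext q
  rw [Function.comp_apply, ← lintegral_map (g := fun x => q.2 + x) (measurable_one.indicator hB)
    (measurable_const_add q.2), lintegral_indicator_one hB]

lemma lintegral_returnLaw_succ_of_measurable {n h : ℕ}
    (hm : Measurable fun p : (Fin (h + 1) → S × A × ℝ) × S => returnLaw mdp π n (h + 1) p.1 p.2)
    (hp : ∀ hist s, IsProbabilityMeasure (returnLaw mdp π n (h + 1) hist s))
    (hist : Fin h → S × A × ℝ) (s : S) {g : ℝ → ℝ≥0∞} (hg : Measurable g) :
    ∫⁻ x, g x ∂returnLaw mdp π (n + 1) h hist s =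
      ∑ a, π h hist s a * ∫⁻ q, ∫⁻ x, g (q.2 + x) ∂nextLaw mdp π n hist s a q
        ∂mdp.step h (s, a) := by
  rw [returnLaw, lintegral_finsetSum_measure]
  refine Finset.sum_congr rfl fun a _ => ?_
  have hmap : Measurable fun q : S × ℝ => (returnLaw mdp π n (h + 1)
      (Fin.snoc (α := fun _ => S × A × ℝ) hist (s, a, q.2)) q.1).map fun x => q.2 + x :=
    measurable_nextLaw_map mdp hm hp hist s a
  rw [lintegral_smul_measure, smul_eq_mul, Measure.lintegral_bind hmap.aemeasurable hg.aemeasurable]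
  congr 1
  refine lintegral_congr fun q => ?_
  rw [lintegral_map hg (measurable_const_add q.2)]
  rfl

/-- Measurability and total mass 1 are proved together: `Measure.bind` is computed correctly only
for measurable families, and measurability after the shift by the reward uses that the next law is a
Markov kernel. -/
lemma measurable_returnLaw (hπ : π.IsMeasurable) (n : ℕ) : ∀ h,
    (Measurable fun p : (Fin h → S × A × ℝ) × S => returnLaw mdp π n h p.1 p.2) ∧
      ∀ hist s, IsProbabilityMeasure (returnLaw mdp π n h hist s) := by
  induction n with
  | zero => exact fun h => ⟨measurable_const, fun hist s => by rw [returnLaw]; infer_instance⟩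
  | succ n ih =>
    intro h
    obtain ⟨hm, hp⟩ := ih (h + 1)
    have key := fun hist s => @lintegral_returnLaw_succ_of_measurable S A _ _ _ mdp π n h hm hp hist s
    refine ⟨Measure.measurable_of_measurable_coe _ fun B hB => ?_, fun hist s => ⟨?_⟩⟩
    · have e : (fun p : (Fin h → S × A × ℝ) × S => returnLaw mdp π (n + 1) h p.1 p.2 B) = fun p =>
          ∑ a, π h p.1 p.2 a * ∫⁻ q, ∫⁻ x, B.indicator 1 (q.2 + x) ∂nextLaw mdp π n p.1 p.2 a q
            ∂mdp.step h (p.2, a) := by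
        ext p
        rw [← key p.1 p.2 (measurable_one.indicator hB), lintegral_indicator_one hB]
      rw [e]
      refine Finset.measurable_sum _ fun a _ => (hπ h a).mul ?_
      let κ : Kernel ((Fin h → S × A × ℝ) × S) (S × ℝ) := (mdp.step h).comap (fun p => (p.2, a))
        (measurable_snd.prodMk measurable_const)
      exact Measurable.lintegral_kernel_prod_right' (κ := κ)
        (measurable_lintegral_nextLaw mdp hm hp a (measurable_one.indicator hB))
    · have h1 := key hist s (measurable_const (a := (1 : ℝ≥0∞)))
      have hp' : ∀ a q, IsProbabilityMeasure (nextLaw mdp π n hist s a q) := fun a q => hp _ _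
      simp only [lintegral_const, measure_univ, mul_one, one_mul] at h1
      rw [h1, ← tsum_fintype (L := .unconditional A)]
      exact PMF.tsum_coe _

lemma isProbabilityMeasure_returnLaw (hπ : π.IsMeasurable) (n h : ℕ) (hist : Fin h → S × A × ℝ) (s : S) :
    IsProbabilityMeasure (returnLaw mdp π n h hist s) :=
  (measurable_returnLaw mdp hπ n h).2 hist s

lemma lintegral_returnLaw_succ (hπ : π.IsMeasurable) (n h : ℕ) (hist : Fin h → S × A × ℝ) (s : S)
    {g : ℝ → ℝ≥0∞}
    (hg : Measurable g) :
    ∫⁻ x, g x ∂returnLaw mdp π (n + 1) h hist s =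
      ∑ a, π h hist s a * ∫⁻ q, ∫⁻ x, g (q.2 + x) ∂nextLaw mdp π n hist s a q
        ∂mdp.step h (s, a) :=
  lintegral_returnLaw_succ_of_measurable mdp (measurable_returnLaw mdp hπ n (h + 1)).1
    (measurable_returnLaw mdp hπ n (h + 1)).2 hist s hg

lemma returnLaw_compl_Icc (hπ : π.IsMeasurable) (n h : ℕ) (hist : Fin h → S × A × ℝ) (s : S) :
    returnLaw mdp π n h hist s (Set.Icc 0 (n : ℝ))ᶜ = 0 := by
  induction n generalizing h s with
  | zero =>
    rw [returnLaw, Measure.dirac_apply' _ measurableSet_Icc.compl]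
    simp
  | succ n ih =>
    have hB : MeasurableSet (Set.Icc 0 ((n + 1 : ℕ) : ℝ))ᶜ := measurableSet_Icc.compl
    rw [← lintegral_indicator_one hB,
      lintegral_returnLaw_succ mdp hπ n h hist s (measurable_one.indicator hB)]
    refine Finset.sum_eq_zero fun a _ => mul_eq_zero_of_right _ ?_
    rw [lintegral_eq_zero_of_ae_eq_zero]
    filter_upwards [mdp.step_ae_reward h (s, a) (mdp.rew_mem h (s, a))] with q hq
    rw [Pi.zero_apply, lintegral_eq_zero_of_ae_eq_zero]
    have h1 : ∀ᵐ x ∂nextLaw mdp π n hist s a q, x ∈ Set.Icc 0 (n : ℝ) := ih (h + 1) _ q.1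
    filter_upwards [h1] with x hx
    rw [Set.indicator_of_notMem, Pi.zero_apply]
    simp only [Set.mem_compl_iff, not_not]
    push_cast
    exact ⟨add_nonneg hq.1 hx.1, by linarith [hq.2, hx.2]⟩

end ReturnLaw

/-! ### The greedy policy as a measurable history-dependent policy. -/

section AugPolicy

variable {S A : Type*} [MeasurableSpace S] [MeasurableSpace A] [MeasurableSingletonClass A]
  [Fintype A] {d : ℕ} {I : Input S A d}

/-- Fixed data are a family over a one-point space, so the joint measurability lemmas also give
measurability in (s, y) for one realization. -/
lemma measurableData_const (D : Data S A) (k T : ℕ) :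
    MeasurableData (inferInstance : MeasurableSpace Unit) (fun _ => D) k T := fun _ _ _ _ =>
  ⟨measurable_const, measurable_const, measurable_const, measurable_const⟩

lemma isMeasurable_augPolicy (hφ : ∀ a, Measurable fun s => I.φ s a) (hlam : I.lam = 1)
    (hH : 1 ≤ I.H) (D : Data S A) (k : ℕ) (y : ℝ) : (augPolicy (I.policy D k) y).IsMeasurable := by
  classical
  intro h a
  -- Measurability of a history policy is required at every step, including h ≥ H, so the step range
  -- is enlarged beyond the horizon.
  have h1 := (measurableData_const D k (I.H + h + 1)).policy hφ hlam hH (by omega)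
    (show h < I.H + h + 1 by omega)
  have h2 : Measurable fun p : (Fin h → S × A × ℝ) × S =>
      I.policy D k h p.2 (y + ∑ i : Fin h, (p.1 i).2.2) := by
    refine h1.comp (g := fun p : Unit × S × ℝ => I.policy D k h p.2.1 p.2.2)
      (f := fun p : (Fin h → S × A × ℝ) × S => ((), p.2, y + ∑ i : Fin h, (p.1 i).2.2)) ?_
    refine measurable_const.prodMk (measurable_snd.prodMk (Measurable.const_add ?_ y))
    exact Finset.measurable_sum _ fun i _ => measurable_snd.comp (measurable_snd.comp
      ((measurable_pi_apply i).comp measurable_fst))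
  simp only [augPolicy, PMF.pure_apply]
  refine Measurable.ite ?_ measurable_const measurable_const
  have : {p : (Fin h → S × A × ℝ) × S | a = I.policy D k h p.2 (y + ∑ i : Fin h, (p.1 i).2.2)} =
      (fun p : (Fin h → S × A × ℝ) × S => I.policy D k h p.2 (y + ∑ i : Fin h, (p.1 i).2.2)) ⁻¹'
        {a} := by
    ext p; exact eq_comm
  rw [this]
  exact h2 (measurableSet_singleton a)

end AugPolicy

/-! ### Optimism and the gap of the greedy policy -/

section Gap

variable {S A : Type*} [MeasurableSpace S] [MeasurableSpace A] [MeasurableSingletonClass A]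
  [Fintype A] [Nonempty A] {d : ℕ}

/-- In episode `k`, all value functions are accurate up to the bonus, and bounded by the horizon. -/
structure IsAccurate (mdp : MDP S A) (I : Input S A d) (D : Data S A) (k : ℕ) : Prop where
  mem_Icc : ∀ n ≤ I.H, ∀ s y, -(I.H : ℝ) ≤ y → I.vToGo D k n s y ∈ Set.Icc (0 : ℝ) I.H
  close : ∀ n < I.H, ∀ s y a, -(I.H : ℝ) ≤ y →
    |psi I.φ s a ⬝ᵥ I.weight D k (I.H - (n + 1)) (I.vToGo D k n) y -
      ∫ q, I.vToGo D k n q.1 (y + q.2) ∂mdp.step (I.H - (n + 1)) (s, a)| ≤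
        I.bonus D k (I.H - (n + 1)) s a

lemma isAccurate_of_concentrationEvent {I : Input S A d} {mdp : MDP S A} {s₁ : ℕ → S} {R ρ ε : ℝ}
    {N k : ℕ} {D : Data S A} (hlin : IsDiscretizedLinear mdp I.H I.φ I.grid s₁)
    (htie : ∀ T : Finset A, T.Nonempty → I.tieA T ∈ T)
    (hlam : I.lam = 1) (hH : 1 ≤ I.H) (hβ : 0 ≤ I.β) (hR : 0 < R) (hN : 0 < N)
    (hε : (d : ℝ) ^ 2 * (2 * R / N) + I.β / I.H * √((d : ℝ) ^ 4 * (2 / N)) ≤ ε) (hε' : 2 / N ≤ ε)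
    (hE : ConcentrationEvent I mdp (I.β / I.H) R N ρ k D)
    (hρ : I.H * (ρ + k * (2 * ε) + 2 * d ^ 2) ≤ I.β) (hkR : k ≤ R) : IsAccurate mdp I D k where
  mem_Icc n hn s y hy := (isClippedLinear_of_concentrationEvent hlin htie hlam hH hβ hR hN hε hε' hE
    hρ hkR hn).mem_Icc hy s
  close n hn s y a hy := (isClippedLinear_of_concentrationEvent hlin htie hlam hH hβ hR hN hε hε' hE
    hρ hkR hn.le).weight_close hlin hlam hH hβ hR hN hε hε' hE hρ (by omega) hy s a

variable {mdp : MDP S A} {I : Input S A d} {D : Data S A} {k : ℕ}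

lemma IsAccurate.ofReal_integral (hacc : IsAccurate mdp I D k)
    (hφ : ∀ a, Measurable fun s => I.φ s a) (hlam : I.lam = 1) (hH : 1 ≤ I.H) {n : ℕ}
    (hn : n ≤ I.H) {y : ℝ} (hy : -(I.H : ℝ) ≤ y) (h : ℕ) (p : S × A) :
    ENNReal.ofReal (∫ q, I.vToGo D k n q.1 (y + q.2) ∂mdp.step h p) =
      ∫⁻ q, ENNReal.ofReal (I.vToGo D k n q.1 (y + q.2)) ∂mdp.step h p := by
  have hae : ∀ᵐ q ∂mdp.step h p, I.vToGo D k n q.1 (y + q.2) ∈ Set.Icc (0 : ℝ) I.H := by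
    filter_upwards [mdp.step_ae_reward h p (mdp.rew_mem h p)] with q hq
    exact hacc.mem_Icc n hn _ _ (by linarith [hq.1])
  have hm : Measurable fun q : S × ℝ => I.vToGo D k n q.1 (y + q.2) :=
    ((measurableData_const D k I.H).vToGo hφ hlam hH le_rfl n).comp
      (f := fun q : S × ℝ => ((), q.1, y + q.2))
      (measurable_const.prodMk (measurable_fst.prodMk (measurable_snd.const_add y)))
  exact ofReal_integral_eq_lintegral_ofReal (Integrable.of_mem_Icc 0 _ hm.aemeasurable hae)
    (hae.mono fun q hq => hq.1)

/-- The expected shortfall of the return of the last `n` steps below the level `-y`. -/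
def shortfall (mdp : MDP S A) (π : HistPolicy S A) (n h : ℕ) (hist : Fin h → S × A × ℝ) (s : S)
    (y : ℝ) : ℝ≥0∞ :=
  ∫⁻ x, ENNReal.ofReal (max (-y - x) 0) ∂returnLaw mdp π n h hist s

lemma shortfall_succ {π : HistPolicy S A} (hπ : π.IsMeasurable) (n h : ℕ)
    (hist : Fin h → S × A × ℝ) (s : S) (y : ℝ) :
    shortfall mdp π (n + 1) h hist s y = ∑ a, π h hist s a *
      ∫⁻ q, shortfall mdp π n (h + 1) (Fin.snoc (α := fun _ => S × A × ℝ) hist (s, a, q.2)) q.1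
        (y + q.2) ∂mdp.step h (s, a) := by
  rw [shortfall, lintegral_returnLaw_succ mdp hπ]
  · refine Finset.sum_congr rfl fun a _ => ?_
    congr 1
    refine lintegral_congr fun q => lintegral_congr fun x => ?_
    congr 2
    ring
  · exact ((measurable_const.sub measurable_id).max measurable_const).ennreal_ofReal

lemma shortfall_zero (π : HistPolicy S A) (h : ℕ) (hist : Fin h → S × A × ℝ) (s : S) (y : ℝ) :
    shortfall mdp π 0 h hist s y = ENNReal.ofReal (max (-y) 0) := by
  have h : Measurable fun x : ℝ => ENNReal.ofReal (max (-y - x) 0) :=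
    ((measurable_const.sub measurable_id).max measurable_const).ennreal_ofReal
  rw [shortfall, returnLaw, lintegral_dirac' _ h, sub_zero]

/-- The value functions underestimate the shortfall of every policy. -/
lemma IsAccurate.le_shortfall (hacc : IsAccurate mdp I D k)
    (htie : ∀ T : Finset A, T.Nonempty → I.tieA T ∈ T)
    (hφ : ∀ a, Measurable fun s => I.φ s a) (hlam : I.lam = 1) (hH : 1 ≤ I.H) {π : HistPolicy S A}
    (hπ : π.IsMeasurable) {n : ℕ} (hn : n ≤ I.H) (hist : Fin (I.H - n) → S × A × ℝ) (s : S) {y : ℝ}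
    (hy : -(I.H : ℝ) ≤ y) :
    ENNReal.ofReal (I.vToGo D k n s y) ≤ shortfall mdp π n (I.H - n) hist s y := by
  -- The type of the history depends on the step; naming the step lets the induction pass from `Fin
  -- h` to `Fin (h + 1)`.
  obtain ⟨h, hh⟩ : ∃ h, I.H - n = h := ⟨_, rfl⟩
  revert hist
  rw [hh]
  induction n generalizing h s y with
  | zero => intro hist; rw [shortfall_zero]; rfl
  | succ n ih =>
    intro hist
    rw [shortfall_succ hπ]
    -- The bound holds for each action separately, so it survives any history-dependent
    -- randomization.
    have hle : ∀ a, ENNReal.ofReal (I.vToGo D k (n + 1) s y) ≤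
        ∫⁻ q, shortfall mdp π n (h + 1) (Fin.snoc (α := fun _ => S × A × ℝ) hist (s, a, q.2)) q.1
          (y + q.2) ∂mdp.step h (s, a) := by
      intro a
      have h1 : I.vToGo D k (n + 1) s y ≤ ∫ q, I.vToGo D k n q.1 (y + q.2) ∂mdp.step h (s, a) := by
        refine max_le ?_ ?_
        · refine (I.argminAct_le htie _ a).trans ?_
          have := (abs_le.1 (hacc.close n hn s y a hy)).2
          rw [hh] at this ⊢
          rw [Input.qOf]
          linarith
        · refine integral_nonneg_of_ae ?_
          filter_upwards [mdp.step_ae_reward h (s, a) (mdp.rew_mem h (s, a))] with q hq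
          exact (hacc.mem_Icc n (Nat.le_of_succ_le hn) _ _ (by linarith [hq.1])).1
      refine (ENNReal.ofReal_le_ofReal h1).trans ?_
      rw [hacc.ofReal_integral hφ hlam hH (Nat.le_of_succ_le hn) hy]
      refine lintegral_mono_ae ?_
      filter_upwards [mdp.step_ae_reward h (s, a) (mdp.rew_mem h (s, a))] with q hq
      exact ih (Nat.le_of_succ_le hn) q.1 (by linarith [hq.1]) (h + 1) (by omega) _
    calc ENNReal.ofReal (I.vToGo D k (n + 1) s y)
        = ∑ a, π h hist s a * ENNReal.ofReal (I.vToGo D k (n + 1) s y) := by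
          rw [← Finset.sum_mul, ← tsum_fintype (L := .unconditional A), PMF.tsum_coe, one_mul]
      _ ≤ _ := Finset.sum_le_sum fun a _ => mul_le_mul_right (hle a) _

/-- The shortfall of the policy of episode `k` exceeds its value function at most by the expected
sum of twice the bonuses. -/
lemma IsAccurate.shortfall_le (hacc : IsAccurate mdp I D k)
    (hφ : ∀ a, Measurable fun s => I.φ s a) (hlam : I.lam = 1) (hH : 1 ≤ I.H) (hβ : 0 ≤ I.β)
    (y₁ : ℝ) {n : ℕ} (hn : n ≤ I.H) (hist : Fin (I.H - n) → S × A × ℝ) (s : S)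
    (hy : -(I.H : ℝ) ≤ y₁ + ∑ i, (hist i).2.2) :
    shortfall mdp (augPolicy (I.policy D k) y₁) n (I.H - n) hist s (y₁ + ∑ i, (hist i).2.2) ≤
      ENNReal.ofReal (I.vToGo D k n s (y₁ + ∑ i, (hist i).2.2)) + ENNReal.ofReal (2 * I.β) *
        expectedWidth mdp I D k n s (y₁ + ∑ i, (hist i).2.2) := by
  obtain ⟨h, hh⟩ : ∃ h, I.H - n = h := ⟨_, rfl⟩
  revert hist hy
  rw [hh]
  induction n generalizing h s with
  | zero =>
    intro hist hy
    rw [shortfall_zero]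
    exact le_self_add
  | succ n ih =>
    intro hist hy
    set y := y₁ + ∑ i, (hist i).2.2 with hyd
    have hn' : n ≤ I.H := Nat.le_of_succ_le hn
    rw [shortfall_succ (isMeasurable_augPolicy hφ hlam hH D k y₁)]
    set a := I.policy D k h s y with ha
    have hsum : ∀ X : A → ℝ≥0∞, ∑ a', augPolicy (I.policy D k) y₁ h hist s a' * X a' = X a := by
      intro X
      rw [Finset.sum_eq_single a]
      · rw [augPolicy, PMF.pure_apply, if_pos ha, one_mul]
      · intro a' _ ha'
        rw [augPolicy, PMF.pure_apply, if_neg ha', zero_mul]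
      · simp
    rw [hsum]
    have hφd := measurableData_const D k I.H
    have hmW : Measurable fun q : S × ℝ => expectedWidth mdp I D k n q.1 (y + q.2) :=
      (hφd.expectedWidth mdp hφ hlam hH le_rfl n).comp
        (f := fun q : S × ℝ => ((), q.1, y + q.2))
        (measurable_const.prodMk (measurable_fst.prodMk (measurable_snd.const_add y)))
    have h1 : ∫⁻ q, shortfall mdp (augPolicy (I.policy D k) y₁) n (h + 1)
        (Fin.snoc (α := fun _ => S × A × ℝ) hist (s, a, q.2)) q.1 (y + q.2) ∂mdp.step h (s, a) ≤
        ∫⁻ q, (ENNReal.ofReal (I.vToGo D k n q.1 (y + q.2)) + ENNReal.ofReal (2 * I.β) *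
          expectedWidth mdp I D k n q.1 (y + q.2)) ∂mdp.step h (s, a) := by
      refine lintegral_mono_ae ?_
      filter_upwards [mdp.step_ae_reward h (s, a) (mdp.rew_mem h (s, a))] with q hq
      have e : y₁ + ∑ i, (Fin.snoc (α := fun _ => S × A × ℝ) hist (s, a, q.2) i).2.2 = y + q.2 := by
        rw [Fin.sum_univ_castSucc]
        simp only [Fin.snoc_castSucc, Fin.snoc_last]
        rw [hyd, add_assoc]
      have := ih hn' q.1 (h + 1) (by omega)
        (Fin.snoc (α := fun _ => S × A × ℝ) hist (s, a, q.2)) (by rw [e]; linarith [hq.1])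
      rwa [e] at this
    refine h1.trans ?_
    rw [lintegral_add_right _ (hmW.const_mul _), lintegral_const_mul _ hmW,
      ← hacc.ofReal_integral hφ hlam hH hn' hy]
    -- One bonus is the estimation error and the other is the bonus subtracted in Q; hence the
    -- factor 2.
    have h2 : ∫ q, I.vToGo D k n q.1 (y + q.2) ∂mdp.step h (s, a) ≤ I.vToGo D k (n + 1) s y +
        2 * I.β * √(invNormSq (I.gram D k h) (psi I.φ s a)) := by
      have h3 := (abs_le.1 (hacc.close n hn s y a hy)).1
      have h4 : I.qOf D k h (I.vToGo D k n) s y a ≤ I.vToGo D k (n + 1) s y := by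
        have e : a = I.argminAct (I.qOf D k h (I.vToGo D k n) s y) := by
          rw [ha, Input.policy]
          congr 1
          ext a'
          rw [Input.Q]
          congr 2
          omega
        rw [e, ← hh]
        exact le_max_left _ _
      rw [hh] at h3
      have h5 : I.bonus D k h s a = I.β * √(invNormSq (I.gram D k h) (psi I.φ s a)) := rfl
      rw [Input.qOf] at h4
      rw [h5] at h3 h4
      linarith
    have h6 : expectedWidth mdp I D k (n + 1) s y =
        ENNReal.ofReal (√(invNormSq (I.gram D k h) (psi I.φ s a))) +
          ∫⁻ q, expectedWidth mdp I D k n q.1 (y + q.2) ∂mdp.step h (s, a) := by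
      rw [expectedWidth, hh]
    rw [h6, mul_add, ← add_assoc]
    gcongr
    refine (ENNReal.ofReal_le_ofReal h2).trans ?_
    rw [ENNReal.ofReal_add (hacc.mem_Icc _ hn _ _ hy).1 (by positivity),
      ENNReal.ofReal_mul (by positivity)]

end Gap

/-! ### Conditional value at risk on a grid -/

section CVaR

/-- The function of `b` whose maximum is the `CVaR`. -/
def cvarObjective (τ : ℝ) (ν : Measure ℝ) (b : ℝ) : ℝ := b - τ⁻¹ * ∫ x, max (b - x) 0 ∂ν

variable {τ : ℝ} {ν : Measure ℝ} [IsProbabilityMeasure ν] {B : ℝ}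

lemma integrable_max_sub (hB : ∀ᵐ x ∂ν, x ∈ Set.Icc 0 B) (b : ℝ) :
    Integrable (fun x => max (b - x) 0) ν := by
  refine Integrable.of_mem_Icc 0 (max b 0)
    ((measurable_const.sub measurable_id).max measurable_const).aemeasurable ?_
  filter_upwards [hB] with x hx
  exact ⟨le_max_right _ _, max_le_max (by linarith [hx.1]) le_rfl⟩

lemma cvarObjective_le_self (hτ : 0 < τ) (b : ℝ) : cvarObjective τ ν b ≤ b := by
  have : 0 ≤ τ⁻¹ * ∫ x, max (b - x) 0 ∂ν :=
    mul_nonneg (inv_nonneg.2 hτ.le) (integral_nonneg fun x => le_max_right _ _)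
  rw [cvarObjective]
  linarith

/-- Beyond an almost sure upper bound of the return the objective is affine in b with slope 1 - τ⁻¹
≤ 0. -/
lemma cvarObjective_le_of_le (hτ : 0 < τ) (hτ1 : τ ≤ 1) (hB : ∀ᵐ x ∂ν, x ∈ Set.Icc 0 B) {g b : ℝ}
    (hg : ∀ᵐ x ∂ν, x ≤ g) (hgb : g ≤ b) : cvarObjective τ ν b ≤ cvarObjective τ ν g := by
  have h1 : ∫ x, max (b - x) 0 ∂ν = ∫ x, (max (g - x) 0 + (b - g)) ∂ν := by
    refine integral_congr_ae ?_
    filter_upwards [hg] with x hx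
    rw [max_eq_left (by linarith), max_eq_left (by linarith)]
    ring
  rw [cvarObjective, cvarObjective, h1,
    integral_add (integrable_max_sub hB g) (integrable_const _)]
  simp only [integral_const, probReal_univ, one_smul]
  have : b - g ≤ τ⁻¹ * (b - g) := le_mul_of_one_le_left (by linarith) ((one_le_inv₀ hτ).2 hτ1)
  linarith

lemma cvarObjective_le (hτ : 0 < τ) (hτ1 : τ ≤ 1) (hB : ∀ᵐ x ∂ν, x ∈ Set.Icc 0 B) (b : ℝ) :
    cvarObjective τ ν b ≤ B := by
  rcases le_total b B with h | h
  · exact (cvarObjective_le_self hτ b).trans h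
  · exact (cvarObjective_le_of_le hτ hτ1 hB (hB.mono fun x hx => hx.2) h).trans
      (cvarObjective_le_self hτ B)

lemma cvarObjective_zero (hB : ∀ᵐ x ∂ν, x ∈ Set.Icc 0 B) : cvarObjective τ ν 0 = 0 := by
  have : ∫ x, max (0 - x) 0 ∂ν = 0 := by
    rw [integral_eq_zero_of_ae]
    filter_upwards [hB] with x hx
    simpa using hx.1
  rw [cvarObjective, this]
  simp

lemma bddAbove_cvarObjective (hτ : 0 < τ) (hτ1 : τ ≤ 1) (hB : ∀ᵐ x ∂ν, x ∈ Set.Icc 0 B) :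
    BddAbove (Set.range (cvarObjective τ ν)) :=
  ⟨B, by rintro _ ⟨b, rfl⟩; exact cvarObjective_le hτ hτ1 hB b⟩

lemma cvarObjective_le_cvar (hτ : 0 < τ) (hτ1 : τ ≤ 1) (hB : ∀ᵐ x ∂ν, x ∈ Set.Icc 0 B) (b : ℝ) :
    cvarObjective τ ν b ≤ cvar τ ν :=
  le_ciSup (bddAbove_cvarObjective hτ hτ1 hB) b

lemma cvar_mem_Icc (hτ : 0 < τ) (hτ1 : τ ≤ 1) (hB : ∀ᵐ x ∂ν, x ∈ Set.Icc 0 B) :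
    cvar τ ν ∈ Set.Icc 0 B :=
  ⟨(cvarObjective_zero (τ := τ) hB).symm.le.trans (cvarObjective_le_cvar hτ hτ1 hB 0),
    ciSup_le fun b => cvarObjective_le hτ hτ1 hB b⟩

/-- For a distribution supported on a finite set containing `0`, the maximum in the definition of
the `CVaR` may be restricted to the nonnegative points of this set. -/
lemma exists_mem_grid_cvarObjective_le (hτ : 0 < τ) (hτ1 : τ ≤ 1)
    (hB : ∀ᵐ x ∂ν, x ∈ Set.Icc 0 B) {G : Finset ℝ} (h0 : (0 : ℝ) ∈ G) (hG : ∀ᵐ x ∂ν, x ∈ G)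
    (b : ℝ) : ∃ g ∈ G, 0 ≤ g ∧ cvarObjective τ ν b ≤ cvarObjective τ ν g := by
  rcases lt_or_ge b 0 with hb | hb
  · exact ⟨0, h0, le_rfl, by
      rw [cvarObjective_zero hB]; exact (cvarObjective_le_self hτ b).trans hb.le⟩
  have hT : (G.filter fun x => x ≤ b).Nonempty := ⟨0, Finset.mem_filter.2 ⟨h0, hb⟩⟩
  set g := (G.filter fun x => x ≤ b).max' hT with hg
  obtain ⟨hgG, hgb⟩ := Finset.mem_filter.1 (Finset.max'_mem _ hT)
  have hg0 : 0 ≤ g := Finset.le_max' _ _ (Finset.mem_filter.2 ⟨h0, hb⟩)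
  have hgle : ∀ x ∈ G, x ≤ b → x ≤ g := fun x hx hxb =>
    Finset.le_max' _ _ (Finset.mem_filter.2 ⟨hx, hxb⟩)
  rw [← hg] at hgG hgb
  by_cases hT' : (G.filter fun x => b < x).Nonempty
  · set g' := (G.filter fun x => b < x).min' hT' with hg'
    obtain ⟨hgG', hgb'⟩ := Finset.mem_filter.1 (Finset.min'_mem _ hT')
    have hgle' : ∀ x ∈ G, b < x → g' ≤ x := fun x hx hxb =>
      Finset.min'_le _ _ (Finset.mem_filter.2 ⟨hx, hxb⟩)
    rw [← hg'] at hgG' hgb'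
    have hlt : 0 < g' - g := by linarith
    -- Between neighbouring grid points the objective is affine, so one of the two endpoints does at
    -- least as well as `b`.
    set t := (b - g) / (g' - g) with ht
    have htb : b = (1 - t) * g + t * g' := by
      rw [ht]; field_simp; ring
    have ht0 : 0 ≤ t := div_nonneg (by linarith) hlt.le
    have ht1 : t ≤ 1 := (div_le_one hlt).2 (by linarith)
    have h1 : ∫ x, max (b - x) 0 ∂ν =
        (1 - t) * ∫ x, max (g - x) 0 ∂ν + t * ∫ x, max (g' - x) 0 ∂ν := by
      rw [← integral_const_mul, ← integral_const_mul,
        ← integral_add ((integrable_max_sub hB g).const_mul _)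
          ((integrable_max_sub hB g').const_mul _)]
      refine integral_congr_ae ?_
      filter_upwards [hG] with x hx
      rcases le_or_gt x b with hxb | hxb
      · have := hgle x hx hxb
        rw [max_eq_left (by linarith), max_eq_left (by linarith), max_eq_left (by linarith)]
        linear_combination htb
      · have := hgle' x hx hxb
        rw [max_eq_right (by linarith), max_eq_right (by linarith), max_eq_right (by linarith)]
        ring
    have h2 : cvarObjective τ ν b =
        (1 - t) * cvarObjective τ ν g + t * cvarObjective τ ν g' := by
      simp only [cvarObjective]
      rw [h1]
      linear_combination htb
    rcases le_total (cvarObjective τ ν g) (cvarObjective τ ν g') with h | h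
    · refine ⟨g', hgG', by linarith, ?_⟩
      rw [h2]
      nlinarith
    · refine ⟨g, hgG, hg0, ?_⟩
      rw [h2]
      nlinarith
  · refine ⟨g, hgG, hg0, cvarObjective_le_of_le hτ hτ1 hB ?_ hgb⟩
    filter_upwards [hG] with x hx
    refine hgle x hx ?_
    by_contra! hxb
    exact hT' ⟨x, Finset.mem_filter.2 ⟨hx, hxb⟩⟩

end CVaR

/-! ### The grid contains zero. -/

section GridStructure

variable {S A : Type*} [MeasurableSpace S] [MeasurableSpace A] [MeasurableSingletonClass A]
  [Fintype A] [Nonempty A] {d : ℕ} {mdp : MDP S A}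

lemma exists_isMeasurable_policy (S A : Type*) [MeasurableSpace S] [MeasurableSpace A]
    [Nonempty A] : ∃ π : HistPolicy S A, π.IsMeasurable :=
  ⟨fun _ _ _ => PMF.pure (Classical.arbitrary A), fun _ _ => measurable_const⟩

lemma isProbabilityMeasure_totalLaw {π : HistPolicy S A} (hπ : π.IsMeasurable) (n : ℕ) (s : S) :
    IsProbabilityMeasure (totalLaw mdp π n s) := isProbabilityMeasure_returnLaw mdp hπ n 0 _ s

lemma totalLaw_ae_mem_Icc {π : HistPolicy S A} (hπ : π.IsMeasurable) (n : ℕ) (s : S) :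
    ∀ᵐ x ∂totalLaw mdp π n s, x ∈ Set.Icc (0 : ℝ) n := returnLaw_compl_Icc mdp hπ n 0 _ s

variable {H M : ℕ} {φ : S → A → EuclideanSpace ℝ (Fin d)} {G : Finset ℝ} {s₁ : ℕ → S}

lemma IsDiscretizedLinear.exists_reward (hlin : IsDiscretizedLinear mdp H φ G s₁) (hH : 1 ≤ H) :
    ∃ r ∈ G, 0 ≤ r := by
  have h1 := hlin.rew_rewardGrid hH (s₁ 0, Classical.arbitrary A)
  have h2 : (rewardGrid G).Nonempty := by
    by_contra hne
    rw [Finset.not_nonempty_iff_eq_empty] at hne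
    rw [hne] at h1
    simp at h1
  obtain ⟨r, hr⟩ := h2
  exact ⟨r, (Finset.mem_filter.1 hr).1, (Finset.mem_filter.1 hr).2.1⟩

/-- For a reward point b ≥ 0 of the grid, `aug_grid` puts -b on the grid, and some reward x has both
x and -b + x on it. Comparing indices makes z₀ an integer multiple of η, and 0 lies between -b and
b. With 0 as a budget, `aug_grid` says that the returns themselves lie on the grid. -/
lemma IsDiscretizedLinear.zero_mem_grid {z₀ η : ℝ} (hη : 0 < η) (hH : 1 ≤ H)
    (hlin : IsDiscretizedLinear mdp H φ (uniformGrid z₀ η M) s₁) :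
    (0 : ℝ) ∈ uniformGrid z₀ η M := by
  obtain ⟨b, hbG, hb0⟩ := hlin.exists_reward hH
  obtain ⟨π, hπ⟩ := exists_isMeasurable_policy S A
  have hm : ∀ n ≤ H, ∀ᵐ x ∂totalLaw mdp π n (s₁ 0), -b + x ∈ uniformGrid z₀ η M := fun n hn =>
    hlin.aug_grid π hπ 0 n hn b hbG hb0
  have hnb : -b ∈ uniformGrid z₀ η M := by
    have := hm 0 (Nat.zero_le _)
    rw [totalLaw, returnLaw, ae_dirac_iff] at this
    · simpa using this
    · exact (Finset.measurableSet (uniformGrid z₀ η M)).preimage (measurable_const_add (-b))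
  have hr : ∀ᵐ x ∂totalLaw mdp π 1 (s₁ 0), x ∈ uniformGrid z₀ η M := by
    have hB : MeasurableSet ((↑(uniformGrid z₀ η M) : Set ℝ)ᶜ) := (Finset.measurableSet _).compl
    change totalLaw mdp π 1 (s₁ 0) (↑(uniformGrid z₀ η M))ᶜ = 0
    rw [totalLaw, ← lintegral_indicator_one hB,
      lintegral_returnLaw_succ mdp hπ 0 0 _ _ (measurable_one.indicator hB)]
    refine Finset.sum_eq_zero fun a _ => mul_eq_zero_of_right _ ?_
    rw [lintegral_eq_zero_of_ae_eq_zero]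
    filter_upwards [mdp.step_ae_reward 0 (s₁ 0, a) (hlin.rew_grid 0 hH _)] with q hq
    have hm2 : Measurable fun x => (↑(uniformGrid z₀ η M) : Set ℝ)ᶜ.indicator
        (1 : ℝ → ℝ≥0∞) (q.2 + x) := (measurable_one.indicator hB).comp (measurable_const_add _)
    rw [nextLaw, returnLaw, lintegral_dirac' _ hm2, add_zero, Pi.zero_apply,
      Set.indicator_of_notMem]
    simpa using hq
  have hprob := isProbabilityMeasure_totalLaw (mdp := mdp) hπ 1 (s₁ 0)
  obtain ⟨x, hx1, hx2⟩ := ((hm 1 hH).and hr).exists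
  simp only [uniformGrid, Finset.mem_image, Finset.mem_range] at hbG hnb hx1 hx2 ⊢
  obtain ⟨i, hi, hib⟩ := hbG
  obtain ⟨j, -, hjb⟩ := hnb
  obtain ⟨m, -, hmx⟩ := hx1
  obtain ⟨l, -, hlx⟩ := hx2
  -- Subtracting the representations of -b and x from that of -b + x leaves one copy of z₀.
  have hz : z₀ = ((m : ℤ) - j - l : ℤ) * η := by
    push_cast
    linear_combination hjb + hlx - hmx
  set c : ℤ := (m : ℤ) - j - l
  have h1 : 0 ≤ c + i := by
    by_contra! hneg
    have : ((c + i : ℤ) : ℝ) ≤ -1 := by exact_mod_cast (by omega : c + (i : ℤ) ≤ -1)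
    push_cast at this
    nlinarith
  have h2 : c + j ≤ 0 := by
    by_contra! hpos
    have : (1 : ℝ) ≤ ((c + j : ℤ) : ℝ) := by exact_mod_cast (by omega : 1 ≤ c + (j : ℤ))
    push_cast at this
    nlinarith
  -- The index of 0 is -c, which is at most the index i < M of b.
  refine ⟨(-c).toNat, by omega, ?_⟩
  have h3 : (((-c).toNat : ℕ) : ℝ) = -c := by
    have : (((-c).toNat : ℤ) : ℝ) = ((-c : ℤ) : ℝ) := by rw [Int.toNat_of_nonneg (by omega)]
    exact_mod_cast this
  rw [h3, hz]
  ring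

end GridStructure

/-! ### The regret of a single episode. -/

section EpisodeGap

variable {S A : Type*} [MeasurableSpace S] [MeasurableSpace A] [MeasurableSingletonClass A]
  [Fintype A] [Nonempty A] {d : ℕ} {mdp : MDP S A} {I : Input S A d} {D : Data S A} {k : ℕ}
  {s₁ : ℕ → S}

lemma Input.budget_spec (htie : ∀ T : Finset ℝ, T.Nonempty → I.tieB T ∈ T) (s : S)
    (hne : ∃ r ∈ I.grid, 0 ≤ r) : I.budget D k s ∈ I.grid ∧ 0 ≤ I.budget D k s ∧
      ∀ b ∈ I.grid, 0 ≤ b → I.objective D k s b ≤ I.objective D k s (I.budget D k s) := by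
  classical
  obtain ⟨r, hr, hr0⟩ := hne
  obtain ⟨b, hb, hmax⟩ := Finset.exists_max_image (I.grid.filter fun b => 0 ≤ b)
    (I.objective D k s) ⟨r, Finset.mem_filter.2 ⟨hr, hr0⟩⟩
  have h := htie ((I.grid.filter fun b => 0 ≤ b).filter fun b =>
    ∀ b' ∈ I.grid, 0 ≤ b' → I.objective D k s b' ≤ I.objective D k s b)
    ⟨b, Finset.mem_filter.2 ⟨hb, fun b' h1 h2 => hmax b' (Finset.mem_filter.2 ⟨h1, h2⟩)⟩⟩
  have e : I.tieB ((I.grid.filter fun b => 0 ≤ b).filter fun b =>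
    ∀ b' ∈ I.grid, 0 ≤ b' → I.objective D k s b' ≤ I.objective D k s b) = I.budget D k s := by
    simp only [budget]
  rw [e] at h
  obtain ⟨h1, h2⟩ := Finset.mem_filter.1 h
  obtain ⟨h3, h4⟩ := Finset.mem_filter.1 h1
  exact ⟨h3, h4, h2⟩

lemma expectedWidth_le (hlam : I.lam = 1) (hφ : ∀ s a, ‖I.φ s a‖ ≤ 1) (n : ℕ) (s : S) (y : ℝ) :
    expectedWidth mdp I D k n s y ≤ n := by
  induction n generalizing s y with
  | zero => simp [expectedWidth]
  | succ n ih =>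
    rw [expectedWidth, I.gram_eq_ridge hlam, Nat.cast_succ, add_comm (n : ℝ≥0∞)]
    refine add_le_add ?_ ?_
    · rw [← ENNReal.ofReal_one]
      refine ENNReal.ofReal_le_ofReal (Real.sqrt_le_one.2 ?_)
      exact ((dotProduct_ridge_inv_le _ k _).2).trans (psi_dotProduct_self_le hφ _ _)
    · refine (lintegral_mono fun q : S × ℝ => ih q.1 (y + q.2)).trans ?_
      simp

lemma integral_shortfall_eq {π : HistPolicy S A} (n : ℕ) (s : S) (b : ℝ) :
    ∫ x, max (b - x) 0 ∂totalLaw mdp π n s =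
      (shortfall mdp π n 0 Fin.elim0 s (-b)).toReal := by
  have hm : Measurable fun x : ℝ => max (b - x) 0 :=
    (measurable_const.sub measurable_id).max measurable_const
  have h0 : 0 ≤ᵐ[totalLaw mdp π n s] fun x : ℝ => max (b - x) 0 :=
    ae_of_all _ fun x => le_max_right _ _
  rw [shortfall, integral_eq_lintegral_of_nonneg_ae h0 hm.aestronglyMeasurable, neg_neg]
  rfl

lemma shortfall_ne_top {π : HistPolicy S A} (hπ : π.IsMeasurable) (n : ℕ) (s : S) (b : ℝ) :
    shortfall mdp π n 0 Fin.elim0 s (-b) ≠ ∞ := by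
  have hp := isProbabilityMeasure_totalLaw (mdp := mdp) hπ n s
  have h := (integrable_max_sub (totalLaw_ae_mem_Icc (mdp := mdp) hπ n s) b).lintegral_lt_top
  rw [shortfall, neg_neg]
  exact h.ne

/-- The `CVaR` of a return in [0, H] is itself in [0, H]. This trivial bound handles the case K ≤
H². -/
lemma optCVaR_sub_cvar_le_horizon {τ : ℝ} (hτ : 0 < τ) (hτ1 : τ ≤ 1) (H : ℕ) (s : S)
    {π : HistPolicy S A} (hπ : π.IsMeasurable) :
    optCVaR mdp H τ s - cvar τ (totalLaw mdp π H s) ≤ H := by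
  have h1 : optCVaR mdp H τ s ≤ H := Real.iSup_le (fun π' => by
    have := isProbabilityMeasure_totalLaw (mdp := mdp) π'.2 H s
    exact (cvar_mem_Icc hτ hτ1 (totalLaw_ae_mem_Icc π'.2 H s)).2) (Nat.cast_nonneg H)
  have := isProbabilityMeasure_totalLaw (mdp := mdp) hπ H s
  have h2 := (cvar_mem_Icc hτ hτ1 (totalLaw_ae_mem_Icc (mdp := mdp) hπ H s)).1
  linarith

/-- The regret of episode `k` is at most the expected sum of twice the bonuses, divided by `τ`. -/
lemma IsAccurate.optCVaR_sub_cvar_le (hacc : IsAccurate mdp I D k)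
    (hlin : IsDiscretizedLinear mdp I.H I.φ I.grid s₁) (h0 : (0 : ℝ) ∈ I.grid)
    (htieA : ∀ T : Finset A, T.Nonempty → I.tieA T ∈ T)
    (htieB : ∀ T : Finset ℝ, T.Nonempty → I.tieB T ∈ T)
    (hlam : I.lam = 1) (hH : 1 ≤ I.H) (hβ : 0 ≤ I.β) (hτ : 0 < I.τ) (hτ1 : I.τ ≤ 1) (j : ℕ) :
    optCVaR mdp I.H I.τ (s₁ j) - cvar I.τ (totalLaw mdp
        (augPolicy (I.policy D k) (-I.budget D k (s₁ j))) I.H (s₁ j)) ≤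
      I.τ⁻¹ * (2 * I.β * (expectedWidth mdp I D k I.H (s₁ j) (-I.budget D k (s₁ j))).toReal) := by
  have hφ := hlin.feature_measurable
  obtain ⟨hbG, hb0, hbmax⟩ := Input.budget_spec (D := D) (k := k) htieB (s₁ j) ⟨0, h0, le_rfl⟩
  set b := I.budget D k (s₁ j) with hb
  have hτi : 0 ≤ I.τ⁻¹ := inv_nonneg.2 hτ.le
  have hyH : ∀ g ∈ I.grid, -(I.H : ℝ) ≤ -g := fun g hg =>
    neg_le_neg ((le_abs_self g).trans (hlin.grid_bound g hg))
  -- Optimism: any level is dominated by a nonnegative grid level, where the estimated objective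
  -- exceeds the true one, and b_k maximizes the estimated objective.
  have hopt : optCVaR mdp I.H I.τ (s₁ j) ≤ I.objective D k (s₁ j) b := by
    obtain ⟨π₀, hπ₀⟩ := exists_isMeasurable_policy S A
    have : Nonempty {π : HistPolicy S A // π.IsMeasurable} := ⟨⟨π₀, hπ₀⟩⟩
    refine ciSup_le fun ⟨π, hπ⟩ => ciSup_le fun b' => ?_
    have hp := isProbabilityMeasure_totalLaw (mdp := mdp) hπ I.H (s₁ j)
    have hG : ∀ᵐ x ∂totalLaw mdp π I.H (s₁ j), x ∈ I.grid := by
      have := hlin.aug_grid π hπ j I.H le_rfl 0 h0 le_rfl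
      filter_upwards [show ∀ᵐ x ∂totalLaw mdp π I.H (s₁ j), -0 + x ∈ I.grid from this] with x hx
      simpa using hx
    obtain ⟨g, hgG, hg0, hg⟩ := exists_mem_grid_cvarObjective_le hτ hτ1
      (totalLaw_ae_mem_Icc hπ I.H (s₁ j)) h0 hG b'
    refine hg.trans (le_trans ?_ (hbmax g hgG hg0))
    rw [cvarObjective, Input.objective, integral_shortfall_eq]
    refine sub_le_sub_left (mul_le_mul_of_nonneg_left ?_ hτi) _
    rw [← ENNReal.ofReal_le_iff_le_toReal (shortfall_ne_top hπ _ _ _)]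
    obtain ⟨h, hh⟩ : ∃ h, I.H - I.H = h := ⟨_, rfl⟩
    have hh0 : h = 0 := by omega
    have key := fun hist => hacc.le_shortfall htieA hφ hlam hH hπ le_rfl hist (s₁ j) (hyH g hgG)
    rw [hh, hh0] at key
    exact key Fin.elim0
  set π := augPolicy (I.policy D k) (-b) with hπd
  have hπ : π.IsMeasurable := isMeasurable_augPolicy hφ hlam hH D k (-b)
  have hp := isProbabilityMeasure_totalLaw (mdp := mdp) hπ I.H (s₁ j)
  -- The `CVaR` of the policy played is bounded below by evaluating its objective at b_k alone.
  have hcv := cvarObjective_le_cvar hτ hτ1 (totalLaw_ae_mem_Icc (mdp := mdp) hπ I.H (s₁ j)) b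
  have hgap : (shortfall mdp π I.H 0 Fin.elim0 (s₁ j) (-b)).toReal ≤
      I.vToGo D k I.H (s₁ j) (-b) +
        2 * I.β * (expectedWidth mdp I D k I.H (s₁ j) (-b)).toReal := by
    have key := fun hist => hacc.shortfall_le hφ hlam hH hβ (-b) le_rfl hist (s₁ j)
    rw [Nat.sub_self] at key
    have h1 := key Fin.elim0
    simp only [Finset.univ_eq_empty, Finset.sum_empty, add_zero] at h1
    have h2 := h1 (hyH b hbG)
    have hW : expectedWidth mdp I D k I.H (s₁ j) (-b) ≠ ∞ :=
      ((expectedWidth_le hlam hlin.feature_norm _ _ _).trans_lt (ENNReal.natCast_lt_top _)).ne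
    have h3 := ENNReal.toReal_mono (ENNReal.add_ne_top.2
      ⟨ENNReal.ofReal_ne_top, ENNReal.mul_ne_top ENNReal.ofReal_ne_top hW⟩) h2
    rwa [ENNReal.toReal_add ENNReal.ofReal_ne_top (ENNReal.mul_ne_top ENNReal.ofReal_ne_top hW),
      ENNReal.toReal_mul, ENNReal.toReal_ofReal (hacc.mem_Icc _ le_rfl _ _ (hyH b hbG)).1,
      ENNReal.toReal_ofReal (by positivity)] at h3
  rw [cvarObjective, integral_shortfall_eq] at hcv
  have h4 := mul_le_mul_of_nonneg_left hgap hτi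
  rw [mul_add] at h4
  rw [Input.objective] at hopt
  linarith

end EpisodeGap

/-! ### Runs of the algorithm -/

section Past

variable {Ω S A : Type*} [MeasurableSpace S] [MeasurableSpace A] {H : ℕ} {D : Ω → Data S A}
  {k h : ℕ}

lemma past_measurable_st {i j : ℕ} (hi : i < k) (hj : j ≤ H) :
    Measurable[past H D k h] fun ω => (D ω).st i j := by
  rw [measurable_iff_comap_le]
  refine le_trans ?_ (le_sup_left.trans (le_sup_left.trans le_sup_left))
  exact le_iSup₂_of_le i hi (le_iSup₂_of_le j hj le_rfl)

lemma past_measurable_ac_rw {i j : ℕ} (hi : i < k) (hj : j < H) :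
    Measurable[past H D k h] fun ω => ((D ω).ac i j, (D ω).rw i j) := by
  rw [measurable_iff_comap_le]
  refine le_trans ?_ (le_sup_right.trans (le_sup_left.trans le_sup_left))
  exact le_iSup₂_of_le i hi (le_iSup₂_of_le j hj le_rfl)

lemma past_measurable_st_ac {j : ℕ} (hj : j ≤ h) :
    Measurable[past H D k h] fun ω => ((D ω).st k j, (D ω).ac k j) := by
  rw [measurable_iff_comap_le]
  refine le_trans ?_ (le_sup_right.trans le_sup_left)
  exact le_iSup₂_of_le j hj le_rfl

lemma past_measurable_rw {j : ℕ} (hj : j < h) :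
    Measurable[past H D k h] fun ω => (D ω).rw k j := by
  rw [measurable_iff_comap_le]
  refine le_trans ?_ le_sup_right
  exact le_iSup₂_of_le j hj le_rfl

lemma past_mono_step {h' : ℕ} (hh : h ≤ h') : past H D k h ≤ past H D k h' := by
  refine sup_le_sup (sup_le_sup le_rfl ?_) ?_
  · exact iSup₂_le fun j hj => le_iSup₂_of_le j (hj.trans hh) le_rfl
  · exact iSup₂_le fun j hj => le_iSup₂_of_le j (hj.trans_le hh) le_rfl

lemma measurableData_past : MeasurableData (past H D k h) D k H := fun _ hi _ hj =>
  ⟨past_measurable_st hi hj.le, measurable_fst.comp (past_measurable_ac_rw hi hj),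
    measurable_snd.comp (past_measurable_ac_rw hi hj), past_measurable_st hi hj⟩

end Past

section Run

variable {Ω S A : Type*} [mΩ : MeasurableSpace Ω] [MeasurableSpace S] [MeasurableSpace A]
  [MeasurableSingletonClass A] [Fintype A] [Nonempty A] {d : ℕ} {Pr : Measure Ω}
  [IsProbabilityMeasure Pr] {mdp : MDP S A} {I : Input S A d} {s₁ : ℕ → S} {K : ℕ}
  {D : Ω → Data S A}

lemma IsRun.past_le (hrun : IsRun Pr mdp I s₁ K D) {k h : ℕ} (hk : k < K) (hh : h < I.H) :
    past I.H D k h ≤ mΩ := by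
  refine sup_le (sup_le (sup_le ?_ ?_) ?_) ?_
  · exact iSup₂_le fun i hi => iSup₂_le fun j hj =>
      (hrun.measurable_st i (hi.trans hk) j hj).comap_le
  · exact iSup₂_le fun i hi => iSup₂_le fun j hj =>
      ((hrun.measurable_ac i (hi.trans hk) j hj).prodMk
        (hrun.measurable_rw i (hi.trans hk) j hj)).comap_le
  · exact iSup₂_le fun j hj => ((hrun.measurable_st k hk j (hj.trans hh.le)).prodMk
      (hrun.measurable_ac k hk j (hj.trans_lt hh))).comap_le
  · exact iSup₂_le fun j hj => (hrun.measurable_rw k hk j (hj.trans hh)).comap_le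

lemma IsRun.measurableData (hrun : IsRun Pr mdp I s₁ K D) : MeasurableData mΩ D K I.H :=
  fun i hi h hh => ⟨hrun.measurable_st i hi h hh.le, hrun.measurable_ac i hi h hh,
    hrun.measurable_rw i hi h hh, hrun.measurable_st i hi (h + 1) hh⟩

/-- The conditional law of the next state and the reward, given the past. -/
def pastKernel (mdp : MDP S A) (H : ℕ) (D : Ω → Data S A) (k h : ℕ) :
    @Kernel Ω (S × ℝ) (past H D k h) inferInstance :=
  (mdp.step h).comap (fun ω => ((D ω).st k h, (D ω).ac k h)) (past_measurable_st_ac le_rfl)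

instance (H : ℕ) (k h : ℕ) :
    @IsMarkovKernel Ω (S × ℝ) (past H D k h) inferInstance (pastKernel mdp H D k h) := by
  unfold pastKernel; infer_instance

/-- The identity map from Ω to Ω with the coarser σ-algebra of the past turns the set-wise
`dynamics` condition into a disintegration, so integrands may depend on the whole past. -/
lemma IsRun.map_eq_compProd (hrun : IsRun Pr mdp I s₁ K D) {k h : ℕ} (hk : k < K)
    (hh : h < I.H) :
    @Measure.map Ω (Ω × S × ℝ) mΩ (@Prod.instMeasurableSpace _ _ (past I.H D k h) inferInstance)
      (fun ω => (id ω, ((D ω).st k (h + 1), (D ω).rw k h))) Pr =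
    @Measure.compProd Ω (S × ℝ) (past I.H D k h) inferInstance
      (@Measure.map Ω Ω mΩ (past I.H D k h) id Pr) (pastKernel mdp I.H D k h) := by
  refine map_prodMk_eq_compProd (mE := past I.H D k h) (T := id) Pr
    (measurable_id'' (hrun.past_le hk hh))
    (X := fun ω => ((D ω).st k (h + 1), (D ω).rw k h))
    ((hrun.measurable_st k hk (h + 1) hh).prodMk (hrun.measurable_rw k hk h hh))
    (pastKernel mdp I.H D k h) fun C hC B hB => ?_
  exact hrun.dynamics k hk h hh C hC B hB

lemma IsRun.lintegral_step (hrun : IsRun Pr mdp I s₁ K D) {k h : ℕ} (hk : k < K) (hh : h < I.H)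
    {F : Ω × S × ℝ → ℝ≥0∞}
    (hF : @Measurable _ _ (@Prod.instMeasurableSpace _ _ (past I.H D k h) inferInstance) _ F) :
    ∫⁻ ω, F (ω, (D ω).st k (h + 1), (D ω).rw k h) ∂Pr =
      ∫⁻ ω, ∫⁻ q, F (ω, q) ∂mdp.step h ((D ω).st k h, (D ω).ac k h) ∂Pr :=
  lintegral_eq_of_map_prodMk (mE := past I.H D k h) (T := id) Pr
    (measurable_id'' (hrun.past_le hk hh))
    (X := fun ω => ((D ω).st k (h + 1), (D ω).rw k h))
    ((hrun.measurable_st k hk (h + 1) hh).prodMk (hrun.measurable_rw k hk h hh))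
    (pastKernel mdp I.H D k h) (hrun.map_eq_compProd hk hh) hF

lemma IsRun.lintegral_mul_exp_noise_le (hrun : IsRun Pr mdp I s₁ K D) {k h : ℕ} (hk : k < K)
    (hh : h < I.H) {f : S × ℝ → ℝ} (hf : Measurable f) (hf01 : ∀ q, f q ∈ Set.Icc (0 : ℝ) 1)
    {U s : Ω → ℝ} (hU : Measurable[past I.H D k h] U) (hs : Measurable[past I.H D k h] s) :
    ∫⁻ ω, ENNReal.ofReal (U ω) *
        ENNReal.ofReal (Real.exp (s ω * sampleNoise mdp (D ω) h f k)) ∂Pr ≤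
      ∫⁻ ω, ENNReal.ofReal (U ω) * ENNReal.ofReal (Real.exp (s ω ^ 2 / 2)) ∂Pr :=
  lintegral_mul_exp_centered_le (mE := past I.H D k h) (T := id) Pr
    (measurable_id'' (hrun.past_le hk hh))
    (X := fun ω => ((D ω).st k (h + 1), (D ω).rw k h))
    ((hrun.measurable_st k hk (h + 1) hh).prodMk (hrun.measurable_rw k hk h hh))
    (pastKernel mdp I.H D k h) (hrun.map_eq_compProd hk hh) hf hf01 hU hs

lemma measurable_sampleNoise {E : Type*} {mE : MeasurableSpace E} {D : E → Data S A} {k T h : ℕ}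
    (hD : MeasurableData mE D k T) {f : S × ℝ → ℝ} (hf : Measurable f) {i : ℕ} (hi : i < k)
    (hh : h < T) : Measurable fun e => sampleNoise mdp (D e) h f i := by
  obtain ⟨h1, h2, h3, h4⟩ := hD i hi h hh
  have hbar : Measurable fun p => ∫ q, f q ∂mdp.step h p :=
    (StronglyMeasurable.integral_kernel hf.stronglyMeasurable).measurable
  exact (hf.comp (h4.prodMk h3)).sub (hbar.comp (h1.prodMk h2))

lemma abs_sampleNoise_le {D : Data S A} {f : S × ℝ → ℝ} (hf : Measurable f)
    (hf01 : ∀ q, f q ∈ Set.Icc (0 : ℝ) 1) (h i : ℕ) : |sampleNoise mdp D h f i| ≤ 1 := by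
  have hi : Integrable f (mdp.step h (D.st i h, D.ac i h)) :=
    Integrable.of_mem_Icc 0 1 hf.aemeasurable (ae_of_all _ hf01)
  have h0 : 0 ≤ ∫ q, f q ∂mdp.step h (D.st i h, D.ac i h) := integral_nonneg fun q => (hf01 q).1
  have h1 : ∫ q, f q ∂mdp.step h (D.st i h, D.ac i h) ≤ 1 := by
    have := integral_mono hi (integrable_const (1 : ℝ)) fun q => (hf01 q).2
    simpa using this
  obtain ⟨f0, f1⟩ := hf01 (D.st i (h + 1), D.rw i h)
  rw [sampleNoise, abs_le]
  constructor <;> linarith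

/-- Time is the episode index, with the step h fixed. At the past of (i, h) the feature of episode i
is known, and so are the noises of earlier episodes, which are complete. -/
lemma IsRun.measure_noiseSum_le (hrun : IsRun Pr mdp I s₁ K D)
    (hφm : ∀ a, Measurable fun s => I.φ s a) (hφ : ∀ s a, ‖I.φ s a‖ ≤ 1) {h : ℕ} (hh : h < I.H)
    {f : S × ℝ → ℝ} (hf : Measurable f) (hf01 : ∀ q, f q ∈ Set.Icc (0 : ℝ) 1) {k : ℕ}
    (hk : k ≤ K) {ε : ℝ} (hε : 0 < ε) :
    Pr {ω | (d : ℝ) ^ 2 * Real.log ((d : ℝ) ^ 2 + k) + 2 * Real.log (1 / ε) ≤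
      invNormSq (ridge (I.feat (D ω) h) k)
        (noiseSum (I.feat (D ω) h) (sampleNoise mdp (D ω) h f) k)} ≤ ENNReal.ofReal ε := by
  have hcard : (Fintype.card (Fin d × Fin d) : ℝ) = (d : ℝ) ^ 2 := by simp [sq]
  rw [← hcard]
  refine measure_selfNormalized_le (m := fun i => past I.H D i h) (K := K) Pr ?_ ?_ ?_ ?_ ?_ ?_ ?_ hk
    hε
  · intro i _ i' hi' j
    rcases hi'.lt_or_eq with hlt | rfl
    · exact measurableData_past.feat hφm hlt hh j
    · have h1 := past_measurable_st_ac (H := I.H) (D := D) (k := i') (le_refl h)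
      exact measurable_apply_action (q := fun ω a => psi I.φ ((D ω).st i' h) a j)
        (fun a => (measurable_psi_apply hφm a j).comp (measurable_fst.comp h1))
        (measurable_snd.comp h1)
  · intro i _ i' hi'
    exact measurable_sampleNoise measurableData_past hf hi' hh
  · intro i hi j
    exact hrun.measurableData.feat hφm hi hh j
  · intro i hi
    exact measurable_sampleNoise hrun.measurableData hf hi hh
  · intro i _ ω
    exact abs_sampleNoise_le hf hf01 h i
  · intro i hi U s hU hs
    exact hrun.lintegral_mul_exp_noise_le hi hh hf hf01 hU hs
  · exact fun ω i => psi_dotProduct_self_le hφ _ _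

lemma IsRun.ae_reward_mem (hrun : IsRun Pr mdp I s₁ K D)
    (hlin : IsDiscretizedLinear mdp I.H I.φ I.grid s₁) {k h : ℕ} (hk : k < K) (hh : h < I.H) :
    Pr {ω | (D ω).rw k h ∉ rewardGrid I.grid} = 0 := by
  have hB : MeasurableSet {q : S × ℝ | q.2 ∉ rewardGrid I.grid} :=
    measurable_snd (Finset.measurableSet (rewardGrid I.grid)).compl
  have h1 := hrun.dynamics k hk h hh Set.univ MeasurableSet.univ _ hB
  rw [Set.univ_inter] at h1
  refine h1.trans ?_
  rw [lintegral_eq_zero_of_ae_eq_zero]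
  refine ae_of_all _ fun ω => ?_
  exact mdp.step_ae_reward h _ (hlin.rew_rewardGrid hh _)

/-- The concentration event has high probability. -/
lemma IsRun.measure_not_concentrationEvent_le (hrun : IsRun Pr mdp I s₁ K D)
    (hlin : IsDiscretizedLinear mdp I.H I.φ I.grid s₁) (b R : ℝ) (N : ℕ) {ε ρ : ℝ} (hε : 0 < ε)
    (hρ0 : 0 ≤ ρ)
    (hρ : (d : ℝ) ^ 2 * Real.log ((d : ℝ) ^ 2 + K) + 2 * Real.log (1 / ε) ≤ ρ ^ 2) :
    Pr {ω | ¬ ∀ k < K, ConcentrationEvent I mdp b R N ρ k (D ω)} ≤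
      ENNReal.ofReal (K * (I.H * (Fintype.card (NetIndex d (rewardGrid I.grid) N) * ε))) := by
  have hsub : {ω | ¬ ∀ k < K, ConcentrationEvent I mdp b R N ρ k (D ω)} ⊆
      (⋃ k ∈ Finset.range K, ⋃ h ∈ Finset.range I.H, {ω | (D ω).rw k h ∉ rewardGrid I.grid}) ∪
      (⋃ k ∈ Finset.range K, ⋃ h ∈ Finset.range I.H,
        ⋃ θ ∈ (Finset.univ : Finset (NetIndex d (rewardGrid I.grid) N)),
        {ω | (d : ℝ) ^ 2 * Real.log ((d : ℝ) ^ 2 + k) + 2 * Real.log (1 / ε) ≤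
          invNormSq (ridge (I.feat (D ω) h) k) (noiseSum (I.feat (D ω) h)
            (sampleNoise mdp (D ω) h (netFun I.φ b R θ)) k)}) := by
    intro ω hω
    by_contra hcon
    refine hω fun k hk h hh => ?_
    simp only [Set.mem_union, Set.mem_iUnion, Finset.mem_range, Set.mem_ofPred_eq, not_or,
      not_exists, not_not, Finset.mem_univ, not_le] at hcon
    refine ⟨fun i hi => hcon.1 i (hi.trans hk) h hh, fun θ => ?_⟩
    rw [Real.sqrt_le_left hρ0]
    refine (hcon.2 k hk h hh θ trivial).le.trans (le_trans ?_ hρ)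
    rcases Nat.eq_zero_or_pos d with hd | hd
    · simp [hd]
    · gcongr
  refine (measure_mono hsub).trans ((measure_union_le _ _).trans ?_)
  have h1 : Pr (⋃ k ∈ Finset.range K, ⋃ h ∈ Finset.range I.H,
      {ω | (D ω).rw k h ∉ rewardGrid I.grid}) = 0 :=
    (measure_biUnion_null_iff (Finset.range K).countable_toSet).2 fun k hk =>
      (measure_biUnion_null_iff (Finset.range I.H).countable_toSet).2 fun h hh =>
        hrun.ae_reward_mem hlin (Finset.mem_range.1 hk) (Finset.mem_range.1 hh)
  rw [h1, zero_add]
  have h2 : ∀ k < K, ∀ h < I.H, Pr (⋃ θ ∈ (Finset.univ : Finset (NetIndex d (rewardGrid I.grid) N)),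
      {ω | (d : ℝ) ^ 2 * Real.log ((d : ℝ) ^ 2 + k) + 2 * Real.log (1 / ε) ≤
        invNormSq (ridge (I.feat (D ω) h) k) (noiseSum (I.feat (D ω) h)
          (sampleNoise mdp (D ω) h (netFun I.φ b R θ)) k)}) ≤
      Fintype.card (NetIndex d (rewardGrid I.grid) N) * ENNReal.ofReal ε := by
    intro k hk h hh
    refine (measure_biUnion_finset_le _ _).trans ((Finset.sum_le_card_nsmul _ _ _ fun θ _ =>
      hrun.measure_noiseSum_le hlin.feature_measurable hlin.feature_norm hh
        (measurable_netFun hlin.feature_measurable b R θ) (fun q => netFun_mem θ q) hk.le hε).trans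
      (le_of_eq ?_))
    rw [nsmul_eq_mul, Finset.card_univ]
  have h3 : ∀ k < K, Pr (⋃ h ∈ Finset.range I.H,
      ⋃ θ ∈ (Finset.univ : Finset (NetIndex d (rewardGrid I.grid) N)),
      {ω | (d : ℝ) ^ 2 * Real.log ((d : ℝ) ^ 2 + k) + 2 * Real.log (1 / ε) ≤
        invNormSq (ridge (I.feat (D ω) h) k) (noiseSum (I.feat (D ω) h)
          (sampleNoise mdp (D ω) h (netFun I.φ b R θ)) k)}) ≤
      I.H * (Fintype.card (NetIndex d (rewardGrid I.grid) N) * ENNReal.ofReal ε) := by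
    intro k hk
    refine (measure_biUnion_finset_le _ _).trans ((Finset.sum_le_card_nsmul _ _ _ fun h hh =>
      h2 k hk h (Finset.mem_range.1 hh)).trans (le_of_eq ?_))
    rw [nsmul_eq_mul, Finset.card_range]
  refine (measure_biUnion_finset_le _ _).trans ((Finset.sum_le_card_nsmul _ _ _ fun k hk =>
    h3 k (Finset.mem_range.1 hk)).trans (le_of_eq ?_))
  rw [nsmul_eq_mul, Finset.card_range, ENNReal.ofReal_mul (by positivity),
    ENNReal.ofReal_mul (by positivity), ENNReal.ofReal_mul (by positivity), ENNReal.ofReal_natCast,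
    ENNReal.ofReal_natCast, ENNReal.ofReal_natCast]

end Run

/-! ### The sum of the expected widths -/

section WidthSum

variable {Ω S A : Type*} [mΩ : MeasurableSpace Ω] [MeasurableSpace S] [MeasurableSpace A]
  [MeasurableSingletonClass A] [Fintype A] [Nonempty A] {d : ℕ} {Pr : Measure Ω}
  [IsProbabilityMeasure Pr] {mdp : MDP S A} {I : Input S A d} {s₁ : ℕ → S} {K : ℕ}
  {D : Ω → Data S A}

/-- The norm of the feature at step `h` of episode `k`. -/
def width (I : Input S A d) (D : Data S A) (k h : ℕ) : ℝ :=
  √(invNormSq (I.gram D k h) (psi I.φ (D.st k h) (D.ac k h)))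

/-- The sum of the norms of the features in episode `k`. -/
def episodeWidth (I : Input S A d) (D : Data S A) (k : ℕ) : ℝ :=
  ∑ h ∈ Finset.range I.H, width I D k h

/-- The expected sum of the norms of the features in episode `k`. -/
def meanWidth (mdp : MDP S A) (I : Input S A d) (s₁ : ℕ → S) (D : Data S A) (k : ℕ) : ℝ :=
  (expectedWidth mdp I D k I.H (s₁ k) (-I.budget D k (s₁ k))).toReal

/-- The augmented coordinate at step `h` of episode `k`. -/
def augCoord (I : Input S A d) (s₁ : ℕ → S) (D : Data S A) (k h : ℕ) : ℝ :=
  -I.budget D k (s₁ k) + ∑ j ∈ Finset.range h, D.rw k j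

lemma width_mem_Icc (hlam : I.lam = 1) (hφ : ∀ s a, ‖I.φ s a‖ ≤ 1) (D : Data S A) (k h : ℕ) :
    width I D k h ∈ Set.Icc (0 : ℝ) 1 := by
  refine ⟨Real.sqrt_nonneg _, Real.sqrt_le_one.2 ?_⟩
  rw [I.gram_eq_ridge hlam]
  exact ((dotProduct_ridge_inv_le _ k _).2).trans (psi_dotProduct_self_le hφ _ _)

lemma episodeWidth_mem_Icc (hlam : I.lam = 1) (hφ : ∀ s a, ‖I.φ s a‖ ≤ 1) (D : Data S A) (k : ℕ) :
    episodeWidth I D k ∈ Set.Icc (0 : ℝ) I.H := by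
  refine ⟨Finset.sum_nonneg fun h _ => (width_mem_Icc hlam hφ D k h).1, ?_⟩
  refine (Finset.sum_le_sum fun h _ => (width_mem_Icc hlam hφ D k h).2).trans (le_of_eq ?_)
  simp

lemma sum_episodeWidth_le (hlam : I.lam = 1) (hφ : ∀ s a, ‖I.φ s a‖ ≤ 1) (D : Data S A) (K : ℕ) :
    ∑ k ∈ Finset.range K, episodeWidth I D k ≤
      I.H * √(K * (2 * ((d : ℝ) ^ 2 * Real.log ((d : ℝ) ^ 2 + K)))) := by
  have hcard : (Fintype.card (Fin d × Fin d) : ℝ) = (d : ℝ) ^ 2 := by simp [sq]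
  simp only [episodeWidth]
  rw [Finset.sum_comm]
  calc ∑ h ∈ Finset.range I.H, ∑ k ∈ Finset.range K, width I D k h
      ≤ ∑ _h ∈ Finset.range I.H, √(K * (2 * ((d : ℝ) ^ 2 * Real.log ((d : ℝ) ^ 2 + K)))) := by
        refine Finset.sum_le_sum fun h _ => ?_
        rw [← hcard]
        refine le_trans (le_of_eq (Finset.sum_congr rfl fun k _ => ?_))
          (sum_sqrt_invNormSq_le (I.feat D h) (fun i => psi_dotProduct_self_le hφ _ _) K)
        rw [width, I.gram_eq_ridge hlam]
        rfl
    _ = _ := by simp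

section Measurability

variable {E : Type*} {mE : MeasurableSpace E} {D : E → Data S A} {k T : ℕ}

lemma MeasurableData.mono (hD : MeasurableData mE D k T) {j : ℕ} (hj : j ≤ k) :
    MeasurableData mE D j T := fun i hi => hD i (hi.trans_le hj)

lemma MeasurableData.episodeWidth (hD : MeasurableData mE D k I.H)
    (hφ : ∀ a, Measurable fun s => I.φ s a) (hlam : I.lam = 1) {j : ℕ} (hj : j < k) :
    Measurable fun e => episodeWidth I (D e) j :=
  Finset.measurable_sum _ fun h hh =>
    (hD.mono hj.le).sqrt_invNormSq hφ hlam (Finset.mem_range.1 hh) measurable_id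
      (hD j hj h (Finset.mem_range.1 hh)).1 (hD j hj h (Finset.mem_range.1 hh)).2.1

lemma MeasurableData.meanWidth (mdp : MDP S A) (s₁ : ℕ → S) (hD : MeasurableData mE D k I.H)
    (hφ : ∀ a, Measurable fun s => I.φ s a) (hlam : I.lam = 1) (hH : 1 ≤ I.H) {j : ℕ}
    (hj : j ≤ k) : Measurable fun e => meanWidth mdp I s₁ (D e) j := by
  have h1 := (hD.mono hj).expectedWidth mdp hφ hlam hH le_rfl I.H
  have h2 := (hD.mono hj).budget hφ hlam hH le_rfl (s₁ j)
  exact (h1.comp (measurable_id.prodMk (measurable_const.prodMk h2.neg))).ennreal_toReal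

end Measurability

/-- Under the run, `expectedWidth` is the conditional expectation of the sum of the widths. -/
lemma IsRun.lintegral_mul_expectedWidth (hrun : IsRun Pr mdp I s₁ K D)
    (hφ : ∀ a, Measurable fun s => I.φ s a) (hlam : I.lam = 1) (hH : 1 ≤ I.H) {k : ℕ} (hk : k < K)
    {G : Ω → ℝ≥0∞} (hG : Measurable[past I.H D k 0] G) {n h : ℕ} (hn : n + h = I.H) :
    ∫⁻ ω, G ω * expectedWidth mdp I (D ω) k n ((D ω).st k h) (augCoord I s₁ (D ω) k h) ∂Pr =
      ∑ j ∈ Finset.Ico h I.H, ∫⁻ ω, G ω * ENNReal.ofReal (width I (D ω) k j) ∂Pr := by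
  induction n generalizing h with
  | zero =>
    have : h = I.H := by omega
    simp [this, expectedWidth]
  | succ n ih =>
    have hh : h < I.H := by omega
    have hhn : I.H - (n + 1) = h := by omega
    have hmP := measurableData_past (H := I.H) (D := D) (k := k) (h := h)
    have hsa := past_measurable_st_ac (H := I.H) (D := D) (k := k) (le_refl h)
    have hGm : Measurable[past I.H D k h] G := hG.mono (past_mono_step (Nat.zero_le h)) le_rfl
    have hym : Measurable[past I.H D k h] fun ω => augCoord I s₁ (D ω) k h :=
      (hmP.budget hφ hlam hH le_rfl (s₁ k)).neg.add
        (Finset.measurable_sum _ fun j hj => past_measurable_rw (Finset.mem_range.1 hj))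
    have hwm : Measurable[past I.H D k h] fun ω => ENNReal.ofReal (width I (D ω) k h) :=
      (hmP.sqrt_invNormSq hφ hlam hh measurable_id (measurable_fst.comp hsa)
        (measurable_snd.comp hsa)).ennreal_ofReal
    have hFm : @Measurable _ _ (@Prod.instMeasurableSpace _ _ (past I.H D k h) inferInstance) _
        (fun p : Ω × S × ℝ => G p.1 * expectedWidth mdp I (D p.1) k n p.2.1
          (augCoord I s₁ (D p.1) k h + p.2.2)) := by
      refine (hGm.comp measurable_fst).mul ((hmP.expectedWidth mdp hφ hlam hH le_rfl n).comp
        (f := fun p : Ω × S × ℝ => (p.1, p.2.1, augCoord I s₁ (D p.1) k h + p.2.2)) ?_)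
      exact measurable_fst.prodMk ((measurable_fst.comp measurable_snd).prodMk
        ((hym.comp measurable_fst).add (measurable_snd.comp measurable_snd)))
    have h1 := hrun.lintegral_step hk hh hFm
    have h2 := ih (h := h + 1) (by omega)
    have e1 : ∀ ω, augCoord I s₁ (D ω) k (h + 1) = augCoord I s₁ (D ω) k h + (D ω).rw k h := by
      intro ω
      rw [augCoord, Finset.sum_range_succ, augCoord, add_assoc]
    simp only [e1] at h2
    have hGw : Measurable fun ω => G ω * ENNReal.ofReal (width I (D ω) k h) :=
      (hGm.mul hwm).mono (hrun.past_le hk hh) le_rfl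
    dsimp only at h1
    rw [Finset.sum_eq_sum_Ico_succ_bot hh, ← h2, h1, ← lintegral_add_left hGw]
    refine lintegral_congr fun ω => ?_
    have hact := hrun.action k hk h hh ω
    have hpol : I.policy (D ω) k h ((D ω).st k h) (augCoord I s₁ (D ω) k h) = (D ω).ac k h :=
      hact.symm
    have hmW : Measurable fun q : S × ℝ =>
        expectedWidth mdp I (D ω) k n q.1 (augCoord I s₁ (D ω) k h + q.2) :=
      ((measurableData_const (D ω) k I.H).expectedWidth mdp hφ hlam hH le_rfl n).comp
        (f := fun q : S × ℝ => ((), q.1, augCoord I s₁ (D ω) k h + q.2))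
        (measurable_const.prodMk (measurable_fst.prodMk (measurable_snd.const_add _)))
    rw [expectedWidth, hhn]
    dsimp only
    rw [hpol, mul_add, lintegral_const_mul _ hmW]
    rfl

lemma meanWidth_mem_Icc (hlam : I.lam = 1) (hφ : ∀ s a, ‖I.φ s a‖ ≤ 1) (D : Data S A) (k : ℕ) :
    meanWidth mdp I s₁ D k ∈ Set.Icc (0 : ℝ) I.H := by
  refine ⟨ENNReal.toReal_nonneg, ?_⟩
  have := ENNReal.toReal_mono (ENNReal.natCast_ne_top _)
    (expectedWidth_le (mdp := mdp) (D := D) (k := k) hlam hφ I.H (s₁ k) (-I.budget D k (s₁ k)))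
  simpa [meanWidth] using this

lemma IsRun.lintegral_mul_meanWidth (hrun : IsRun Pr mdp I s₁ K D)
    (hφm : ∀ a, Measurable fun s => I.φ s a) (hφ : ∀ s a, ‖I.φ s a‖ ≤ 1) (hlam : I.lam = 1)
    (hH : 1 ≤ I.H) {k : ℕ} (hk : k < K) {G : Ω → ℝ≥0∞} (hG : Measurable[past I.H D k 0] G) :
    ∫⁻ ω, G ω * ENNReal.ofReal (meanWidth mdp I s₁ (D ω) k) ∂Pr =
      ∫⁻ ω, G ω * ENNReal.ofReal (episodeWidth I (D ω) k) ∂Pr := by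
  have h1 := hrun.lintegral_mul_expectedWidth hφm hlam hH hk hG (n := I.H) (h := 0) (by omega)
  have hGΩ : Measurable G := hG.mono (hrun.past_le hk hH) le_rfl
  have hwm : ∀ j ∈ Finset.range I.H, Measurable fun ω => ENNReal.ofReal (width I (D ω) k j) := by
    intro j hj
    have hjH := Finset.mem_range.1 hj
    exact ((hrun.measurableData.mono hk.le).sqrt_invNormSq hφm hlam hjH measurable_id
      (hrun.measurable_st k hk j hjH.le) (hrun.measurable_ac k hk j hjH)).ennreal_ofReal
  have hGw : ∀ j ∈ Finset.range I.H,
      Measurable fun ω => G ω * ENNReal.ofReal (width I (D ω) k j) :=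
    fun j hj => hGΩ.mul (hwm j hj)
  rw [Nat.Ico_zero_eq_range, ← lintegral_finsetSum _ hGw] at h1
  calc ∫⁻ ω, G ω * ENNReal.ofReal (meanWidth mdp I s₁ (D ω) k) ∂Pr
      = ∫⁻ ω, G ω * expectedWidth mdp I (D ω) k I.H ((D ω).st k 0)
          (augCoord I s₁ (D ω) k 0) ∂Pr := by
        refine lintegral_congr fun ω => ?_
        rw [meanWidth, ENNReal.ofReal_toReal ((expectedWidth_le hlam hφ _ _ _).trans_lt
          (ENNReal.natCast_lt_top _)).ne, hrun.init k hk ω, augCoord]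
        simp
    _ = _ := h1
    _ = _ := by
        refine lintegral_congr fun ω => ?_
        rw [episodeWidth, ENNReal.ofReal_sum_of_nonneg fun j _ => (width_mem_Icc hlam hφ _ _ _).1,
          Finset.mul_sum]

/-- Convexity puts the exponential below its chord, and e ≥ 2 bounds the slope. -/
lemma exp_neg_le_one_sub_half {t : ℝ} (ht : t ∈ Set.Icc (0 : ℝ) 1) :
    Real.exp (-t) ≤ 1 - t / 2 := by
  have h1 := convexOn_exp.2 (Set.mem_univ 0) (Set.mem_univ (-1))
    (by linarith [ht.2] : 0 ≤ 1 - t) ht.1 (by ring)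
  simp only [smul_eq_mul, mul_zero, zero_add, mul_neg, mul_one, Real.exp_zero] at h1
  have h2 : Real.exp (-1) ≤ 1 / 2 := by
    rw [Real.exp_neg, one_div]
    exact inv_anti₀ two_pos (by linarith [Real.add_one_le_exp 1])
  nlinarith [ht.1]

/-- With x the normalized width in [0, 1] and u its conditional mean, E e⁻ˣ ≤ 1 - u/2 ≤ e^(-u/2).
This multiplicative supermartingale gives a deviation of order H log(1/ε) and no √K term. -/
lemma IsRun.lintegral_exp_width_le_one (hrun : IsRun Pr mdp I s₁ K D)
    (hφm : ∀ a, Measurable fun s => I.φ s a) (hφ : ∀ s a, ‖I.φ s a‖ ≤ 1) (hlam : I.lam = 1)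
    (hH : 1 ≤ I.H) {k : ℕ} (hk : k ≤ K) :
    ∫⁻ ω, ENNReal.ofReal (Real.exp (∑ j ∈ Finset.range k,
      (meanWidth mdp I s₁ (D ω) j / I.H / 2 - episodeWidth I (D ω) j / I.H))) ∂Pr ≤ 1 := by
  have hH' : (0 : ℝ) < I.H := by exact_mod_cast hH
  induction k with
  | zero => simp
  | succ k ih =>
    have hkK : k < K := hk
    refine le_trans ?_ (ih hkK.le)
    set W : Ω → ℝ := fun ω => ∑ j ∈ Finset.range k,
      (meanWidth mdp I s₁ (D ω) j / I.H / 2 - episodeWidth I (D ω) j / I.H)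
    set u : Ω → ℝ := fun ω => meanWidth mdp I s₁ (D ω) k / I.H
    set x : Ω → ℝ := fun ω => episodeWidth I (D ω) k / I.H
    have hmP := measurableData_past (H := I.H) (D := D) (k := k) (h := 0)
    have hu01 : ∀ ω, u ω ∈ Set.Icc (0 : ℝ) 1 := fun ω => by
      obtain ⟨h0, h1⟩ := meanWidth_mem_Icc (mdp := mdp) (s₁ := s₁) hlam hφ (D ω) k
      exact ⟨div_nonneg h0 hH'.le, (div_le_one hH').2 h1⟩
    have hx01 : ∀ ω, x ω ∈ Set.Icc (0 : ℝ) 1 := fun ω => by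
      obtain ⟨h0, h1⟩ := episodeWidth_mem_Icc hlam hφ (D ω) k
      exact ⟨div_nonneg h0 hH'.le, (div_le_one hH').2 h1⟩
    have hWm : Measurable[past I.H D k 0] W := Finset.measurable_sum _ fun j hj =>
      (((hmP.meanWidth mdp s₁ hφm hlam hH (Finset.mem_range.1 hj).le).div_const _).div_const _).sub
        ((hmP.episodeWidth hφm hlam (Finset.mem_range.1 hj)).div_const _)
    have hum : Measurable[past I.H D k 0] u :=
      (hmP.meanWidth mdp s₁ hφm hlam hH le_rfl).div_const _
    set G : Ω → ℝ≥0∞ := fun ω => ENNReal.ofReal (Real.exp (W ω + u ω / 2))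
    have hGm : Measurable[past I.H D k 0] G :=
      (Real.measurable_exp.comp (hWm.add (hum.div_const 2))).ennreal_ofReal
    have hle := hrun.past_le hkK hH
    have hGΩ : Measurable G := hGm.mono hle le_rfl
    have huΩ : Measurable u := hum.mono hle le_rfl
    have hxΩ : Measurable x := by
      exact (Finset.measurable_sum _ fun j hj =>
        (hrun.measurableData.mono hkK.le).sqrt_invNormSq hφm hlam (Finset.mem_range.1 hj)
          measurable_id (hrun.measurable_st k hkK j (Finset.mem_range.1 hj).le)
          (hrun.measurable_ac k hkK j (Finset.mem_range.1 hj))).div_const _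
    have hux : ∫⁻ ω, G ω * ENNReal.ofReal (u ω / 2) ∂Pr =
        ∫⁻ ω, G ω * ENNReal.ofReal (x ω / 2) ∂Pr := by
      have h1 := hrun.lintegral_mul_meanWidth hφm hφ hlam hH hkK
        (G := fun ω => G ω * ENNReal.ofReal (1 / (2 * I.H))) (hGm.mul measurable_const)
      simp only [mul_assoc] at h1
      have e : ∀ y : ℝ, ENNReal.ofReal (1 / (2 * I.H)) * ENNReal.ofReal y =
          ENNReal.ofReal (y / I.H / 2) := fun y => by
        rw [← ENNReal.ofReal_mul (by positivity)]
        congr 1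
        field_simp
      simpa only [e] using h1
    -- Finiteness allows the common term to be cancelled at the end.
    have hfin : ∫⁻ ω, G ω * ENNReal.ofReal (u ω / 2) ∂Pr ≠ ∞ := by
      have hb : ∀ ω, G ω * ENNReal.ofReal (u ω / 2) ≤
          ENNReal.ofReal (Real.exp (k + 1)) * 1 := by
        intro ω
        have hWk : W ω ≤ k := by
          refine (Finset.sum_le_card_nsmul _ _ 1 fun j _ => ?_).trans (le_of_eq (by simp))
          have h0 := (episodeWidth_mem_Icc hlam hφ (D ω) j).1
          have h1 := (meanWidth_mem_Icc (mdp := mdp) (s₁ := s₁) hlam hφ (D ω) j).2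
          have h2 : meanWidth mdp I s₁ (D ω) j / I.H ≤ 1 := (div_le_one hH').2 h1
          have h3 : 0 ≤ episodeWidth I (D ω) j / I.H := div_nonneg h0 hH'.le
          linarith
        refine mul_le_mul' (ENNReal.ofReal_le_ofReal (Real.exp_le_exp.2 ?_)) ?_
        · linarith [(hu01 ω).2]
        · rw [← ENNReal.ofReal_one]
          exact ENNReal.ofReal_le_ofReal (by linarith [(hu01 ω).2])
      refine ((lintegral_mono hb).trans_lt ?_).ne
      simp
    -- This is e⁻ˣ + x/2 ≤ 1 integrated against `G`; the next inequality is 1 ≤ e^(-u/2) + u/2. The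
    -- terms with x and u agree because u is the conditional mean of x.
    have h1 : ∫⁻ ω, ENNReal.ofReal (Real.exp (∑ j ∈ Finset.range (k + 1),
        (meanWidth mdp I s₁ (D ω) j / I.H / 2 - episodeWidth I (D ω) j / I.H))) ∂Pr +
        ∫⁻ ω, G ω * ENNReal.ofReal (x ω / 2) ∂Pr ≤ ∫⁻ ω, G ω ∂Pr := by
      have hm : Measurable fun ω => G ω * ENNReal.ofReal (x ω / 2) :=
        hGΩ.mul (hxΩ.div_const 2).ennreal_ofReal
      rw [← lintegral_add_right _ hm]
      refine lintegral_mono fun ω => ?_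
      dsimp only
      rw [Finset.sum_range_succ, ← ENNReal.ofReal_mul (Real.exp_pos _).le,
        ← ENNReal.ofReal_add (Real.exp_pos _).le
          (mul_nonneg (Real.exp_pos _).le (by linarith [(hx01 ω).1]))]
      refine ENNReal.ofReal_le_ofReal ?_
      have e : W ω + (u ω / 2 - x ω) = (W ω + u ω / 2) + -x ω := by ring
      change Real.exp (W ω + (u ω / 2 - x ω)) + _ ≤ _
      rw [e, Real.exp_add (W ω + u ω / 2)]
      nlinarith [exp_neg_le_one_sub_half (hx01 ω), Real.exp_pos (W ω + u ω / 2)]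
    have h2 : ∫⁻ ω, G ω ∂Pr ≤ ∫⁻ ω, ENNReal.ofReal (Real.exp (W ω)) ∂Pr +
        ∫⁻ ω, G ω * ENNReal.ofReal (u ω / 2) ∂Pr := by
      have hm : Measurable fun ω => G ω * ENNReal.ofReal (u ω / 2) :=
        hGΩ.mul (huΩ.div_const 2).ennreal_ofReal
      rw [← lintegral_add_right _ hm]
      refine lintegral_mono fun ω => ?_
      dsimp only [G]
      rw [← ENNReal.ofReal_mul (Real.exp_pos _).le, ← ENNReal.ofReal_add (Real.exp_pos _).le
          (mul_nonneg (Real.exp_pos _).le (by linarith [(hu01 ω).1]))]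
      refine ENNReal.ofReal_le_ofReal ?_
      have e : Real.exp (W ω) = Real.exp (W ω + u ω / 2) * Real.exp (-(u ω / 2)) := by
        rw [← Real.exp_add]; ring_nf
      rw [e]
      nlinarith [Real.add_one_le_exp (-(u ω / 2)), Real.exp_pos (W ω + u ω / 2)]
    rw [← hux] at h1
    exact (ENNReal.add_le_add_iff_right hfin).1 (h1.trans h2)

/-- With high probability, the sum of the expected widths is bounded in terms of the sum of the
observed widths. -/
lemma IsRun.measure_meanWidth_le (hrun : IsRun Pr mdp I s₁ K D)
    (hφm : ∀ a, Measurable fun s => I.φ s a) (hφ : ∀ s a, ‖I.φ s a‖ ≤ 1) (hlam : I.lam = 1)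
    (hH : 1 ≤ I.H) {ε : ℝ} (hε : 0 < ε) :
    Pr {ω | 2 * (∑ k ∈ Finset.range K, episodeWidth I (D ω) k + I.H * Real.log (1 / ε)) ≤
      ∑ k ∈ Finset.range K, meanWidth mdp I s₁ (D ω) k} ≤ ENNReal.ofReal ε := by
  have hH' : (0 : ℝ) < I.H := by exact_mod_cast hH
  have h1 := hrun.lintegral_exp_width_le_one hφm hφ hlam hH le_rfl
  have hm : Measurable fun ω => ENNReal.ofReal (Real.exp (∑ j ∈ Finset.range K,
      (meanWidth mdp I s₁ (D ω) j / I.H / 2 - episodeWidth I (D ω) j / I.H))) := by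
    have hD := hrun.measurableData
    refine (Real.measurable_exp.comp (Finset.measurable_sum _ fun j hj => ?_)).ennreal_ofReal
    exact (((hD.meanWidth mdp s₁ hφm hlam hH (Finset.mem_range.1 hj).le).div_const _).div_const
      _).sub ((hD.episodeWidth hφm hlam (Finset.mem_range.1 hj)).div_const _)
  have h2 := (mul_meas_ge_le_lintegral₀ (μ := Pr) hm.aemeasurable (ENNReal.ofReal (1 / ε))).trans h1
  rw [one_div, ENNReal.ofReal_inv_of_pos hε, mul_comm, ← div_eq_mul_inv,
    ENNReal.div_le_iff (by simpa using hε) (by simp), one_mul] at h2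
  refine (measure_mono fun ω hω => ?_).trans h2
  rw [Set.mem_ofPred_eq] at hω ⊢
  rw [← ENNReal.ofReal_inv_of_pos hε]
  refine ENNReal.ofReal_le_ofReal ?_
  rw [← one_div, ← Real.log_le_iff_le_exp (by positivity), Finset.sum_sub_distrib,
    ← Finset.sum_div, ← Finset.sum_div, ← Finset.sum_div, div_div, div_sub_div _ _ (by positivity)
    (by positivity), le_div_iff₀ (by positivity)]
  nlinarith

end WidthSum

/-! ### The choice of the constants -/

section Constants

variable {D M K H δ x : ℝ}

lemma half_le_log (hx : 2 ≤ x) : 1 / 2 ≤ Real.log x := by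
  have := Real.log_le_log two_pos hx
  linarith [Real.log_two_gt_d9]

lemma two_mul_mul_mul_le_div (hD : 1 ≤ D) (hM : 1 ≤ M) (hK : 1 ≤ K) (hδ : 0 < δ) (hδ1 : δ < 1) :
    2 * D * M * K ≤ 2 * D * M * K / δ :=
  le_div_self (by positivity) hδ hδ1.le

lemma log_add_le_log (hD : 1 ≤ D) (hM : 1 ≤ M) (hK : 1 ≤ K) (hx : 2 * D * M * K ≤ x) :
    Real.log (D + K) ≤ Real.log x := by
  refine Real.log_le_log (by linarith) (le_trans ?_ hx)
  have h1 : D ≤ D * K := le_mul_of_one_le_right (by linarith) hK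
  have h2 : K ≤ D * K := le_mul_of_one_le_left (by linarith) hD
  have h3 : D * K ≤ M * (D * K) := le_mul_of_one_le_left (by positivity) hM
  linarith

lemma two_le_of_le (hD : 1 ≤ D) (hM : 1 ≤ M) (hK : 1 ≤ K) (hx : 2 * D * M * K ≤ x) : 2 ≤ x := by
  have := one_le_mul_of_one_le_of_one_le (one_le_mul_of_one_le_of_one_le hD hM) hK
  linarith

/-- The union bound runs over K H pairs, but the logarithm in β does not contain H; the condition H
≤ K absorbs it. -/
lemma two_mul_mul_div_le_sq (hD : 1 ≤ D) (hM : 1 ≤ M) (hK : 1 ≤ K) (hHK : H ≤ K)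
    (hδ : 0 < δ) (hδ1 : δ < 1) : 2 * K * H / δ ≤ (2 * D * M * K / δ) ^ 2 := by
  rw [div_pow, div_le_div_iff₀ hδ (by positivity)]
  calc 2 * K * H * δ ^ 2 = 2 * K * H * (δ * δ) := by ring
    _ ≤ 2 * K * K * (1 * δ) := by gcongr
    _ = 2 * 1 ^ 2 * (K * K * δ) := by ring
    _ ≤ 4 * (D * M) ^ 2 * (K * K * δ) := by
        gcongr
        · norm_num
        · exact one_le_mul_of_one_le_of_one_le hD hM
    _ = _ := by ring

/-- Here D stands for d². The number of levels is a generous power of x, and x ≥ 2D, 2M, 2K. The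
constant 3200 = 20² · 2 · 4 below comes from squaring the bonus term against 1/(2K). -/
lemma net_error_le (hD : 1 ≤ D) (hM : 1 ≤ M) (hK : 1 ≤ K) (hx : 2 * D * M * K ≤ x) {N : ℝ}
    (hN : x ^ 20 ≤ N) :
    D * (2 * K / N) + 20 * D * √(M * Real.log x) * √(D ^ 2 * (2 / N)) ≤ 1 / K ∧
      2 / N ≤ 1 / K := by
  have hDM : 1 ≤ D * M := one_le_mul_of_one_le_of_one_le hD hM
  have hDK : 1 ≤ D * K := one_le_mul_of_one_le_of_one_le hD hK
  have hMK : 1 ≤ M * K := one_le_mul_of_one_le_of_one_le hM hK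
  have hDx : 2 * D ≤ x := by nlinarith
  have hMx : 2 * M ≤ x := by nlinarith
  have hKx : 2 * K ≤ x := by nlinarith
  have hx2 : 2 ≤ x := by linarith
  have hx0 : 0 < x := by linarith
  have hN0 : 0 < N := (pow_pos hx0 20).trans_le hN
  have hx1 : 1 ≤ x := by linarith
  have h4 : 4 * D * K ^ 2 ≤ N := by
    calc 4 * D * K ^ 2 ≤ (2 * D) * (2 * K) ^ 2 := by nlinarith [sq_nonneg K]
      _ ≤ x * x ^ 2 := by gcongr
      _ = x ^ 3 := by ring
      _ ≤ x ^ 20 := pow_le_pow_right₀ hx1 (by norm_num)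
      _ ≤ N := hN
  have h5 : 3200 * K ^ 2 * D ^ 4 * (M * Real.log x) ≤ N := by
    have hlog : Real.log x ≤ x := (Real.log_le_sub_one_of_pos hx0).trans (by linarith)
    have hlog0 : 0 ≤ Real.log x := Real.log_nonneg hx1
    calc 3200 * K ^ 2 * D ^ 4 * (M * Real.log x)
        = 3200 / 2 ^ 7 * (2 * K) ^ 2 * (2 * D) ^ 4 * (2 * M * Real.log x) := by ring
      _ ≤ 2 ^ 7 * x ^ 2 * x ^ 4 * (x * x) := by
          gcongr
          norm_num
      _ ≤ x ^ 7 * x ^ 2 * x ^ 4 * (x * x) := by gcongr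
      _ = x ^ 15 := by ring
      _ ≤ x ^ 20 := pow_le_pow_right₀ hx1 (by norm_num)
      _ ≤ N := hN
  have hlog0 : 0 ≤ Real.log x := Real.log_nonneg hx1
  have e1 : D * (2 * K / N) ≤ 1 / (2 * K) := by
    rw [mul_div_assoc', div_le_div_iff₀ hN0 (by positivity)]
    nlinarith
  have e2 : 20 * D * √(M * Real.log x) * √(D ^ 2 * (2 / N)) ≤ 1 / (2 * K) := by
    refine abs_le_of_sq_le_sq' ?_ (by positivity) |>.2
    rw [mul_pow, mul_pow, Real.sq_sqrt (by positivity), Real.sq_sqrt (by positivity), div_pow,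
      mul_div_assoc', mul_div_assoc', div_le_div_iff₀ hN0 (by positivity)]
    nlinarith
  refine ⟨?_, ?_⟩
  · have : 1 / K = 1 / (2 * K) + 1 / (2 * K) := by field_simp; norm_num
    linarith
  · rw [div_le_div_iff₀ hN0 (by positivity)]
    nlinarith

/-- N + 1 ≤ x²¹ and the exponent is at most 3 m d⁴, whence 63 = 3 · 21. -/
lemma log_card_netIndex_le {d g N m : ℕ} (hd : 1 ≤ d) (hg : g ≤ m) (hm : 1 ≤ m) (hx : 2 ≤ x)
    (hN : (N : ℝ) ≤ x ^ 20 + 1) :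
    Real.log ((N + 1 : ℝ) ^ (d ^ 2 * g + (d ^ 4 + g))) ≤ 63 * (m * (d : ℝ) ^ 4 * Real.log x) := by
  have hx1 : 1 ≤ x := by linarith
  have hlog0 : 0 ≤ Real.log x := Real.log_nonneg hx1
  have h1 : Real.log (N + 1) ≤ 21 * Real.log x := by
    have h2 : (N : ℝ) + 1 ≤ x ^ 21 := by
      have : (2 : ℝ) ≤ x ^ 20 := hx.trans (le_self_pow₀ hx1 (by norm_num))
      calc (N : ℝ) + 1 ≤ x ^ 20 * 2 := by linarith
        _ ≤ x ^ 20 * x := by gcongr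
        _ = x ^ 21 := by ring
    have := Real.log_le_log (by positivity) h2
    rwa [Real.log_pow] at this
  have h3 : ((d ^ 2 * g + (d ^ 4 + g) : ℕ) : ℝ) ≤ 3 * (m * (d : ℝ) ^ 4) := by
    have hn : d ^ 2 * g + (d ^ 4 + g) ≤ 3 * (m * d ^ 4) := by
      have a1 : d ^ 2 * g ≤ d ^ 4 * m := Nat.mul_le_mul (Nat.pow_le_pow_right hd (by norm_num)) hg
      have a2 : d ^ 4 * 1 ≤ d ^ 4 * m := Nat.mul_le_mul_left _ hm
      have a3 : 1 * g ≤ d ^ 4 * m := Nat.mul_le_mul (Nat.one_le_pow _ _ hd) hg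
      rw [mul_comm m]
      omega
    exact_mod_cast hn
  rw [Real.log_pow]
  calc ((d ^ 2 * g + (d ^ 4 + g) : ℕ) : ℝ) * Real.log (N + 1)
      ≤ 3 * (m * (d : ℝ) ^ 4) * (21 * Real.log x) :=
        mul_le_mul h3 h1 (Real.log_nonneg (by linarith [Nat.cast_nonneg (α := ℝ) N]))
          (by positivity)
    _ = _ := by ring

/-- The bound on the sum of the expected widths, multiplied by the bonus coefficient. -/
lemma bonus_mul_width_le {d : ℝ} (hd : 1 ≤ d) (hM : 1 ≤ M) (hK : 1 ≤ K) (hH : 1 ≤ H) (hδ : 0 < δ)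
    (hδ1 : δ < 1) :
    2 * (20 * d ^ 2 * H * √(M * Real.log (2 * d ^ 2 * M * K / δ))) *
        (2 * (H * √(K * (2 * (d ^ 2 * Real.log (d ^ 2 + K)))) + H * Real.log (2 / δ))) ≤
      1000 * (d ^ 3 * H ^ 2 * √(M * K)) * Real.log (2 * d * H * M * K / δ) ^ 2 := by
  set x := 2 * d ^ 2 * M * K / δ with hxdef
  set y := 2 * d * H * M * K / δ with hydef
  have hd2 : 1 ≤ d ^ 2 := one_le_pow₀ hd
  have hMK : 1 ≤ M * K := one_le_mul_of_one_le_of_one_le hM hK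
  have hx : 2 * d ^ 2 * M * K ≤ x := two_mul_mul_mul_le_div hd2 hM hK hδ hδ1
  have hdHMK : 1 ≤ d * H * M * K := one_le_mul_of_one_le_of_one_le
    (one_le_mul_of_one_le_of_one_le (one_le_mul_of_one_le_of_one_le hd hH) hM) hK
  have hδy : 2 / δ ≤ y := by
    rw [hydef]
    gcongr
    nlinarith
  have hδ2 : 2 ≤ 2 / δ := le_div_self (by norm_num) hδ hδ1.le
  have hy2 : 2 ≤ y := hδ2.trans hδy
  have hy := half_le_log hy2
  have hx2 : 2 ≤ x := two_le_of_le hd2 hM hK hx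
  -- The logarithm in β has d² where that of the theorem has d H; x ≤ y² reconciles them.
  have hlx : Real.log x ≤ 2 * Real.log y := by
    have : x ≤ y ^ 2 := by
      rw [hxdef, hydef, div_pow, div_le_div_iff₀ hδ (by positivity)]
      have h1 : d ^ 2 * (M * K) * δ ^ 2 ≤ d ^ 2 * (M * K) ^ 2 * H ^ 2 * δ := by
        calc d ^ 2 * (M * K) * δ ^ 2 = d ^ 2 * ((M * K) * 1) * 1 ^ 2 * (δ * δ) := by ring
          _ ≤ d ^ 2 * ((M * K) * (M * K)) * H ^ 2 * (1 * δ) := by gcongr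
          _ = _ := by ring
      nlinarith [mul_nonneg (mul_nonneg (sq_nonneg d) (sq_nonneg (M * K)))
        (mul_nonneg (sq_nonneg H) hδ.le)]
    have := Real.log_le_log (by linarith) this
    rwa [Real.log_pow, Nat.cast_two] at this
  have hlx0 : 0 ≤ Real.log x := Real.log_nonneg (by linarith)
  have hldK : Real.log (d ^ 2 + K) ≤ Real.log x := log_add_le_log hd2 hM hK hx
  have hlδ : Real.log (2 / δ) ≤ Real.log y := Real.log_le_log (by positivity) hδy
  set L := Real.log y
  set Lx := Real.log x
  have s1 : √(M * Lx) ≤ √M * (2 * L) := by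
    rw [Real.sqrt_le_left (by positivity), mul_pow, Real.sq_sqrt (by positivity)]
    gcongr
    nlinarith
  have s2 : √(M * Lx) * √(K * (2 * (d ^ 2 * Real.log (d ^ 2 + K)))) ≤
      d * √(M * K) * (2 * (2 * L)) := by
    rw [← Real.sqrt_mul (by positivity), Real.sqrt_le_left (by positivity), mul_pow, mul_pow,
      Real.sq_sqrt (by positivity)]
    calc M * Lx * (K * (2 * (d ^ 2 * Real.log (d ^ 2 + K))))
        ≤ M * (2 * L) * (K * (2 * (d ^ 2 * (2 * L)))) := by
          have t1 : Real.log (d ^ 2 + K) ≤ 2 * L := hldK.trans hlx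
          have t2 : 0 ≤ Real.log (d ^ 2 + K) := Real.log_nonneg (by linarith)
          gcongr
      _ ≤ _ := by
          have : 0 ≤ d ^ 2 * (M * K) * L ^ 2 := by positivity
          nlinarith
  have s3 : √M ≤ √(M * K) := Real.sqrt_le_sqrt (by nlinarith)
  have hd23 : d ^ 2 ≤ d ^ 3 := pow_le_pow_right₀ hd (by norm_num)
  calc 2 * (20 * d ^ 2 * H * √(M * Lx)) *
        (2 * (H * √(K * (2 * (d ^ 2 * Real.log (d ^ 2 + K)))) + H * Real.log (2 / δ)))
      = 80 * d ^ 2 * H ^ 2 * (√(M * Lx) * √(K * (2 * (d ^ 2 * Real.log (d ^ 2 + K))))) +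
        80 * d ^ 2 * H ^ 2 * √(M * Lx) * Real.log (2 / δ) := by ring
    _ ≤ 80 * d ^ 2 * H ^ 2 * (d * √(M * K) * (2 * (2 * L))) +
        80 * d ^ 3 * H ^ 2 * (√(M * K) * (2 * L)) * L := by
        have t0 : 0 ≤ Real.log (2 / δ) := Real.log_nonneg (by linarith)
        have t1 : √(M * Lx) ≤ √(M * K) * (2 * L) := s1.trans (by gcongr)
        gcongr
    _ = d ^ 3 * H ^ 2 * √(M * K) * (320 * L + 160 * L ^ 2) := by ring
    -- L ≥ 1/2 gives 320 L ≤ 640 L².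
    _ ≤ d ^ 3 * H ^ 2 * √(M * K) * (1000 * L ^ 2) := by
        gcongr
        nlinarith
    _ = _ := by ring

end Constants

/-! ### The regret bound. -/

section Main

variable {Ω S A : Type*} [mΩ : MeasurableSpace Ω] [MeasurableSpace S] [MeasurableSpace A]
  [MeasurableSingletonClass A] [Fintype A] [Nonempty A] {d : ℕ} {Pr : Measure Ω}
  [IsProbabilityMeasure Pr] {mdp : MDP S A} {I : Input S A d} {s₁ : ℕ → S} {M K : ℕ}
  {D : Ω → Data S A} {δ z₀ η : ℝ}

lemma card_uniformGrid_le (z₀ η : ℝ) (M : ℕ) : (uniformGrid z₀ η M).card ≤ M :=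
  Finset.card_image_le.trans (Finset.card_range M).le

lemma IsDiscretizedLinear.one_le_dim {H : ℕ} {φ : S → A → EuclideanSpace ℝ (Fin d)}
    {G : Finset ℝ} (hlin : IsDiscretizedLinear mdp H φ G s₁) (hH : 1 ≤ H) : 1 ≤ d := by
  rw [Nat.one_le_iff_ne_zero]
  rintro rfl
  obtain ⟨μ, -, h⟩ := hlin.trans_linear 0 hH
  have h1 := h (s₁ 0) (Classical.arbitrary A) Set.univ MeasurableSet.univ
  have := mdp.trans_markov 0
  rw [probReal_univ, Subsingleton.elim (φ (s₁ 0) (Classical.arbitrary A)) 0, inner_zero_left] at h1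
  exact one_ne_zero h1

/-- With high probability, the estimates of all episodes are accurate. -/
lemma IsRun.measure_not_isAccurate_le (hrun : IsRun Pr mdp I s₁ K D)
    (hlin : IsDiscretizedLinear mdp I.H I.φ I.grid s₁)
    (htie : ∀ T : Finset A, T.Nonempty → I.tieA T ∈ T) (hlam : I.lam = 1) (hH : 1 ≤ I.H)
    (hM : 1 ≤ M) (hcard : I.grid.card ≤ M) (hK : 1 ≤ K) (hHK : I.H ≤ K) (hδ : 0 < δ) (hδ1 : δ < 1)
    (hβ : I.β = betaCoeff 20 d I.H M K δ) :
    Pr {ω | ¬ ∀ k < K, IsAccurate mdp I (D ω) k} ≤ ENNReal.ofReal (δ / 2) := by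
  have hd := hlin.one_le_dim hH
  have hdr : (1 : ℝ) ≤ d := by exact_mod_cast hd
  have hMr : (1 : ℝ) ≤ M := by exact_mod_cast hM
  have hKr : (1 : ℝ) ≤ K := by exact_mod_cast hK
  have hHr : (1 : ℝ) ≤ I.H := by exact_mod_cast hH
  have hHKr : (I.H : ℝ) ≤ K := by exact_mod_cast hHK
  have hD : (1 : ℝ) ≤ (d : ℝ) ^ 2 := one_le_pow₀ hdr
  set x : ℝ := 2 * (d : ℝ) ^ 2 * M * K / δ with hx
  have hxle : 2 * (d : ℝ) ^ 2 * M * K ≤ x := two_mul_mul_mul_le_div hD hMr hKr hδ hδ1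
  have hx2 : 2 ≤ x := two_le_of_le hD hMr hKr hxle
  have hL := half_le_log hx2
  set L := Real.log x with hLdef
  set N := ⌈x ^ 20⌉₊ with hNdef
  have hxN : x ^ 20 ≤ N := Nat.le_ceil _
  have hNx : (N : ℝ) ≤ x ^ 20 + 1 := (Nat.ceil_lt_add_one (by positivity)).le
  have hN0 : 0 < N := by
    have : (0 : ℝ) < N := (by positivity : 0 < x ^ 20).trans_le hxN
    exact_mod_cast this
  obtain ⟨hε, hε'⟩ := net_error_le hD hMr hKr hxle hxN
  set n := Fintype.card (NetIndex d (rewardGrid I.grid) N) with hn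
  have hn_eq : (n : ℝ) = (N + 1 : ℝ) ^ (d ^ 2 * (rewardGrid I.grid).card +
      (d ^ 4 + (rewardGrid I.grid).card)) := by
    rw [hn, card_netIndex]
    push_cast
    rfl
  have hg : (rewardGrid I.grid).card ≤ M := (Finset.card_filter_le _ _).trans hcard
  have hlogn : Real.log n ≤ 63 * (M * (d : ℝ) ^ 4 * L) := by
    rw [hn_eq]
    exact log_card_netIndex_le hd hg hM hx2 hNx
  have hn0 : (0 : ℝ) < n := by rw [hn_eq]; positivity
  -- Failure probability allotted to each episode, step and net function, so that the union bound
  -- gives δ/2.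
  set p : ℝ := δ / (2 * (K * I.H * n)) with hp
  have hp0 : 0 < p := by positivity
  have hbase : L ≤ M * (d : ℝ) ^ 4 * L :=
    le_mul_of_one_le_left (by linarith) (one_le_mul_of_one_le_of_one_le hMr (one_le_pow₀ hdr))
  have hlogp : Real.log (1 / p) ≤ 65 * (M * (d : ℝ) ^ 4 * L) := by
    have e : 1 / p = 2 * K * I.H / δ * n := by
      rw [hp]
      field_simp
    have h1 : 2 * K * I.H / δ ≤ x ^ 2 := two_mul_mul_div_le_sq hD hMr hKr hHKr hδ hδ1
    have h2 := Real.log_le_log (by positivity) h1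
    rw [Real.log_pow, Nat.cast_two] at h2
    rw [e, Real.log_mul (by positivity) hn0.ne']
    linarith
  -- The noise bound needs ρ² ≥ (1 + 2 · 65) M d⁴ L, and 12² = 144 is enough.
  set ρ : ℝ := 12 * ((d : ℝ) ^ 2 * √(M * L)) with hρ
  have hML : (1 : ℝ) / 2 ≤ M * L := hL.trans (le_mul_of_one_le_left (by linarith) hMr)
  have hρ2 : (d : ℝ) ^ 2 * Real.log ((d : ℝ) ^ 2 + K) + 2 * Real.log (1 / p) ≤ ρ ^ 2 := by
    have e : ρ ^ 2 = 144 * (M * (d : ℝ) ^ 4 * L) := by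
      rw [hρ, mul_pow, mul_pow, Real.sq_sqrt (by positivity)]
      ring
    have h1 : Real.log ((d : ℝ) ^ 2 + K) ≤ L := log_add_le_log hD hMr hKr hxle
    have h2 : (d : ℝ) ^ 2 * Real.log ((d : ℝ) ^ 2 + K) ≤ M * (d : ℝ) ^ 4 * L := by
      have h3 : (d : ℝ) ^ 2 ≤ M * (d : ℝ) ^ 4 :=
        (pow_le_pow_right₀ hdr (by norm_num)).trans (le_mul_of_one_le_left (by positivity) hMr)
      calc (d : ℝ) ^ 2 * Real.log ((d : ℝ) ^ 2 + K) ≤ (d : ℝ) ^ 2 * L := by gcongr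
        _ ≤ _ := by gcongr
    linarith
  have hb : I.β / I.H = 20 * (d : ℝ) ^ 2 * √(M * L) := by
    rw [hβ, betaCoeff, ← hx, ← hLdef]
    field_simp
  have hβ0 : 0 ≤ I.β := by
    rw [hβ, betaCoeff]
    positivity
  have hbound : I.H * (ρ + K * (2 * (1 / K)) + 2 * (d : ℝ) ^ 2) ≤ I.β := by
    have h1 : (1 : ℝ) / 2 ≤ √(M * L) := Real.le_sqrt_of_sq_le (by linarith)
    have h2 : (K : ℝ) * (2 * (1 / K)) = 2 := by field_simp
    rw [h2, hβ, betaCoeff, ← hx, ← hLdef, hρ]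
    -- Since √(M L) ≥ 1/2, the terms 2 + 2d² ≤ 4d² fit into the remaining 8 d² √(M L); this fixes
    -- the coefficient 20.
    have h3 : 12 * ((d : ℝ) ^ 2 * √(M * L)) + 2 + 2 * (d : ℝ) ^ 2 ≤
        20 * (d : ℝ) ^ 2 * √(M * L) := by
      have := mul_le_mul_of_nonneg_left h1 (by positivity : 0 ≤ (d : ℝ) ^ 2)
      linarith
    calc I.H * (12 * ((d : ℝ) ^ 2 * √(M * L)) + 2 + 2 * (d : ℝ) ^ 2)
        ≤ I.H * (20 * (d : ℝ) ^ 2 * √(M * L)) := by gcongr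
      _ = _ := by ring
  have hprob := hrun.measure_not_concentrationEvent_le hlin (I.β / I.H) K N hp0 (by positivity) hρ2
  have hpδ : K * (I.H * (n * p)) = δ / 2 := by
    rw [hp]
    field_simp
  rw [hpδ] at hprob
  refine (measure_mono fun ω hω => ?_).trans hprob
  rw [Set.mem_ofPred_eq] at hω ⊢
  refine fun hcon => hω fun k hk => ?_
  have hkK : (k : ℝ) ≤ K := by exact_mod_cast hk.le
  -- Scaled weights are at most k ≤ K, and accuracy 1/K makes the total approximation error over k
  -- samples at most 2.
  refine isAccurate_of_concentrationEvent (R := K) (ε := 1 / K) (N := N) hlin htie hlam hH hβ0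
    (by positivity) hN0 ?_ hε' (hcon k hk) (le_trans ?_ hbound) hkK
  · rw [hb]
    convert hε using 4
    ring
  · gcongr

/-- The regret bound of `RSRL-Linear-CVaR`, with explicit constants. -/
theorem IsRun.measure_regret_le (hrun : IsRun Pr mdp I s₁ K D)
    (hgrid : I.grid = uniformGrid z₀ η M) (hη : 0 < η)
    (hlin : IsDiscretizedLinear mdp I.H I.φ I.grid s₁)
    (htieA : ∀ T : Finset A, T.Nonempty → I.tieA T ∈ T)
    (htieB : ∀ T : Finset ℝ, T.Nonempty → I.tieB T ∈ T) (hlam : I.lam = 1) (hH : 1 ≤ I.H)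
    (hK : 1 ≤ K) (hτ : 0 < I.τ) (hτ1 : I.τ ≤ 1) (hδ : 0 < δ) (hδ1 : δ < 1)
    (hβ : I.β = betaCoeff 20 d I.H M K δ) :
    Pr {ω | 1000 * (I.τ⁻¹ * (d : ℝ) ^ 3 * (I.H : ℝ) ^ 2 * √((M : ℝ) * K)) *
      Real.log (2 * d * I.H * M * K / δ) ^ 2 < regret mdp I s₁ K (D ω)} ≤ ENNReal.ofReal δ := by
  have hcard : I.grid.card ≤ M := hgrid ▸ card_uniformGrid_le z₀ η M
  have h0 : (0 : ℝ) ∈ I.grid := by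
    rw [hgrid] at hlin ⊢
    exact hlin.zero_mem_grid hη hH
  have hM : 1 ≤ M := (Finset.card_pos.2 ⟨0, h0⟩).trans_le hcard
  have hd := hlin.one_le_dim hH
  have hdr : (1 : ℝ) ≤ d := by exact_mod_cast hd
  have hMr : (1 : ℝ) ≤ M := by exact_mod_cast hM
  have hKr : (1 : ℝ) ≤ K := by exact_mod_cast hK
  have hHr : (1 : ℝ) ≤ I.H := by exact_mod_cast hH
  have hτi : 1 ≤ I.τ⁻¹ := (one_le_inv₀ hτ).2 hτ1
  -- For K > H² one has H ≤ K, as the concentration bound requires. Otherwise √K ≤ H and the regret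
  -- is at most K H ≤ H² √K.
  rcases lt_or_ge ((I.H : ℝ) ^ 2) K with hHK | hHK
  · have hHK' : I.H ≤ K := by
      have : (I.H : ℝ) ≤ K := by nlinarith
      exact_mod_cast this
    have p1 := hrun.measure_not_isAccurate_le hlin htieA hlam hH hM hcard hK hHK' hδ hδ1 hβ
    have p2 := hrun.measure_meanWidth_le hlin.feature_measurable hlin.feature_norm hlam hH
      (half_pos hδ)
    have hβ0 : 0 ≤ I.β := by
      rw [hβ, betaCoeff]
      positivity
    calc _ ≤ Pr ({ω | ¬ ∀ k < K, IsAccurate mdp I (D ω) k} ∪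
          {ω | 2 * (∑ k ∈ Finset.range K, episodeWidth I (D ω) k +
            I.H * Real.log (1 / (δ / 2))) ≤ ∑ k ∈ Finset.range K, meanWidth mdp I s₁ (D ω) k}) := by
          refine measure_mono fun ω hω => ?_
          by_contra hcon
          rw [Set.mem_union, not_or] at hcon
          obtain ⟨hacc, hw⟩ := hcon
          rw [Set.mem_ofPred_eq, not_not] at hacc
          rw [Set.mem_ofPred_eq, not_le] at hw
          rw [Set.mem_ofPred_eq] at hω
          refine absurd hω (not_lt.2 ?_)
          have hE := sum_episodeWidth_le hlam hlin.feature_norm (D ω) K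
          have hδ2 : 1 / (δ / 2) = 2 / δ := by rw [one_div_div]
          rw [hδ2] at hw
          have harith := bonus_mul_width_le hdr hMr hKr hHr hδ hδ1
          have hβ' : 20 * (d : ℝ) ^ 2 * I.H * √(M * Real.log (2 * (d : ℝ) ^ 2 * M * K / δ)) =
            I.β := hβ.symm
          rw [hβ'] at harith
          calc regret mdp I s₁ K (D ω)
              ≤ ∑ k ∈ Finset.range K, I.τ⁻¹ * (2 * I.β * meanWidth mdp I s₁ (D ω) k) :=
                Finset.sum_le_sum fun k hk => (hacc k (Finset.mem_range.1 hk)).optCVaR_sub_cvar_le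
                  hlin h0 htieA htieB hlam hH hβ0 hτ hτ1 k
            _ = I.τ⁻¹ * (2 * I.β * ∑ k ∈ Finset.range K, meanWidth mdp I s₁ (D ω) k) := by
                rw [Finset.mul_sum, Finset.mul_sum]
            _ ≤ I.τ⁻¹ * (2 * I.β * (2 * (I.H * √(K * (2 * ((d : ℝ) ^ 2 *
                  Real.log ((d : ℝ) ^ 2 + K)))) + I.H * Real.log (2 / δ)))) := by
                gcongr
                exact hw.le.trans (by gcongr)
            _ ≤ I.τ⁻¹ * (1000 * ((d : ℝ) ^ 3 * I.H ^ 2 * √(M * K)) *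
                  Real.log (2 * d * I.H * M * K / δ) ^ 2) := by gcongr
            _ = _ := by ring
      _ ≤ ENNReal.ofReal (δ / 2) + ENNReal.ofReal (δ / 2) :=
          (measure_union_le _ _).trans (add_le_add p1 p2)
      _ = ENNReal.ofReal δ := by
          rw [← ENNReal.ofReal_add (by positivity) (by positivity), add_halves]
  · have hempty : ∀ ω, regret mdp I s₁ K (D ω) ≤
        1000 * (I.τ⁻¹ * (d : ℝ) ^ 3 * (I.H : ℝ) ^ 2 * √((M : ℝ) * K)) *
          Real.log (2 * d * I.H * M * K / δ) ^ 2 := by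
      intro ω
      have hlog : (1 : ℝ) / 2 ≤ Real.log (2 * d * I.H * M * K / δ) := by
        refine half_le_log (le_trans ?_ (le_div_self (by positivity) hδ hδ1.le))
        have : (1 : ℝ) ≤ d * I.H * M * K := one_le_mul_of_one_le_of_one_le
          (one_le_mul_of_one_le_of_one_le (one_le_mul_of_one_le_of_one_le hdr hHr) hMr) hKr
        linarith
      have hsqrt : √(K : ℝ) ≤ I.H := (Real.sqrt_le_left (by positivity)).2 hHK
      have h1 : (1 : ℝ) ≤ 1000 * Real.log (2 * d * I.H * M * K / δ) ^ 2 := by nlinarith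
      have hd3 : (1 : ℝ) ≤ (d : ℝ) ^ 3 := one_le_pow₀ hdr
      calc regret mdp I s₁ K (D ω)
          ≤ ∑ _k ∈ Finset.range K, (I.H : ℝ) := Finset.sum_le_sum fun k _ =>
            optCVaR_sub_cvar_le_horizon hτ hτ1 I.H (s₁ k)
              (isMeasurable_augPolicy hlin.feature_measurable hlam hH (D ω) k _)
        _ = √(K : ℝ) * √(K : ℝ) * I.H := by simp
        _ ≤ I.H * √((M : ℝ) * K) * I.H := by
            gcongr
            exact le_mul_of_one_le_left (by positivity) hMr
        _ = 1 * 1 * (I.H : ℝ) ^ 2 * √((M : ℝ) * K) * 1 := by ring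
        _ ≤ I.τ⁻¹ * (d : ℝ) ^ 3 * (I.H : ℝ) ^ 2 * √((M : ℝ) * K) *
            (1000 * Real.log (2 * d * I.H * M * K / δ) ^ 2) := by gcongr
        _ = _ := by ring
    rw [show {ω | _ < regret mdp I s₁ K (D ω)} = (∅ : Set Ω) from
      Set.eq_empty_of_forall_notMem fun ω hω => absurd hω (not_lt.2 (hempty ω))]
    simp

end Main

end RiskRL

end

theorem theorem7 :
    ∃ (c C : ℝ) (p : ℕ), 0 < c ∧ 0 < C ∧
      ∀ (S A Ω : Type*) [MeasurableSpace S] [MeasurableSpace A] [MeasurableSingletonClass A]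
        [Fintype A] [MeasurableSpace Ω] (Pr : MeasureTheory.Measure Ω)
        [MeasureTheory.IsProbabilityMeasure Pr]
        (d H M K : ℕ) (τ δ z₀ η : ℝ)
        (mdp : RiskRL.MDP S A) (φ : S → A → EuclideanSpace ℝ (Fin d)) (s₁ : ℕ → S)
        (tieA : Finset A → A) (tieB : Finset ℝ → ℝ) (D : Ω → RiskRL.Data S A),
        1 ≤ H → 1 ≤ K → 0 < τ → τ ≤ 1 → 0 < δ → δ < 1 → 0 < η →
        RiskRL.IsDiscretizedLinear mdp H φ (RiskRL.uniformGrid z₀ η M) s₁ →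
        (∀ T : Finset A, T.Nonempty → tieA T ∈ T) →
        (∀ T : Finset ℝ, T.Nonempty → tieB T ∈ T) →
        let I : RiskRL.Input S A d :=
          { H := H, φ := φ, grid := RiskRL.uniformGrid z₀ η M, τ := τ,
            β := RiskRL.betaCoeff c d H M K δ, lam := 1, tieA := tieA, tieB := tieB }
        RiskRL.IsRun Pr mdp I s₁ K D →
        Pr {ω | C * (τ⁻¹ * (d : ℝ) ^ 3 * (H : ℝ) ^ 2 * √((M : ℝ) * K)) *
              Real.log (2 * d * H * M * K / δ) ^ p < RiskRL.regret mdp I s₁ K (D ω)}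
          ≤ ENNReal.ofReal δ := by
  refine ⟨20, 1000, 2, by norm_num, by norm_num, ?_⟩
  intro S A Ω _ _ _ _ _ Pr _ d H M K τ δ z₀ η mdp φ s₁ tieA tieB D hH hK hτ hτ1 hδ hδ1 hη hlin
    htieA htieB I hrun
  have : Nonempty Ω := nonempty_of_isProbabilityMeasure Pr
  -- An action exists because the data contain one at every sample point, and Ω carries a
  -- probability measure.
  have : Nonempty A := ⟨(D (Classical.arbitrary Ω)).ac 0 0⟩
  exact hrun.measure_regret_le (I := I) rfl hη hlin htieA htieB rfl hH hK hτ hτ1 hδ hδ1 rfl
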